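/- **Setting.** Let $\mathcal G$ be a finite trivalent graph cellularly embedded in a compact oriented surface, possibly with boundary, such that the boundary circles are made of edges of $\mathcal G$ (boundary edges) and every vertex, including the boundary vertices, is trivalent. Assume that no face borders itself along an edge, that every face has at most one boundary edge, and that no two boundary vertices are joined to the same bulk vertex. The faces ("plaquettes") $p$ carry Ising spins $\tau^z_p=\pm1$; a plaquette with a boundary edge is a boundary plaquette, the others are bulk plaquettes. Two boundary plaquettes are nearest neighbours if they share a boundary vertex. Every non-boundary edge $l$ carries a complex fermion $c_l$. Blow up each non-boundary vertex into a triangle to obtain $\mathcal G'$, and fix a Kasteleyn orientation of $\mathcal G'$ (an odd number of clockwise edges around each plaquette and each triangle); $s_{jk}=1$ if the edge $jk$ is oriented from $j$ to $k$, and $-1$ otherwise. An edge $l$ oriented from $j$ to $k$ gives Majorana operators $\gamma_j=c_l+c_l^\dagger$, $\gamma_k=i(c_l^\dagger-c_l)$ on the vertices of $\mathcal G'$. A triangle gets the majority spin of its three adjacent plaquettes. A spin configuration $c$ determines a dimer cover $\mathcal D(c)$: a non-boundary edge of $\mathcal G$ (type I) is covered iff its two bordering faces have equal spins, a triangle edge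 (type II) iff its two bordering faces have opposite spins; boundary edges are never covered. $\mathcal V^c$ is the space of states whose component along each spin configuration $c$ satisfies $i s_{jk}\gamma_j\gamma_k=1$ for all $jk\in\mathcal D(c)$. Let $P_{jk}=\frac12(1+is_{jk}\gamma_j\gamma_k)$ and let $c_p$ be $c$ with the spin at $p$ flipped. Define $$F_p=\sum_c X_{p,c}\otimes \tau^x_p P_c,\qquad X_{p,c}=2^{(n-1)/2}\prod_{jk\in\mathcal D(c_p)\setminus\mathcal D(c)}P_{jk},$$ where $P_c$ is the projector onto $c$, and $n$ is determined by the number of vertices of the loop or open string $\mathcal D(c)+\mathcal D(c_p)$ (symmetric difference), which is $2n$ or $2n-1$. Let $$H_{bulk}=-\sum_{p\ \mathrm{bulk}}F_p-\sum_{c}\Big(\sum_{jk\in\mathcal D(c)} i s_{jk}\gamma_j\gamma_k\Big)\otimes P_c .$$ $H_{bulk}$ conserves the boundary spins. Its boundary ground-state manifold is the span, over all boundary spin configurations $b$, of the eigenvectors of $H_{bulk}$ of lowest eigenvalue among the states of $\mathcal V^c$ with boundary spins $b$. **Proposition.** Every $F_p$ maps $\mathcal V^c$ into itself, and on $\mathcal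 V^c$: 1. $F_pF_q=F_qF_p$ whenever at most one of $p,q$ is a boundary plaquette. 2. $F_pF_q=F_qF_p$ whenever $p,q$ are boundary plaquettes that are not nearest neighbours. 3. $F_pF_q\ne F_qF_p$ whenever $p,q$ are nearest-neighbour boundary plaquettes that share exactly one boundary vertex (that is, on a boundary circle with at least three plaquettes). Moreover, for every boundary plaquette $p$, $F_p$ maps the boundary ground-state manifold of $H_{bulk}$ into itself. -/

import Mathlib

noncomputable section

/-- A trivalent graph cellularly embedded in a closed oriented surface, as a rotation system.
`E` is the set of edges, each with a chosen direction: the half-edge `(e, false)` sits at the tail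
of `e` and `(e, true)` at its head.  `rot` sends a half-edge to the next one counterclockwise around
its vertex, so the vertices are the cycles of `rot`, all of length three. -/
structure TrivalentMap (E : Type*) where
  rot : Equiv.Perm (E × Bool)
  rot_ne : ∀ d, rot d ≠ d
  rot_rot_rot : ∀ d, rot (rot (rot d)) = d

namespace TrivalentMap

variable {E : Type*} (M : TrivalentMap E)

/-- The opposite half-edge of the same edge. -/
def rev : Equiv.Perm (E × Bool) where
  toFun d := (d.1, !d.2)
  invFun d := (d.1, !d.2)
  left_inv d := by simp
  right_inv d := by simp

/-- Follow the half-edge `d` to the other end of its edge and continue along the face that lies to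
the left of `d`.  The cycles are the faces, traversed counterclockwise. -/
def facePerm : Equiv.Perm (E × Bool) := M.rot⁻¹ * rev

/-- The faces of the embedded graph. -/
def Face : Type _ := Quotient (Equiv.Perm.SameCycle.setoid M.facePerm)

/-- The face to the left of the half-edge `d`.  Around the vertex of `d` it is the face that fills
the sector between `d` and `rot d`; the face to the right of `d` is `face (rev d)`. -/
def face (d : E × Bool) : M.Face := Quotient.mk _ d

/-- Two half-edges emanate from the same vertex. -/
def SameVertex (d d' : E × Bool) : Prop := M.rot.SameCycle d d'

theorem face_rev (d : E × Bool) : M.face (rev d) = M.face (M.rot (M.rot d)) := by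
  refine Quotient.sound (s := Equiv.Perm.SameCycle.setoid M.facePerm) ⟨1, ?_⟩
  rw [zpow_one]
  change M.rot⁻¹ (rev (rev d)) = _
  rw [Equiv.Perm.inv_eq_iff_eq, M.rot_rot_rot]
  simp [rev]

end TrivalentMap

/-- A compact oriented surface, possibly with boundary, covered by the faces of a trivalent graph.
The surface is obtained from a closed one by deleting the faces in `hole`; the edges of the deleted
faces are the boundary edges. -/
structure TrivalentSurface (E : Type*) extends TrivalentMap E where
  hole : Set toTrivalentMap.Face
  /-- At most one of the three sectors at a vertex is deleted, so the boundary is a disjoint union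
  of simple closed curves. -/
  hole_disjoint : ∀ d, toTrivalentMap.face d ∈ hole → toTrivalentMap.face (rot d) ∉ hole
  /-- No face borders itself along an edge. -/
  face_ne : ∀ d, toTrivalentMap.face d ≠ toTrivalentMap.face (TrivalentMap.rev d)
  /-- A face has at most one boundary edge. -/
  boundary_edge_unique : ∀ d d', toTrivalentMap.face d = toTrivalentMap.face d' →
    toTrivalentMap.face (TrivalentMap.rev d) ∈ hole →
    toTrivalentMap.face (TrivalentMap.rev d') ∈ hole → d = d'
  /-- No two boundary vertices are joined to the same vertex: if `rot d` bounds a deleted sector on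
  its left, then `d` is the half-edge that leads from a boundary vertex into the surface. -/
  boundary_neighbor_unique : ∀ d d', toTrivalentMap.face (rot d) ∈ hole →
    toTrivalentMap.face (rot d') ∈ hole →
    toTrivalentMap.SameVertex (TrivalentMap.rev d) (TrivalentMap.rev d') → d = d'

namespace TrivalentSurface

open TrivalentMap

variable {E : Type*} (S : TrivalentSurface E)

/-- The edge `e` is not a boundary edge. -/
def IsInterior (e : E) : Prop := S.face (e, false) ∉ S.hole ∧ S.face (e, true) ∉ S.hole

/-- The vertex of `d` is not on the boundary. -/
def IsBulkVertex (d : E × Bool) : Prop :=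
  S.face d ∉ S.hole ∧ S.face (S.rot d) ∉ S.hole ∧ S.face (S.rot (S.rot d)) ∉ S.hole

theorem IsBulkVertex.next {d : E × Bool} (h : S.IsBulkVertex d) : S.IsBulkVertex (S.rot d) :=
  ⟨h.2.1, h.2.2, by rw [S.rot_rot_rot]; exact h.1⟩

theorem IsBulkVertex.isInterior {d : E × Bool} (h : S.IsBulkVertex d) : S.IsInterior d.1 := by
  obtain ⟨e, b⟩ := d
  have h1 := h.1
  have h2 := h.2.2
  rw [← S.face_rev] at h2
  cases b
  · exact ⟨h1, h2⟩
  · exact ⟨h2, h1⟩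

/-- Faces of the surface; each carries an Ising spin. -/
def Plaquette : Type _ := {f : S.Face // f ∉ S.hole}

/-- The non-boundary edges; each carries a complex fermion. -/
def InteriorEdge : Type _ := {e : E // S.IsInterior e}

/-- The half-edges of the non-boundary edges.  They are the vertices of the decorated graph, in which
every vertex not on the boundary is blown up into a triangle: the three half-edges at such a vertex
are the corners of its triangle, and a boundary vertex has exactly one non-boundary half-edge.
Each site carries a Majorana fermion. -/
def Site : Type _ := {d : E × Bool // S.IsInterior d.1}

/-- The half-edges at the non-boundary vertices.  The element `d` stands for the triangle edge
between `d` and `rot d`, which separates the triangle from the face `face d`. -/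
def Corner : Type _ := {d : E × Bool // S.IsBulkVertex d}

/-- A plaquette with a boundary edge. -/
def IsBoundary (p : S.Plaquette) : Prop := ∃ d, S.face d = p.1 ∧ S.face (rev d) ∈ S.hole

/-- The boundary vertices shared by `p` and `q`, each given by the half-edge `d` that leads from it
into the surface (and separates the two plaquettes at that vertex). -/
def sharedBoundaryVertices (p q : S.Plaquette) : Set (E × Bool) :=
  {d | S.face (S.rot d) ∈ S.hole ∧
    ((S.face d = p.1 ∧ S.face (rev d) = q.1) ∨ (S.face d = q.1 ∧ S.face (rev d) = p.1))}

/-- Plaquettes that are consecutive along the boundary. -/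
def NearestNeighbors (p q : S.Plaquette) : Prop := (S.sharedBoundaryVertices p q).Nonempty

end TrivalentSurface

/-- A trivalent surface with a Kasteleyn orientation of the decorated graph.  The edges inherited from
the trivalent graph are directed as they are in `E`, from `(e, false)` to `(e, true)`; the triangle
edge `d` is directed from `d` to `rot d` if `forward d = true`, and from `rot d` to `d` otherwise. -/
structure TFLattice (E : Type*) extends TrivalentSurface E where
  forward : toTrivalentSurface.Corner → Bool
  /-- Each triangle has an odd number of clockwise edges. -/
  kasteleyn_triangle : ∀ x : toTrivalentSurface.Corner,
    Odd {y : toTrivalentSurface.Corner |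
      toTrivalentMap.SameVertex x.1 y.1 ∧ forward y = false}.ncard
  /-- Each plaquette of the decorated graph has an odd number of clockwise edges.  The first term
  counts inherited edges (including boundary edges), the second counts triangle edges: the edge from
  `d` to `rot d` runs counterclockwise around its triangle, hence clockwise around the plaquette. -/
  kasteleyn_plaquette : ∀ p : toTrivalentSurface.Plaquette,
    Odd ({d : E × Bool | toTrivalentMap.face d = p.1 ∧ d.2 = true}.ncard +
      {x : toTrivalentSurface.Corner | toTrivalentMap.face x.1 = p.1 ∧ forward x = true}.ncard)

namespace TFLattice

open TrivalentMap TrivalentSurface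

open scoped Classical

variable {E : Type*} (L : TFLattice E)

instance [Finite E] : Finite L.Plaquette :=
  haveI : Finite L.Face := Quotient.finite _
  Subtype.finite

instance [Finite E] : Finite L.InteriorEdge := Subtype.finite

instance [Finite E] : Finite L.Corner := Subtype.finite

instance [Finite E] : Finite L.Site := Subtype.finite

instance [Finite E] : Fintype L.Plaquette := Fintype.ofFinite _

instance [Finite E] : Fintype L.Site := Fintype.ofFinite _

/-- The edges of the decorated graph that can carry a dimer: non-boundary edges of the trivalent
graph (type I) and triangle edges (type II). -/
abbrev Link : Type _ := L.InteriorEdge ⊕ L.Corner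

instance [Finite E] : Fintype L.Link := Fintype.ofFinite _

/-- The site at which a link starts, according to its orientation. -/
def tail : L.Link → L.Site
  | .inl e => ⟨(e.1, false), e.2⟩
  | .inr x => if L.forward x then ⟨x.1, x.2.isInterior⟩
      else ⟨L.rot x.1, x.2.next.isInterior⟩

/-- The site at which a link ends, according to its orientation. -/
def head : L.Link → L.Site
  | .inl e => ⟨(e.1, true), e.2⟩
  | .inr x => if L.forward x then ⟨L.rot x.1, x.2.next.isInterior⟩
      else ⟨x.1, x.2.isInterior⟩

/-! ### Fermions -/

/-- The fermionic Fock space with one mode for each non-boundary edge. -/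
abbrev Fock : Type _ := ExteriorAlgebra ℂ (L.InteriorEdge → ℂ)

/-- The creation operator of the mode `e`. -/
def create (e : L.InteriorEdge) : Module.End ℂ L.Fock :=
  LinearMap.mulLeft ℂ (ExteriorAlgebra.ι ℂ (Pi.single e 1))

/-- The annihilation operator of the mode `e`. -/
def annihilate (e : L.InteriorEdge) : Module.End ℂ L.Fock :=
  CliffordAlgebra.contractLeft (Q := (0 : QuadraticForm ℂ (L.InteriorEdge → ℂ)))
    (LinearMap.proj e)

/-- The Majorana operators: `c + c†` at the tail and `i (c† - c)` at the head of an edge. -/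
def majorana (x : L.Site) : Module.End ℂ L.Fock :=
  if x.1.2 = false then L.annihilate ⟨x.1.1, x.2⟩ + L.create ⟨x.1.1, x.2⟩
  else Complex.I • (L.create ⟨x.1.1, x.2⟩ - L.annihilate ⟨x.1.1, x.2⟩)

/-- The operator `i s_{jk} γ_j γ_k` of the link `jk`. -/
def bond (l : L.Link) : Module.End ℂ L.Fock :=
  Complex.I • (L.majorana (L.tail l) * L.majorana (L.head l))

/-- The projector `P_{jk} = (1 + i s_{jk} γ_j γ_k) / 2`. -/
def linkProj (l : L.Link) : Module.End ℂ L.Fock := (1 / 2 : ℂ) • (1 + L.bond l)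

/-! ### Spins and dimers -/

/-- Ising spin configurations. -/
abbrev Config : Type _ := L.Plaquette → Bool

/-- The configuration with the spin at `p` flipped. -/
def flip (p : L.Plaquette) (c : L.Config) : L.Config := Function.update c p (!c p)

/-- The spin of the triangle at the vertex of `x`, by the majority rule. -/
def triangleSpin (c : L.Config) (x : L.Corner) : Bool :=
  let a := c ⟨L.face x.1, x.2.1⟩
  let b := c ⟨L.face (L.rot x.1), x.2.2.1⟩
  let d := c ⟨L.face (L.rot (L.rot x.1)), x.2.2.2⟩
  (a && b) || (b && d) || (a && d)

/-- A type I link is covered by a dimer if the two faces bordering it have equal spins, a type II link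
if the plaquette and the triangle bordering it have opposite spins. -/
def IsDimer (c : L.Config) : L.Link → Prop
  | .inl e => c ⟨L.face (e.1, false), e.2.1⟩ = c ⟨L.face (e.1, true), e.2.2⟩
  | .inr x => c ⟨L.face x.1, x.2.1⟩ ≠ L.triangleSpin c x

variable [Finite E]

/-- The dimer cover of a spin configuration. -/
def dimers (c : L.Config) : Finset L.Link := Finset.univ.filter (L.IsDimer c)

/-- The full state space, (spins) ⊗ (fermions): `ψ c` is the fermionic component of `ψ` along the
spin basis state `c`. -/
abbrev State : Type _ := L.Config → L.Fock

/-- The dimer-constrained space `V^c`: `i s_{jk} γ_j γ_k = 1` on each link covered by a dimer. -/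
def constrained : Submodule ℂ L.State where
  carrier := {ψ | ∀ c, ∀ l ∈ L.dimers c, L.bond l (ψ c) = ψ c}
  add_mem' ha hb c l hl := by simp [ha c l hl, hb c l hl]
  zero_mem' c l _ := by simp
  smul_mem' r ψ h c l hl := by simp [h c l hl]

/-! ### Plaquette flips -/

/-- The sites of the closed loop or open string formed by the links that belong to exactly one of
the dimer covers of `c` and of `flip p c`. -/
def flipSites (p : L.Plaquette) (c : L.Config) : Finset L.Site :=
  Finset.univ.filter fun x =>
    ∃ l ∈ symmDiff (L.dimers c) (L.dimers (L.flip p c)), L.tail l = x ∨ L.head l = x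

/-- The number `n`, where the loop or string has `2 n` sites, or `2 n - 1` sites if it is a string
with exactly one initially unpaired end. -/
def flipLength (p : L.Plaquette) (c : L.Config) : ℕ := ((L.flipSites p c).card + 1) / 2

/-- The fermionic factor `X_{p,c}`: `2 ^ ((n - 1) / 2)` times the product of the projectors onto the
new dimers.  The projectors commute, because different dimers of one cover have no common site, so
the order of the factors plays no role. -/
def flipFermion (p : L.Plaquette) (c : L.Config) : Module.End ℂ L.Fock :=
  (((2 : ℝ) ^ (((L.flipLength p c : ℝ) - 1) / 2) : ℝ) : ℂ) •
    ((L.dimers (L.flip p c) \ L.dimers c).toList.map L.linkProj).prod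

/-- The plaquette flip operator `F_p = ∑_c X_{p,c} ⊗ τ^x_p P_c`. -/
def F (p : L.Plaquette) : Module.End ℂ L.State where
  toFun ψ c := L.flipFermion p (L.flip p c) (ψ (L.flip p c))
  map_add' ψ χ := by ext c; simp
  map_smul' r ψ := by ext c; simp

/-! ### The bulk Hamiltonian -/

/-- The fermion Hamiltonian: minus the sum of `i s_{jk} γ_j γ_k` over the links covered by dimers. -/
def fermionHamiltonian : Module.End ℂ L.State where
  toFun ψ c := -∑ l ∈ L.dimers c, L.bond l (ψ c)
  map_add' ψ χ := by ext c; simp [Finset.sum_add_distrib]; abel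
  map_smul' r ψ := by ext c; simp [Finset.smul_sum]

/-- The bulk Hamiltonian: flips of the non-boundary plaquettes, and the fermion term. -/
def bulkHamiltonian : Module.End ℂ L.State :=
  -(∑ p : L.Plaquette with ¬ L.IsBoundary p, L.F p) + L.fermionHamiltonian

/-- The states of `V^c` whose boundary spins are those of `b`. -/
def boundarySector (b : L.Config) : Submodule ℂ L.State where
  carrier := {ψ | ψ ∈ L.constrained ∧ ∀ c, (∃ p, L.IsBoundary p ∧ c p ≠ b p) → ψ c = 0}
  add_mem' ha hb := ⟨add_mem ha.1 hb.1, fun c hc => by simp [ha.2 c hc, hb.2 c hc]⟩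
  zero_mem' := ⟨zero_mem _, fun _ _ => rfl⟩
  smul_mem' r _ h := ⟨Submodule.smul_mem _ r h.1, fun c hc => by simp [h.2 c hc]⟩

/-- The energies of the bulk Hamiltonian in `V^c` for fixed boundary spins. -/
def sectorEnergies (b : L.Config) : Set ℝ :=
  {e | ∃ ψ ∈ L.boundarySector b, ψ ≠ 0 ∧ L.bulkHamiltonian ψ = (e : ℂ) • ψ}

/-- The boundary ground-state manifold of the bulk Hamiltonian: the span, over all boundary spin
configurations, of the states of lowest energy in `V^c` with these boundary spins. -/
def groundManifold : Submodule ℂ L.State :=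
  Submodule.span ℂ {ψ | ∃ b : L.Config, ψ ∈ L.boundarySector b ∧
    ∃ e : ℝ, IsLeast (L.sectorEnergies b) e ∧ L.bulkHamiltonian ψ = (e : ℂ) • ψ}

end TFLattice

end

/-! On `constrained`, the component of `F p ψ` at a configuration is a normalization times the full
dimer projector of that configuration, applied to the component of `ψ` at the flipped one
(`F_apply`), because dimers common to both covers act trivially. Hence `F p` preserves the
constraint, and the other claims concern products of dimer projectors of two or three covers. These
products are computed in any complex algebra with Majorana elements (`IsMajorana`), usually between
factors `U` and `V` that absorb the bonds of the final and of the initial cover.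

Commutation (`F_comm`). Between `U` and `V` only the dimers that occur in the intermediate cover and
in neither of the other two matter (`middle`), and they all lie around edges separating `p` from
`q`. Different such edges have no common end, so they are exchanged one at a time
(`edges_identity`). At a triangle, the Kasteleyn sign makes the three bonds multiply like Pauli
matrices, so reversing the order of the flips costs a definite phase (`vertex_identity_of_ne`,
`vertex_identity_of_eq`). At the other end of the edge `p` and `q` have exchanged sides, and the
phase is undone (`edge_identity`). Each dimer carries a weight `√2`, and counting dimers shows that
the normalizations match (`flipLength_add_flipLength`).

Noncommutation (`exists_F_ne`). If one end of a shared edge is a boundary vertex, there is no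
triangle to undo the phase `(1 ± i) / √2` of the other end. The unpaired Majorana operator at the
boundary separates the terms carrying the two phases. As the normalizations are real, equality of
the two orders would make the product of projectors vanish (`projOn_eq_zero_of_smul_eq`), but it
does not (`projOn_mul_projOn_mul_projOn_ne_zero`).

Ground states. For a bulk plaquette, `F p` is an involution (`F_F_self`). The loop around `p` is
connected, so when the projectors of some new dimers that miss a site of it are expanded between two
copies of the old projector, only the constant term survives (`projOn_mul_projOn_mul_projOn`).
Transporting a Majorana operator once around `p` gives `-1` by the Kasteleyn condition
(`mul_majorana_mul_eq_zero`), and this makes exactly one new projector redundant; the remaining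
powers of two cancel the normalization. The bulk flips are thus commuting involutions that preserve
the boundary spins, while the fermion term is constant for fixed boundary spins. A state fixed by
all bulk flips exists for all boundary spins (`exists_forall_F_eq`), which gives the lowest energy
(`isLeast_groundEnergy`). A boundary flip commutes with the bulk flips and changes only the sector,
so it preserves the ground states. -/

/-! ### Products of commuting elements over a finite set -/

/-- The product of `f` over `s`, in the order of `s.toList`. -/
noncomputable def orderedProd {ι A : Type*} [Monoid A] (s : Finset ι) (f : ι → A) : A :=
  (s.toList.map f).prod

section OrderedProd

variable {ι A : Type*} [Monoid A] {s t : Finset ι} {f : ι → A}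

theorem orderedProd_empty : orderedProd (∅ : Finset ι) f = 1 := by simp [orderedProd]

theorem list_prod_eq_orderedProd {l : List ι} (hl : l.Nodup) (hs : ∀ i, i ∈ l ↔ i ∈ s)
    (hc : ∀ i ∈ s, ∀ j ∈ s, Commute (f i) (f j)) : (l.map f).prod = orderedProd s f := by
  have hp : l.Perm s.toList := by
    rw [List.perm_ext_iff_of_nodup hl s.nodup_toList]
    simpa using hs
  refine (hp.map f).prod_eq' ?_
  rw [List.pairwise_map]
  refine List.Pairwise.imp_of_mem ?_ (List.pairwise_of_forall (R := fun _ _ => True) (by simp))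
  intro a b ha hb _
  exact hc a ((hs a).1 ha) b ((hs b).1 hb)

theorem orderedProd_insert [DecidableEq ι] {i : ι} (hi : i ∉ s)
    (hc : ∀ j ∈ insert i s, ∀ k ∈ insert i s, Commute (f j) (f k)) :
    orderedProd (insert i s) f = f i * orderedProd s f := by
  rw [← list_prod_eq_orderedProd (l := i :: s.toList)
    (by simpa [Finset.nodup_toList] using hi) (by simp) hc]
  simp [orderedProd]

theorem orderedProd_union [DecidableEq ι] (hd : Disjoint s t)
    (hc : ∀ j ∈ s ∪ t, ∀ k ∈ s ∪ t, Commute (f j) (f k)) :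
    orderedProd (s ∪ t) f = orderedProd s f * orderedProd t f := by
  rw [← list_prod_eq_orderedProd (l := s.toList ++ t.toList) _ (by simp) hc]
  · simp [orderedProd]
  · refine List.Nodup.append s.nodup_toList t.nodup_toList ?_
    intro a ha hb
    exact Finset.disjoint_left.1 hd (by simpa using ha) (by simpa using hb)

theorem commute_orderedProd {a : A} (h : ∀ i ∈ s, Commute a (f i)) :
    Commute a (orderedProd s f) := by
  refine Commute.list_prod_right _ _ fun x hx => ?_
  simp only [List.mem_map, Finset.mem_toList] at hx
  obtain ⟨i, hi, rfl⟩ := hx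
  exact h i hi

theorem orderedProd_singleton {i : ι} : orderedProd {i} f = f i := by simp [orderedProd]

theorem mul_orderedProd_of_forall {a : A} (h : ∀ i ∈ s, a * f i = a) :
    a * orderedProd s f = a := by
  unfold orderedProd
  have : ∀ l : List ι, (∀ i ∈ l, a * f i = a) → a * (l.map f).prod = a := by
    intro l
    induction l with
    | nil => simp
    | cons i l ih =>
      intro h
      rw [List.map_cons, List.prod_cons, ← mul_assoc, h i (by simp),
        ih fun j hj => h j (by simp [hj])]
  exact this _ fun i hi => h i (by simpa using hi)

theorem orderedProd_mul_of_forall {a : A} (h : ∀ i ∈ s, f i * a = a) :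
    orderedProd s f * a = a := by
  unfold orderedProd
  have : ∀ l : List ι, (∀ i ∈ l, f i * a = a) → (l.map f).prod * a = a := by
    intro l
    induction l with
    | nil => simp
    | cons i l ih =>
      intro h
      rw [List.map_cons, List.prod_cons, mul_assoc, ih fun j hj => h j (by simp [hj]),
        h i (by simp)]
  exact this _ fun i hi => h i (by simpa using hi)

theorem orderedProd_smul {R B : Type*} [CommSemiring R] [Semiring B] [Algebra R B]
    (s : Finset ι) (g : ι → B) (r : R) :
    orderedProd s (fun i => r • g i) = r ^ s.card • orderedProd s g := by
  unfold orderedProd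
  rw [← Finset.length_toList]
  induction s.toList with
  | nil => simp
  | cons i l ih => simp [ih, pow_succ, mul_smul]

end OrderedProd

/-! ### Majorana operators -/

/-- Self-inverse, pairwise anticommuting elements of a ring. -/
structure IsMajorana {X A : Type*} [Ring A] (γ : X → A) : Prop where
  mul_self : ∀ x, γ x * γ x = 1
  anticomm : ∀ x y, x ≠ y → γ x * γ y = -(γ y * γ x)

/-- Expanding, only the mixed anticommutators `δ` survive. They add up for two Majorana operators of
the same kind and cancel for different kinds. -/
theorem majorana_relations {A : Type*} [Ring A] [Algebra ℂ A] {a c a' c' δ : A}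
    (h1 : c * c' + c' * c = 0) (h2 : a * a' + a' * a = 0) (h3 : a * c' + c' * a = δ)
    (h4 : c * a' + a' * c = δ) :
    (a + c) * (a' + c') + (a' + c') * (a + c) = 2 * δ ∧
    (a + c) * (Complex.I • (c' - a')) + (Complex.I • (c' - a')) * (a + c) = 0 ∧
    (Complex.I • (c - a)) * (a' + c') + (a' + c') * (Complex.I • (c - a)) = 0 ∧
    (Complex.I • (c - a)) * (Complex.I • (c' - a')) +
      (Complex.I • (c' - a')) * (Complex.I • (c - a)) = 2 * δ := by
  refine ⟨?_, ?_, ?_, ?_⟩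
  · have : (a + c) * (a' + c') + (a' + c') * (a + c) =
        (a * a' + a' * a) + (a * c' + c' * a) + (c * a' + a' * c) + (c * c' + c' * c) := by
      noncomm_ring
    rw [this, h1, h2, h3, h4]
    noncomm_ring
  · have : (a + c) * (c' - a') + (c' - a') * (a + c) =
        (a * c' + c' * a) - (a * a' + a' * a) - (c * a' + a' * c) + (c * c' + c' * c) := by
      noncomm_ring
    rw [mul_smul_comm, smul_mul_assoc, ← smul_add, this, h1, h2, h3, h4]
    simp
  · have : (c - a) * (a' + c') + (a' + c') * (c - a) =
        -(a * c' + c' * a) - (a * a' + a' * a) + (c * a' + a' * c) + (c * c' + c' * c) := by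
      noncomm_ring
    rw [mul_smul_comm, smul_mul_assoc, ← smul_add, this, h1, h2, h3, h4]
    simp
  · have : (c - a) * (c' - a') + (c' - a') * (c - a) =
        (a * a' + a' * a) - (a * c' + c' * a) - (c * a' + a' * c) + (c * c' + c' * c) := by
      noncomm_ring
    simp only [mul_smul_comm, smul_mul_assoc, ← smul_add, this, h1, h2, h3, h4, smul_smul,
      Complex.I_mul_I]
    rw [neg_one_smul]
    noncomm_ring

theorem IsMajorana.of_mul_add {X A : Type*} [Ring A] [Algebra ℂ A] {γ : X → A}
    (h : ∀ x, γ x * γ x + γ x * γ x = 2 * 1)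
    (h' : ∀ x y, x ≠ y → γ x * γ y + γ y * γ x = 0) : IsMajorana γ where
  mul_self x := by
    have h2 : (2 : ℂ) • (γ x * γ x) = (2 : ℂ) • 1 := by
      rw [two_smul, h, two_smul, two_mul]
    exact smul_right_injective _ (two_ne_zero (α := ℂ)) h2
  anticomm x y hxy := eq_neg_of_add_eq_zero_left (h' x y hxy)

namespace TFLattice

open TrivalentMap TrivalentSurface

open scoped Classical

variable {E : Type*} {L : TFLattice E}

theorem create_mul_create_add (e f : L.InteriorEdge) :
    L.create e * L.create f + L.create f * L.create e = 0 := by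
  refine LinearMap.ext fun x => ?_
  simp only [create, LinearMap.add_apply, Module.End.mul_apply, LinearMap.mulLeft_apply,
    ← mul_assoc, ← add_mul, ExteriorAlgebra.ι_add_mul_swap]
  simp

theorem annihilate_mul_annihilate_add (e f : L.InteriorEdge) :
    L.annihilate e * L.annihilate f + L.annihilate f * L.annihilate e = 0 := by
  refine LinearMap.ext fun x => ?_
  simp only [annihilate, LinearMap.add_apply, Module.End.mul_apply]
  rw [CliffordAlgebra.contractLeft_comm]
  simp

theorem annihilate_mul_create_add (e f : L.InteriorEdge) :
    L.annihilate e * L.create f + L.create f * L.annihilate e = if e = f then 1 else 0 := by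
  refine LinearMap.ext fun x => ?_
  have h := CliffordAlgebra.contractLeft_ι_mul (Q := (0 : QuadraticForm ℂ (L.InteriorEdge → ℂ)))
    (d := LinearMap.proj e) (Pi.single f 1) x
  have h' : L.annihilate e (L.create f x) =
      (Pi.single f 1 : L.InteriorEdge → ℂ) e • x - L.create f (L.annihilate e x) := h
  rw [LinearMap.add_apply, Module.End.mul_apply, Module.End.mul_apply, h', sub_add_cancel]
  by_cases hef : e = f
  · simp [hef]
  · simp [hef]

theorem create_mul_annihilate_add (e f : L.InteriorEdge) :
    L.create e * L.annihilate f + L.annihilate f * L.create e = if e = f then 1 else 0 := by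
  rw [add_comm, annihilate_mul_create_add]
  simp [eq_comm]

theorem majorana_mul_add (x y : L.Site) :
    L.majorana x * L.majorana y + L.majorana y * L.majorana x =
      2 * if x.1.1 = y.1.1 ∧ x.1.2 = y.1.2 then 1 else 0 := by
  have he : ((⟨x.1.1, x.2⟩ : L.InteriorEdge) = ⟨y.1.1, y.2⟩) ↔ x.1.1 = y.1.1 := Subtype.ext_iff
  have h := majorana_relations (create_mul_create_add (L := L) ⟨x.1.1, x.2⟩ ⟨y.1.1, y.2⟩)
    (annihilate_mul_annihilate_add (L := L) ⟨x.1.1, x.2⟩ ⟨y.1.1, y.2⟩)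
    ((annihilate_mul_create_add (L := L) ⟨x.1.1, x.2⟩ ⟨y.1.1, y.2⟩).trans
      (if_congr he rfl rfl))
    ((create_mul_annihilate_add (L := L) ⟨x.1.1, x.2⟩ ⟨y.1.1, y.2⟩).trans (if_congr he rfl rfl))
  unfold majorana
  rcases hx : x.1.2 <;> rcases hy : y.1.2
  · simpa using h.1
  · simpa using h.2.1
  · simpa using h.2.2.1
  · simpa using h.2.2.2

theorem isMajorana_majorana : IsMajorana L.majorana := by
  refine IsMajorana.of_mul_add (fun x => ?_) (fun x y hxy => ?_)
  · have h := majorana_mul_add x x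
    rw [if_pos ⟨rfl, rfl⟩] at h
    exact h
  · have h := majorana_mul_add x y
    rw [if_neg fun h => hxy (Subtype.ext (Prod.ext h.1 h.2)), mul_zero] at h
    exact h

/-! ### Links and their sites -/

theorem tail_ne_head (l : L.Link) : L.tail l ≠ L.head l := by
  rcases l with e | x
  · intro h
    have := congrArg (fun s : L.Site => s.1.2) h
    simp [tail, head] at this
  · intro h
    have hval := congrArg (fun s : L.Site => s.1) h
    by_cases hf : L.forward x
    · simp only [tail, head, hf] at hval
      exact L.rot_ne _ hval.symm
    · simp only [tail, head, hf] at hval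
      exact L.rot_ne _ hval

/-- The site `x` is an end of the link `l`. -/
def Touches (x : L.Site) (l : L.Link) : Prop := L.tail l = x ∨ L.head l = x

/-- No two links of `s` have a common end. -/
def IsMatching (s : Finset L.Link) : Prop :=
  ∀ l ∈ s, ∀ m ∈ s, ∀ x, Touches x l → Touches x m → l = m

/-- The site `x` is an end of one of the links in `s`. -/
def Covers (s : Finset L.Link) (x : L.Site) : Prop := ∃ l ∈ s, Touches x l

theorem IsMatching.mono {s t : Finset L.Link} (h : IsMatching t) (hst : s ⊆ t) : IsMatching s :=
  fun l hl l' hl' => h l (hst hl) l' (hst hl')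

/-! ### Bonds of a representation of the Majorana relations -/

section Representation

variable {A : Type*} [Ring A] [Algebra ℂ A] {γ : L.Site → A}

/-- The bond operator of the link `l`, for the Majorana operators `γ`. -/
noncomputable def bondOp (γ : L.Site → A) (l : L.Link) : A :=
  Complex.I • (γ (L.tail l) * γ (L.head l))

/-- The projector onto the states with bond operator one. -/
noncomputable def projOp (γ : L.Site → A) (l : L.Link) : A := (1 / 2 : ℂ) • (1 + bondOp γ l)

/-- The product of the projectors of the links in `s`. -/
noncomputable def projOn (γ : L.Site → A) (s : Finset L.Link) : A := orderedProd s (projOp γ)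

theorem bondOp_mul_of_touches (hγ : IsMajorana γ) {x : L.Site} {l : L.Link} (h : Touches x l) :
    bondOp γ l * γ x = -(γ x * bondOp γ l) := by
  have ht := hγ.anticomm _ _ (tail_ne_head l)
  unfold bondOp
  rw [smul_mul_assoc, mul_smul_comm, ← smul_neg]
  congr 1
  rcases h with rfl | rfl
  · rw [ht, neg_mul, mul_assoc, hγ.mul_self, mul_one, mul_neg, neg_inj, ← neg_eq_iff_eq_neg.2 ht,
      mul_neg, ← mul_assoc, hγ.mul_self, one_mul, neg_neg]
  · rw [mul_assoc, hγ.mul_self, mul_one, ht, mul_neg, neg_neg, ← mul_assoc, hγ.mul_self, one_mul]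

theorem commute_bondOp_of_not_touches (hγ : IsMajorana γ) {x : L.Site} {l : L.Link}
    (h : ¬ Touches x l) :
    Commute (γ x) (bondOp γ l) := by
  unfold Touches at h
  push Not at h
  have h1 := hγ.anticomm _ _ h.1
  have h2 := hγ.anticomm _ _ h.2
  unfold bondOp
  refine Commute.smul_right ?_ _
  change _ * (_ * _) = (_ * _) * _
  rw [mul_assoc, h2, mul_neg, ← mul_assoc (γ (L.tail l)), h1, neg_mul, neg_neg, mul_assoc]

theorem bondOp_mul_self (hγ : IsMajorana γ) (l : L.Link) : bondOp γ l * bondOp γ l = 1 := by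
  have ht := hγ.anticomm _ _ (tail_ne_head l)
  have : γ (L.tail l) * γ (L.head l) * (γ (L.tail l) * γ (L.head l)) = -1 := by
    conv_lhs => enter [1]; rw [ht]
    rw [neg_mul, mul_assoc, ← mul_assoc (γ (L.tail l)), hγ.mul_self, one_mul, hγ.mul_self]
  unfold bondOp
  rw [smul_mul_smul_comm, this, Complex.I_mul_I, neg_one_smul, neg_neg]

theorem commute_bondOp {a : A} {l : L.Link} (h : ∀ x, Touches x l → Commute a (γ x)) :
    Commute a (bondOp γ l) :=
  ((h _ (Or.inl rfl)).mul_right (h _ (Or.inr rfl))).smul_right _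

theorem commute_projOp {a : A} {l : L.Link} (h : Commute a (bondOp γ l)) :
    Commute a (projOp γ l) :=
  ((Commute.one_right a).add_right h).smul_right _

theorem commute_bondOp_bondOp (hγ : IsMajorana γ) {l l' : L.Link}
    (h : ∀ x, Touches x l → Touches x l' → False) :
    Commute (bondOp γ l) (bondOp γ l') :=
  commute_bondOp fun x hx =>
    (commute_bondOp_of_not_touches hγ fun h' => h x h' hx).symm

theorem bondOp_mul_projOp (hγ : IsMajorana γ)
    (l : L.Link) : bondOp γ l * projOp γ l = projOp γ l := by
  unfold projOp
  rw [mul_smul_comm, mul_add, bondOp_mul_self hγ, mul_one, add_comm]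

theorem projOp_mul_bondOp (hγ : IsMajorana γ)
    (l : L.Link) : projOp γ l * bondOp γ l = projOp γ l := by
  unfold projOp
  rw [smul_mul_assoc, add_mul, bondOp_mul_self hγ, one_mul, add_comm]

theorem projOp_mul_of_fixed {a : A} {l : L.Link} (h : bondOp γ l * a = a) : projOp γ l * a = a := by
  unfold projOp
  rw [smul_mul_assoc, add_mul, h, one_mul, ← two_smul ℂ, smul_smul]
  norm_num

theorem mul_projOp_of_fixed {a : A} {l : L.Link} (h : a * bondOp γ l = a) : a * projOp γ l = a := by
  unfold projOp
  rw [mul_smul_comm, mul_add, h, mul_one, ← two_smul ℂ, smul_smul]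
  norm_num

theorem IsMatching.commute_projOp (hγ : IsMajorana γ) {s : Finset L.Link} (hs : IsMatching s) :
    ∀ l ∈ s, ∀ l' ∈ s, Commute (projOp γ l) (projOp γ l') := by
  intro l hl l' hl'
  by_cases h : l = l'
  · rw [h]
  · refine TFLattice.commute_projOp (TFLattice.commute_projOp ?_).symm
    exact (commute_bondOp_bondOp hγ fun x hx hx' => h (hs l hl l' hl' x hx hx')).symm

theorem projOn_insert (hγ : IsMajorana γ) {s : Finset L.Link} {l : L.Link} (hl : l ∉ s)
    (hs : IsMatching (insert l s)) :
    projOn γ (insert l s) = projOp γ l * projOn γ s :=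
  orderedProd_insert hl (hs.commute_projOp hγ)

theorem projOn_union (hγ : IsMajorana γ) {s t : Finset L.Link} (hd : Disjoint s t)
    (hs : IsMatching (s ∪ t)) :
    projOn γ (s ∪ t) = projOn γ s * projOn γ t :=
  orderedProd_union hd (hs.commute_projOp hγ)

theorem bondOp_mul_projOn (hγ : IsMajorana γ) {s : Finset L.Link} (hs : IsMatching s) {l : L.Link}
    (hl : l ∈ s) :
    bondOp γ l * projOn γ s = projOn γ s := by
  rw [← Finset.insert_erase hl] at hs ⊢
  rw [projOn_insert hγ (by simp) hs, ← mul_assoc, bondOp_mul_projOp hγ]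

theorem projOn_mul_bondOp (hγ : IsMajorana γ) {s : Finset L.Link} (hs : IsMatching s) {l : L.Link}
    (hl : l ∈ s) :
    projOn γ s * bondOp γ l = projOn γ s := by
  have hc : Commute (projOp γ l) (projOn γ (s.erase l)) :=
    commute_orderedProd fun l' hl' => hs.commute_projOp hγ l hl l' (Finset.mem_of_mem_erase hl')
  rw [← Finset.insert_erase hl] at hs ⊢
  rw [projOn_insert hγ (by simp) hs, hc.eq, mul_assoc, projOp_mul_bondOp hγ]

theorem projOn_mul_of_fixed {s : Finset L.Link} {a : A} (h : ∀ l ∈ s, bondOp γ l * a = a) :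
    projOn γ s * a = a :=
  orderedProd_mul_of_forall fun l hl => projOp_mul_of_fixed (h l hl)

theorem mul_projOn_of_fixed {s : Finset L.Link} {a : A} (h : ∀ l ∈ s, a * bondOp γ l = a) :
    a * projOn γ s = a :=
  mul_orderedProd_of_forall fun l hl => mul_projOp_of_fixed (h l hl)

theorem commute_projOn_of_not_covers (hγ : IsMajorana γ) {s : Finset L.Link} {x : L.Site}
    (h : ¬ Covers s x) :
    Commute (γ x) (projOn γ s) :=
  commute_orderedProd fun l hl => commute_projOp
    (commute_bondOp_of_not_touches hγ fun hx => h ⟨l, hl, hx⟩)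

/-- Conjugation by an end of `l` turns the projector of `l` into its complement. -/
theorem majorana_mul_projOp_mul (hγ : IsMajorana γ) {x : L.Site} {l : L.Link} (h : Touches x l) :
    γ x * projOp γ l * γ x = 1 - projOp γ l := by
  have hb : γ x * bondOp γ l * γ x = -bondOp γ l := by
    rw [mul_assoc, bondOp_mul_of_touches hγ h, mul_neg, ← mul_assoc, hγ.mul_self, one_mul]
  have h1 : (1 : A) = (1 / 2 : ℂ) • (1 + 1) := by
    rw [← two_smul ℂ, smul_smul]; norm_num
  unfold projOp
  rw [mul_smul_comm, smul_mul_assoc, mul_add, add_mul, hb, mul_one, hγ.mul_self]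
  conv_rhs => enter [1]; rw [h1]
  rw [← smul_sub]
  congr 1
  abel

/-- If the projector of `l` killed the product of the others, conjugation by an end of `l`, which
the others do not touch, would show that the complementary projector kills it too; the two add up to
one. -/
theorem projOn_ne_zero (hγ : IsMajorana γ) [Nontrivial A] {s : Finset L.Link} (hs : IsMatching s) :
    projOn γ s ≠ 0 := by
  induction s using Finset.induction_on with
  | empty => simp [projOn, orderedProd_empty]
  | insert l s hl ih =>
    have ih := ih (hs.mono (Finset.subset_insert _ _))
    intro h
    rw [projOn_insert hγ hl hs] at h
    have hc : Commute (γ (L.tail l)) (projOn γ s) := by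
      refine commute_projOn_of_not_covers hγ ?_
      rintro ⟨l', hl', hx⟩
      have := hs l (by simp) l' (by simp [hl']) _ (Or.inl rfl) hx
      exact hl (this ▸ hl')
    have h2 : (1 - projOp γ l) * projOn γ s = 0 := by
      rw [← majorana_mul_projOp_mul hγ (Or.inl rfl : Touches (L.tail l) l), mul_assoc, hc.eq,
        ← mul_assoc, mul_assoc (γ _), h]
      simp
    rw [sub_mul, h, one_mul, sub_zero] at h2
    exact ih h2

/-! ### Products of bonds -/

/-- In a matching a site meets at most one bond, and it anticommutes with that one only. -/
theorem orderedProd_bondOp_mul (hγ : IsMajorana γ) {s : Finset L.Link} (hs : IsMatching s)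
    (x : L.Site) :
    γ x * orderedProd s (bondOp γ) =
      (if Covers s x then -1 else 1 : A) * (orderedProd s (bondOp γ) * γ x) := by
  have hcomm : ∀ s : Finset L.Link, IsMatching s →
      ∀ l ∈ s, ∀ l' ∈ s, Commute (bondOp γ l) (bondOp γ l') := by
    intro s hs l hl l' hl'
    by_cases h : l = l'
    · rw [h]
    · exact commute_bondOp_bondOp hγ fun x hx hx' => h (hs l hl l' hl' x hx hx')
  split_ifs with h
  · obtain ⟨l, hl, hx⟩ := h
    have hc : Commute (γ x) (orderedProd (s.erase l) (bondOp γ)) :=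
      commute_orderedProd fun l' hl' => commute_bondOp_of_not_touches hγ fun hx' =>
        Finset.ne_of_mem_erase hl' (hs l' (Finset.mem_of_mem_erase hl') l hl x hx' hx)
    rw [← Finset.insert_erase hl] at hs ⊢
    rw [orderedProd_insert (by simp) (hcomm _ hs), mul_assoc, ← hc.eq, ← mul_assoc,
      ← mul_assoc (bondOp γ l), bondOp_mul_of_touches hγ hx]
    noncomm_ring
  · rw [one_mul]
    exact commute_orderedProd fun l hl => commute_bondOp_of_not_touches hγ fun hx => h ⟨l, hl, hx⟩

/-- If exactly one end of `l` is covered by `s`, the bond of `l` anticommutes with the product of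
the bonds in `s`, so this product has no matrix element between states fixed by the bond of `l`. -/
theorem mul_orderedProd_bondOp_mul_eq_zero (hγ : IsMajorana γ) {s : Finset L.Link}
    (hs : IsMatching s) {l : L.Link}
    (h : ¬ (Covers s (L.tail l) ↔ Covers s (L.head l))) {U V : A} (hU : U * bondOp γ l = U)
    (hV : bondOp γ l * V = V) : U * orderedProd s (bondOp γ) * V = 0 := by
  have h1 := orderedProd_bondOp_mul hγ hs (L.tail l)
  have h2 := orderedProd_bondOp_mul hγ hs (L.head l)
  have hb : bondOp γ l * orderedProd s (bondOp γ) = -(orderedProd s (bondOp γ) * bondOp γ l) := by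
    unfold bondOp at *
    rw [smul_mul_assoc, mul_smul_comm, ← smul_neg]
    congr 1
    rw [mul_assoc, h2, ← mul_assoc]
    by_cases ht : Covers s (L.tail l)
    · have hh : ¬ Covers s (L.head l) := fun hh => h ⟨fun _ => hh, fun _ => ht⟩
      rw [if_neg hh, mul_one, ← mul_assoc, h1, if_pos ht]
      noncomm_ring
    · have hh : Covers s (L.head l) := by tauto
      rw [if_pos hh, mul_neg_one, neg_mul, ← mul_assoc, h1, if_neg ht]
      noncomm_ring
  have : U * orderedProd s (bondOp γ) * V = -(U * orderedProd s (bondOp γ) * V) := by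
    conv_lhs => rw [← hU]
    rw [mul_assoc U, hb, mul_neg, neg_mul, ← mul_assoc, mul_assoc _ _ V, hV]
  have h3 : (2 : ℂ) • (U * orderedProd s (bondOp γ) * V) = 0 := by
    rw [two_smul]
    nth_rw 2 [this]
    simp
  exact (smul_eq_zero.1 h3).resolve_left two_ne_zero

/-- Expanding one projector of `N` at a time either drops its link or moves it to `s`. Every product
of bonds that results covers just one end of some link in `D`, so it vanishes. The hypothesis ranges
over all subsets of `N` so that it passes to both terms. -/
theorem mul_orderedProd_bondOp_mul_projOn_mul_eq_zero (hγ : IsMajorana γ) {D N s : Finset L.Link}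
    {U V : A}
    (hs : IsMatching (N ∪ s)) (hd : Disjoint N s)
    (h : ∀ t ⊆ N, ∃ l ∈ D, ¬ (Covers (s ∪ t) (L.tail l) ↔ Covers (s ∪ t) (L.head l)))
    (hU : ∀ l ∈ D, U * bondOp γ l = U) (hV : ∀ l ∈ D, bondOp γ l * V = V) :
    U * orderedProd s (bondOp γ) * projOn γ N * V = 0 := by
  induction N using Finset.induction_on generalizing s with
  | empty =>
    obtain ⟨l, hl, hl'⟩ := h ∅ (by simp)
    rw [Finset.union_empty] at hl'
    rw [Finset.empty_union] at hs
    simpa [projOn, orderedProd_empty] using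
      mul_orderedProd_bondOp_mul_eq_zero hγ hs hl' (hU l hl) (hV l hl)
  | insert l N hl ih =>
    rw [Finset.disjoint_insert_left] at hd
    have hN : IsMatching (insert l N) := hs.mono Finset.subset_union_left
    have h1 : U * orderedProd s (bondOp γ) * projOn γ N * V = 0 :=
      ih (hs.mono (Finset.union_subset_union_left (Finset.subset_insert _ _))) hd.2
        fun t ht => h t (ht.trans (Finset.subset_insert _ _))
    have h2 : U * orderedProd (insert l s) (bondOp γ) * projOn γ N * V = 0 := by
      refine ih (hs.mono ?_) (Finset.disjoint_insert_right.2 ⟨hl, hd.2⟩) fun t ht => ?_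
      · intro a; simp only [Finset.mem_union, Finset.mem_insert]; tauto
      · have := h (insert l t) (Finset.insert_subset_insert _ ht)
        rwa [Finset.union_insert, ← Finset.insert_union] at this
    have hcomm : ∀ a ∈ insert l s, ∀ b ∈ insert l s, Commute (bondOp γ a) (bondOp γ b) := by
      intro a ha b hb
      by_cases hab : a = b
      · rw [hab]
      · refine commute_bondOp_bondOp hγ fun x hx hx' => hab (hs a ?_ b ?_ x hx hx')
        · simp only [Finset.mem_union, Finset.mem_insert] at ha ⊢; tauto
        · simp only [Finset.mem_union, Finset.mem_insert] at hb ⊢; tauto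
    have hc : Commute (bondOp γ l) (orderedProd s (bondOp γ)) :=
      commute_orderedProd fun a ha => hcomm l (by simp) a (by simp [ha])
    rw [orderedProd_insert hd.1 hcomm, hc.eq] at h2
    rw [projOn_insert hγ hl hN]
    unfold projOp
    rw [smul_mul_assoc, mul_smul_comm, smul_mul_assoc, add_mul, one_mul, mul_add, add_mul, h1,
      ← mul_assoc, mul_assoc U, h2, add_zero, smul_zero]

/-- If every nonempty set of links in `N` covers exactly one end of some link in `D`, the projectors
of `N` act as a scalar between states fixed by the bonds in `D`. -/
theorem mul_projOn_mul_eq_smul (hγ : IsMajorana γ) {D N : Finset L.Link} {U V : A}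
    (hN : IsMatching N)
    (h : ∀ t ⊆ N, t.Nonempty → ∃ l ∈ D, ¬ (Covers t (L.tail l) ↔ Covers t (L.head l)))
    (hU : ∀ l ∈ D, U * bondOp γ l = U) (hV : ∀ l ∈ D, bondOp γ l * V = V) :
    U * projOn γ N * V = (1 / 2 : ℂ) ^ N.card • (U * V) := by
  induction N using Finset.induction_on with
  | empty => simp [projOn, orderedProd_empty]
  | insert l N hl ih =>
    have ih := ih (hN.mono (Finset.subset_insert _ _))
      fun t ht => h t (ht.trans (Finset.subset_insert _ _))
    -- The bond part of the projector of `l` produces only products over nonempty sets of links, all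
    -- of which vanish.
    have h2 : U * orderedProd {l} (bondOp γ) * projOn γ N * V = 0 := by
      refine mul_orderedProd_bondOp_mul_projOn_mul_eq_zero hγ (D := D) ?_ (by simpa using hl) ?_
        hU hV
      · rwa [Finset.union_comm, ← Finset.insert_eq]
      · intro t ht
        rw [← Finset.insert_eq]
        exact h _ (Finset.insert_subset_insert _ ht) (Finset.insert_nonempty _ _)
    rw [orderedProd_singleton] at h2
    rw [projOn_insert hγ hl hN]
    unfold projOp
    rw [smul_mul_assoc, mul_smul_comm, smul_mul_assoc, add_mul, one_mul, mul_add, add_mul, ih,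
      ← mul_assoc, h2, add_zero, smul_smul, Finset.card_insert_of_notMem hl, pow_succ']

end Representation

end TFLattice

/-- A predicate that propagates along the steps of a permutation, except at one point of a cycle, is
constant on the rest of the cycle. -/
theorem Equiv.Perm.SameCycle.iff_of_step {α : Type*} [Finite α] {φ : Equiv.Perm α} {g I : α → Prop}
    {a : α} (hI : ∀ x y, φ.SameCycle a x → φ.SameCycle a y → ¬ I x → ¬ I y → x = y)
    (hg : ∀ x, φ.SameCycle a x → I x → I (φ x) → (g x ↔ g (φ x)))
    {x y : α} (hx : φ.SameCycle a x) (hy : φ.SameCycle a y) (hxI : I x) (hyI : I y) :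
    g x ↔ g y := by
  classical
  -- The starting point `s` is the successor of the exceptional point, or arbitrary if there is
  -- none.
  have key : ∀ s, φ.SameCycle a s → (∀ z, φ.SameCycle a z → ¬ I z → φ z = s) →
      ∀ z, φ.SameCycle a z → I z → (g s ↔ g z) := by
    intro s hs hlast z hz hzI
    have hex : ∃ k : ℕ, (φ ^ k) s = z := (hs.symm.trans hz).exists_nat_pow_eq
    have hk := Nat.find_spec hex
    have hmin := fun j => Nat.find_min hex (m := j)
    generalize Nat.find hex = k at hk hmin
    have hint : ∀ j ≤ k, I ((φ ^ j) s) := by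
      intro j hj
      by_contra hn
      rcases hj.eq_or_lt with rfl | hlt
      · exact hn (hk ▸ hzI)
      -- An exceptional point on the way would be followed by `s` again, and so give a shorter route
      -- to `z` than the minimal one.
      · have h1 := hlast _ (hs.trans ⟨j, by simp⟩) hn
        refine hmin (k - (j + 1)) (by omega) ?_
        have h2 : (φ ^ k) s = (φ ^ (k - (j + 1))) (φ ((φ ^ j) s)) := by
          rw [← Equiv.Perm.mul_apply φ, ← pow_succ', ← Equiv.Perm.mul_apply, ← pow_add]
          congr 2
          omega
        rw [← hk, h2, h1]
    have hall : ∀ j ≤ k, (g s ↔ g ((φ ^ j) s)) := by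
      intro j
      induction j with
      | zero => simp
      | succ j ih =>
        intro hj
        have h1 := hint (j + 1) hj
        rw [pow_succ', Equiv.Perm.mul_apply] at h1 ⊢
        exact (ih (by omega)).trans (hg _ (hs.trans ⟨j, by simp⟩) (hint j (by omega)) h1)
    exact hk ▸ hall k le_rfl
  by_cases h : ∃ z, φ.SameCycle a z ∧ ¬ I z
  · obtain ⟨z, hz, hzI⟩ := h
    have hs : φ.SameCycle a (φ z) := Equiv.Perm.sameCycle_apply_right.2 hz
    have hl : ∀ w, φ.SameCycle a w → ¬ I w → φ w = φ z := fun w hw hwI => by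
      rw [hI w z hw hz hwI hzI]
    exact (key _ hs hl x hx hxI).symm.trans (key _ hs hl y hy hyI)
  · push Not at h
    exact key x hx (fun z hz hzI => absurd (h z hz) hzI) y hy hyI

/-! ### Local geometry of faces, edges and vertices. -/

namespace TrivalentSurface

open TrivalentMap

variable {E : Type*} (S : TrivalentSurface E)

theorem rev_rev (d : E × Bool) : rev (rev d) = d := by simp [rev]

theorem face_eq_iff {d d' : E × Bool} : S.face d = S.face d' ↔ S.facePerm.SameCycle d d' :=
  Quotient.eq (r := Equiv.Perm.SameCycle.setoid S.facePerm)

theorem face_facePerm (d : E × Bool) : S.face (S.facePerm d) = S.face d :=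
  S.face_eq_iff.2 (Equiv.Perm.sameCycle_apply_left.2 (Equiv.Perm.SameCycle.refl _ _))

theorem rot_facePerm (d : E × Bool) : S.rot (S.facePerm d) = rev d := by
  simp [facePerm]

theorem face_ne_face_rot (d : E × Bool) : S.face d ≠ S.face (S.rot d) := by
  have h := S.face_ne (S.rot d)
  rw [S.face_rev, S.rot_rot_rot] at h
  exact h.symm

theorem face_ne_face_rot_rot (d : E × Bool) : S.face d ≠ S.face (S.rot (S.rot d)) := by
  have h := S.face_ne d
  rwa [S.face_rev] at h

theorem rot_rot_ne (d : E × Bool) : S.rot (S.rot d) ≠ d := by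
  intro h
  have := S.rot_rot_rot d
  rw [h] at this
  exact S.rot_ne d this

theorem rot_rot_ne_rot (d : E × Bool) : S.rot (S.rot d) ≠ S.rot d := S.rot_ne _

theorem isInterior_iff {d : E × Bool} :
    S.IsInterior d.1 ↔ S.face d ∉ S.hole ∧ S.face (rev d) ∉ S.hole := by
  obtain ⟨e, b⟩ := d
  cases b
  · rfl
  · exact and_comm

/-- Two of the three sectors at the vertex are the sides of the edge of `d`; the remaining condition
is about the sector opposite to it. -/
theorem isBulkVertex_iff {d : E × Bool} :
    S.IsBulkVertex d ↔ S.IsInterior d.1 ∧ S.face (S.rot d) ∉ S.hole := by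
  rw [isInterior_iff, S.face_rev]
  exact ⟨fun h => ⟨⟨h.1, h.2.2⟩, h.2.1⟩, fun h => ⟨h.1.1, h.2, h.1.2⟩⟩

/-- Two consecutive non-boundary edges of a face meet at a non-boundary vertex. -/
theorem isBulkVertex_facePerm {d : E × Bool} (h : S.IsInterior d.1)
    (h' : S.IsInterior (S.facePerm d).1) : S.IsBulkVertex (S.facePerm d) := by
  refine S.isBulkVertex_iff.2 ⟨h', ?_⟩
  rw [rot_facePerm]
  exact (S.isInterior_iff.1 h).2

theorem isInterior_of_not_isBoundary {p : S.Plaquette} (hp : ¬ S.IsBoundary p) {d : E × Bool}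
    (hd : S.face d = p.1) : S.IsInterior d.1 :=
  S.isInterior_iff.2 ⟨hd ▸ p.2, fun h => hp ⟨d, hd, h⟩⟩

end TrivalentSurface

namespace TFLattice

open TrivalentMap TrivalentSurface

open scoped Classical

variable {E : Type*} {L : TFLattice E}

/-! ### Spins of faces -/

/-- The spin of a face; deleted faces get the value `false`. -/
noncomputable def faceSpin (c : L.Config) (f : L.Face) : Bool :=
  if h : f ∉ L.hole then c ⟨f, h⟩ else false

theorem faceSpin_of_not_mem (c : L.Config) {f : L.Face} (h : f ∉ L.hole) :
    faceSpin c f = c ⟨f, h⟩ := dif_pos h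

theorem faceSpin_coe (c : L.Config) (p : L.Plaquette) : faceSpin c p.1 = c p :=
  faceSpin_of_not_mem c p.2

theorem faceSpin_flip (c : L.Config) (p : L.Plaquette) (f : L.Face) :
    faceSpin (L.flip p c) f = if f = p.1 then !faceSpin c f else faceSpin c f := by
  by_cases h : f ∈ L.hole
  · have : f ≠ p.1 := fun hf => p.2 (hf ▸ h)
    simp [faceSpin, h, this]
  · rw [faceSpin_of_not_mem _ h, faceSpin_of_not_mem _ h]
    by_cases hf : f = p.1
    · have : (⟨f, h⟩ : L.Plaquette) = p := Subtype.ext hf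
      rw [if_pos hf, this]
      simp [flip]
    · rw [if_neg hf]
      have (q : L.Plaquette) (hq : q ≠ p) : L.flip p c q = c q := by simp [flip, hq]
      exact this ⟨f, h⟩ fun h' => hf (congrArg Subtype.val h')

theorem flip_flip (p : L.Plaquette) (c : L.Config) : L.flip p (L.flip p c) = c := by
  simp [flip]

theorem flip_comm (p q : L.Plaquette) (c : L.Config) :
    L.flip p (L.flip q c) = L.flip q (L.flip p c) := by
  by_cases h : p = q
  · rw [h]
  · funext r
    unfold flip
    by_cases hp : r = p <;> by_cases hq : r = q <;> simp_all [Function.update_apply]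

/-! ### Links at a site -/

/-- The type I link at a site. -/
def edgeLink (x : L.Site) : L.Link := .inl ⟨x.1.1, x.2⟩

/-- The type II link between `d` and `rot d`. -/
def cornerLink (d : E × Bool) (h : L.IsBulkVertex d) : L.Link := .inr ⟨d, h⟩

/-- The site of the half-edge `d`. -/
def siteOf (d : E × Bool) (h : L.IsInterior d.1) : L.Site := ⟨d, h⟩

theorem isDimer_edgeLink (c : L.Config) (x : L.Site) :
    L.IsDimer c (edgeLink x) ↔ faceSpin c (L.face x.1) = faceSpin c (L.face (rev x.1)) := by
  have h := L.isInterior_iff.1 x.2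
  rw [faceSpin_of_not_mem _ h.1, faceSpin_of_not_mem _ h.2]
  obtain ⟨⟨e, b⟩, hx⟩ := x
  cases b
  · exact Iff.rfl
  · exact eq_comm

/-- A face disagrees with the majority of three spins exactly when it is alone in the minority. In
this form every question about dimers at a vertex is a finite check. -/
theorem isDimer_cornerLink (c : L.Config) {d : E × Bool} (h : L.IsBulkVertex d) :
    L.IsDimer c (cornerLink d h) ↔ faceSpin c (L.face d) ≠ faceSpin c (L.face (L.rot d)) ∧
      faceSpin c (L.face d) ≠ faceSpin c (L.face (L.rot (L.rot d))) := by
  rw [faceSpin_of_not_mem _ h.1, faceSpin_of_not_mem _ h.2.1, faceSpin_of_not_mem _ h.2.2]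
  change c ⟨L.face d, h.1⟩ ≠ L.triangleSpin c ⟨d, h⟩ ↔ _
  unfold triangleSpin
  dsimp only
  cases c ⟨L.face d, h.1⟩ <;> cases c ⟨L.face (L.rot d), h.2.1⟩ <;>
    cases c ⟨L.face (L.rot (L.rot d)), h.2.2⟩ <;> simp

theorem touches_edgeLink {x y : L.Site} : Touches x (edgeLink y) ↔ x.1.1 = y.1.1 := by
  constructor
  · rintro (h | h)
    · rw [← h]; rfl
    · rw [← h]; rfl
  · intro h
    cases hb : x.1.2
    · exact Or.inl (Subtype.ext (Prod.ext h.symm hb.symm))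
    · exact Or.inr (Subtype.ext (Prod.ext h.symm hb.symm))

theorem tail_head_of_forward {d : E × Bool} {h : L.IsBulkVertex d} (hf : L.forward ⟨d, h⟩ = true) :
    L.tail (cornerLink d h) = siteOf d h.isInterior ∧
      L.head (cornerLink d h) = siteOf (L.rot d) h.next.isInterior :=
  ⟨if_pos hf, if_pos hf⟩

theorem tail_head_of_not_forward {d : E × Bool} {h : L.IsBulkVertex d}
    (hf : ¬ L.forward ⟨d, h⟩ = true) :
    L.tail (cornerLink d h) = siteOf (L.rot d) h.next.isInterior ∧
      L.head (cornerLink d h) = siteOf d h.isInterior :=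
  ⟨if_neg hf, if_neg hf⟩

theorem touches_cornerLink {x : L.Site} {d : E × Bool} {h : L.IsBulkVertex d} :
    Touches x (cornerLink d h) ↔ x.1 = d ∨ x.1 = L.rot d := by
  have h1 : siteOf d h.isInterior = x ↔ x.1 = d := Subtype.ext_iff.trans eq_comm
  have h2 : siteOf (L.rot d) h.next.isInterior = x ↔ x.1 = L.rot d := Subtype.ext_iff.trans eq_comm
  unfold Touches
  by_cases hf : L.forward ⟨d, h⟩ = true
  · rw [(tail_head_of_forward hf).1, (tail_head_of_forward hf).2, h1, h2]
  · rw [(tail_head_of_not_forward hf).1, (tail_head_of_not_forward hf).2, h1, h2, or_comm]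

theorem touches_self_edgeLink (x : L.Site) : Touches x (edgeLink x) := touches_edgeLink.2 rfl

theorem exists_eq_edgeLink_or_cornerLink (l : L.Link) :
    (∃ x, l = edgeLink x) ∨ ∃ d h, l = cornerLink d h := by
  rcases l with e | y
  · exact Or.inl ⟨⟨(e.1, false), e.2⟩, rfl⟩
  · exact Or.inr ⟨y.1, y.2, rfl⟩

theorem touches_iff {x : L.Site} {l : L.Link} :
    Touches x l ↔ l = edgeLink x ∨ (∃ h, l = cornerLink x.1 h) ∨
      ∃ h, l = cornerLink (L.rot (L.rot x.1)) h := by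
  constructor
  · intro h
    rcases exists_eq_edgeLink_or_cornerLink l with ⟨y, rfl⟩ | ⟨d, hd, rfl⟩
    · left
      have := touches_edgeLink.1 h
      exact congrArg Sum.inl (Subtype.ext this.symm)
    · right
      rcases touches_cornerLink.1 h with rfl | h'
      · exact Or.inl ⟨hd, rfl⟩
      · right
        have : L.rot (L.rot x.1) = d := by rw [h', L.rot_rot_rot]
        subst this
        exact ⟨hd, rfl⟩
  · rintro (rfl | ⟨h, rfl⟩ | ⟨h, rfl⟩)
    · exact touches_self_edgeLink x
    · exact touches_cornerLink.2 (Or.inl rfl)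
    · exact touches_cornerLink.2 (Or.inr (L.rot_rot_rot _).symm)

theorem iff_tail_head_edgeLink {χ : L.Site → Prop} {x : L.Site}
    (h : χ (L.tail (edgeLink x)) ↔ χ (L.head (edgeLink x))) (h' : L.IsInterior (rev x.1).1) :
    χ x ↔ χ (siteOf (rev x.1) h') := by
  obtain ⟨⟨e, b⟩, hx⟩ := x
  cases b
  · exact h
  · exact h.symm

theorem iff_tail_head_cornerLink {χ : L.Site → Prop} {d : E × Bool} {hd : L.IsBulkVertex d}
    (h : χ (L.tail (cornerLink d hd)) ↔ χ (L.head (cornerLink d hd))) :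
    χ (siteOf d hd.isInterior) ↔ χ (siteOf (L.rot d) hd.next.isInterior) := by
  by_cases hf : L.forward ⟨d, hd⟩ = true
  · rwa [(tail_head_of_forward hf).1, (tail_head_of_forward hf).2] at h
  · rw [(tail_head_of_not_forward hf).1, (tail_head_of_not_forward hf).2] at h
    exact h.symm

section Finite

variable [Finite E]

theorem mem_dimers {c : L.Config} {l : L.Link} : l ∈ L.dimers c ↔ L.IsDimer c l := by
  simp [dimers]

/-- The links at a site are decided by the spins around its vertex, and no choice of these covers
two different ones. -/
theorem isMatching_dimers (c : L.Config) : IsMatching (L.dimers c) := by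
  intro l hl l' hl' x hx hx'
  rw [mem_dimers] at hl hl'
  rw [touches_iff] at hx hx'
  rcases hx with rfl | ⟨h, rfl⟩ | ⟨h, rfl⟩ <;> rcases hx' with rfl | ⟨h', rfl⟩ | ⟨h', rfl⟩ <;>
    first
    | rfl
    | (exfalso
       simp only [isDimer_edgeLink, isDimer_cornerLink, L.face_rev, L.rot_rot_rot] at hl hl'
       revert hl hl'
       generalize faceSpin c (L.face x.1) = a
       generalize faceSpin c (L.face (L.rot x.1)) = b
       generalize faceSpin c (L.face (L.rot (L.rot x.1))) = d
       cases a <;> cases b <;> cases d <;> simp)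

/-- A site is left uncovered by the dimers only if it lies on the boundary, between plaquettes of
opposite spins. -/
theorem covers_dimers_iff {c : L.Config} {x : L.Site} :
    Covers (L.dimers c) x ↔
      (L.face (L.rot x.1) ∉ L.hole ∨ faceSpin c (L.face x.1) = faceSpin c (L.face (rev x.1))) := by
  constructor
  · rintro ⟨l, hl, hx⟩
    rw [mem_dimers] at hl
    rcases touches_iff.1 hx with rfl | ⟨h, rfl⟩ | ⟨h, rfl⟩
    · exact Or.inr ((isDimer_edgeLink c x).1 hl)
    · exact Or.inl h.2.1
    · have := h.next.2.1
      rw [L.rot_rot_rot] at this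
      exact Or.inl this
  · intro h
    by_cases hs : faceSpin c (L.face x.1) = faceSpin c (L.face (rev x.1))
    · exact ⟨_, mem_dimers.2 ((isDimer_edgeLink c x).2 hs), touches_self_edgeLink x⟩
    · have hb : L.IsBulkVertex x.1 := L.isBulkVertex_iff.2 ⟨x.2, h.resolve_right hs⟩
      rw [L.face_rev] at hs
      by_cases h1 : faceSpin c (L.face x.1) = faceSpin c (L.face (L.rot x.1))
      · refine ⟨cornerLink _ hb.next.next, mem_dimers.2 ((isDimer_cornerLink c _).2 ?_),
          touches_iff.2 (Or.inr (Or.inr ⟨_, rfl⟩))⟩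
        rw [L.rot_rot_rot]
        exact ⟨fun h => hs h.symm, fun h => hs (h1.trans h.symm)⟩
      · exact ⟨cornerLink _ hb, mem_dimers.2 ((isDimer_cornerLink c _).2 ⟨h1, hs⟩),
          touches_iff.2 (Or.inr (Or.inl ⟨_, rfl⟩))⟩

/-! ### The loop or string around a plaquette -/

variable {p : L.Plaquette} {c : L.Config}

theorem mem_symmDiff_dimers {c c' : L.Config} {l : L.Link} :
    l ∈ symmDiff (L.dimers c) (L.dimers c') ↔ ¬ (L.IsDimer c l ↔ L.IsDimer c' l) := by
  rw [Finset.mem_symmDiff, mem_dimers, mem_dimers]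
  tauto

/-- No face borders itself, so the flip changes at most one of the two spins compared across an
edge. -/
theorem edgeLink_mem_symmDiff_iff {x : L.Site} :
    edgeLink x ∈ symmDiff (L.dimers c) (L.dimers (L.flip p c)) ↔
      L.face x.1 = p.1 ∨ L.face (rev x.1) = p.1 := by
  rw [mem_symmDiff_dimers, isDimer_edgeLink, isDimer_edgeLink, faceSpin_flip, faceSpin_flip]
  have := L.face_ne x.1
  by_cases h1 : L.face x.1 = p.1 <;> by_cases h2 : L.face (rev x.1) = p.1
  · exact absurd (h1.trans h2.symm) this
  all_goals
    simp only [h1, h2, if_true, if_false]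
    cases faceSpin c (L.face x.1) <;> cases faceSpin c (L.face (rev x.1)) <;> simp_all

/-- If the two other faces at a vertex of `p` have equal spins, flipping `p` toggles the triangle
edge next to `p`. -/
theorem cornerLink_mem_symmDiff_of_eq {d : E × Bool} (hd : L.IsBulkVertex d) (hp : L.face d = p.1)
    (h : faceSpin c (L.face (L.rot d)) = faceSpin c (L.face (L.rot (L.rot d)))) :
    cornerLink d hd ∈ symmDiff (L.dimers c) (L.dimers (L.flip p c)) := by
  have h1 : L.face (L.rot d) ≠ p.1 := hp ▸ (L.face_ne_face_rot d).symm
  have h2 : L.face (L.rot (L.rot d)) ≠ p.1 := hp ▸ (L.face_ne_face_rot_rot d).symm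
  rw [mem_symmDiff_dimers, isDimer_cornerLink, isDimer_cornerLink]
  simp only [faceSpin_flip, hp, h1, h2, if_true, if_false, h]
  cases faceSpin c p.1 <;> cases faceSpin c (L.face (L.rot (L.rot d))) <;> simp

/-- If the two other faces at a vertex of `p` have opposite spins, flipping `p` toggles the triangle
edges next to them. -/
theorem cornerLink_mem_symmDiff_of_ne {d : E × Bool} (hd : L.IsBulkVertex d) (hp : L.face d = p.1)
    (h : faceSpin c (L.face (L.rot d)) ≠ faceSpin c (L.face (L.rot (L.rot d)))) :
    cornerLink (L.rot d) hd.next ∈ symmDiff (L.dimers c) (L.dimers (L.flip p c)) ∧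
    cornerLink (L.rot (L.rot d)) hd.next.next ∈
      symmDiff (L.dimers c) (L.dimers (L.flip p c)) := by
  have h1 : L.face (L.rot d) ≠ p.1 := hp ▸ (L.face_ne_face_rot d).symm
  have h2 : L.face (L.rot (L.rot d)) ≠ p.1 := hp ▸ (L.face_ne_face_rot_rot d).symm
  simp only [mem_symmDiff_dimers, isDimer_cornerLink, L.rot_rot_rot, faceSpin_flip, hp, h1, h2,
    if_true, if_false]
  revert h
  cases faceSpin c p.1 <;> cases faceSpin c (L.face (L.rot (L.rot d))) <;>
    cases faceSpin c (L.face (L.rot d)) <;> simp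

theorem face_eq_of_cornerLink_mem_symmDiff {d : E × Bool} {hd : L.IsBulkVertex d}
    (h : cornerLink d hd ∈ symmDiff (L.dimers c) (L.dimers (L.flip p c))) :
    L.face d = p.1 ∨ L.face (L.rot d) = p.1 ∨ L.face (L.rot (L.rot d)) = p.1 := by
  by_contra hn
  push Not at hn
  rw [mem_symmDiff_dimers] at h
  simp [isDimer_cornerLink, faceSpin_flip, hn] at h

section Connected

variable {χ : L.Site → Prop}

/-- The toggled triangle edges join the two sites either directly or by the detour through the third
corner, depending on the other two spins. -/
theorem iff_rot_of_toggled
    (hχ : ∀ l ∈ symmDiff (L.dimers c) (L.dimers (L.flip p c)), (χ (L.tail l) ↔ χ (L.head l)))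
    {d : E × Bool} (hd : L.IsBulkVertex d) (hp : L.face d = p.1) :
    χ (siteOf d hd.isInterior) ↔ χ (siteOf (L.rot d) hd.next.isInterior) := by
  by_cases h : faceSpin c (L.face (L.rot d)) = faceSpin c (L.face (L.rot (L.rot d)))
  · exact iff_tail_head_cornerLink (hχ _ (cornerLink_mem_symmDiff_of_eq hd hp h))
  · have h' := cornerLink_mem_symmDiff_of_ne hd hp h
    have h1 := iff_tail_head_cornerLink (hχ _ h'.1)
    have h2 := iff_tail_head_cornerLink (hχ _ h'.2)
    have h3 : siteOf (L.rot (L.rot (L.rot d))) hd.next.next.next.isInterior =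
        siteOf d hd.isInterior := Subtype.ext (L.rot_rot_rot d)
    rw [h3] at h2
    exact (h1.trans h2).symm

theorem mem_flipSites {x : L.Site} : x ∈ L.flipSites p c ↔
    ∃ l ∈ symmDiff (L.dimers c) (L.dimers (L.flip p c)), Touches x l := by
  simp [flipSites, Touches]

theorem mem_flipSites_of_face {x : L.Site} (h : L.face x.1 = p.1 ∨ L.face (rev x.1) = p.1) :
    x ∈ L.flipSites p c :=
  mem_flipSites.2 ⟨_, edgeLink_mem_symmDiff_iff.2 h, touches_self_edgeLink x⟩

/-- Walk along the face: toggled links lead from each non-boundary half-edge to the next one. Since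
a face has at most one boundary edge, its non-boundary half-edges form a full cycle or a single
interval, so the walk reaches all of them. -/
theorem iff_of_face_eq
    (hχ : ∀ l ∈ symmDiff (L.dimers c) (L.dimers (L.flip p c)), (χ (L.tail l) ↔ χ (L.head l)))
    {x y : L.Site} (hx : L.face x.1 = p.1) (hy : L.face y.1 = p.1) : χ x ↔ χ y := by
  have key := Equiv.Perm.SameCycle.iff_of_step (φ := L.facePerm) (a := x.1)
    (I := fun d => L.IsInterior d.1) (g := fun d => ∃ h, χ (siteOf d h)) (x := x.1) (y := y.1)
    ?_ ?_ (Equiv.Perm.SameCycle.refl _ _) (L.face_eq_iff.1 (hx.trans hy.symm)) x.2 y.2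
  · have h1 : χ x ↔ ∃ h, χ (siteOf x.1 h) := ⟨fun h => ⟨x.2, h⟩, fun ⟨_, h⟩ => h⟩
    have h2 : χ y ↔ ∃ h, χ (siteOf y.1 h) := ⟨fun h => ⟨y.2, h⟩, fun ⟨_, h⟩ => h⟩
    rw [h1, h2]
    exact key
  · intro d d' hd hd' hdI hdI'
    rw [← L.face_eq_iff] at hd hd'
    have hh : ∀ z, L.face x.1 = L.face z → ¬ L.IsInterior z.1 → L.face (rev z) ∈ L.hole := by
      intro z hz hzI
      by_contra hn
      exact hzI (L.isInterior_iff.2 ⟨by rw [← hz, hx]; exact p.2, hn⟩)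
    exact L.boundary_edge_unique d d' (hd.symm.trans hd') (hh d hd hdI) (hh d' hd' hdI')
  · intro d hd hdI hdI'
    rw [← L.face_eq_iff, hx] at hd
    have hb := L.isBulkVertex_facePerm hdI hdI'
    have h1 := iff_rot_of_toggled hχ hb (by rw [L.face_facePerm, ← hd])
    have h2 := iff_tail_head_edgeLink (x := siteOf d hdI)
      (hχ _ (edgeLink_mem_symmDiff_iff.2 (Or.inl hd.symm))) hdI
    have h3 : siteOf (L.rot (L.facePerm d)) hb.next.isInterior = siteOf (rev d) hdI :=
      Subtype.ext (L.rot_facePerm d)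
    rw [h3] at h1
    exact ⟨fun ⟨_, h⟩ => ⟨hdI', h1.2 (h2.1 h)⟩, fun ⟨_, h⟩ => ⟨hdI, h2.2 (h1.1 h)⟩⟩

/-- The loop or string around a plaquette is connected. -/
theorem iff_of_mem_flipSites
    (hχ : ∀ l ∈ symmDiff (L.dimers c) (L.dimers (L.flip p c)), (χ (L.tail l) ↔ χ (L.head l)))
    {x y : L.Site} (hx : x ∈ L.flipSites p c) (hy : y ∈ L.flipSites p c) : χ x ↔ χ y := by
  have htouch : ∀ l ∈ symmDiff (L.dimers c) (L.dimers (L.flip p c)), ∀ x y : L.Site,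
      Touches x l → Touches y l → (χ x ↔ χ y) := by
    intro l hl x y hx hy
    have := hχ l hl
    rcases hx with rfl | rfl <;> rcases hy with rfl | rfl <;> tauto
  have key : ∀ x ∈ L.flipSites p c, ∃ z : L.Site, L.face z.1 = p.1 ∧ (χ x ↔ χ z) := by
    intro x hx
    obtain ⟨l, hl, hxl⟩ := mem_flipSites.1 hx
    rcases exists_eq_edgeLink_or_cornerLink l with ⟨y, rfl⟩ | ⟨d, hd, rfl⟩
    · rcases edgeLink_mem_symmDiff_iff.1 hl with h | h
      · exact ⟨y, h, htouch _ hl _ _ hxl (touches_self_edgeLink y)⟩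
      · exact ⟨siteOf (rev y.1) y.2, h, htouch _ hl _ _ hxl (touches_edgeLink.2 rfl)⟩
    · have h1 := htouch _ hl x (siteOf d hd.isInterior) hxl (touches_cornerLink.2 (Or.inl rfl))
      have h2 := htouch _ hl x (siteOf (L.rot d) hd.next.isInterior) hxl
        (touches_cornerLink.2 (Or.inr rfl))
      rcases face_eq_of_cornerLink_mem_symmDiff hl with h | h | h
      · exact ⟨_, h, h1⟩
      · exact ⟨_, h, h2⟩
      · have h3 := iff_rot_of_toggled hχ hd.next.next h
        have h4 : siteOf (L.rot (L.rot (L.rot d))) hd.next.next.next.isInterior =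
          siteOf d hd.isInterior := Subtype.ext (L.rot_rot_rot d)
        rw [h4] at h3
        exact ⟨_, h, h1.trans h3.symm⟩
  obtain ⟨z, hz, hxz⟩ := key x hx
  obtain ⟨w, hw, hyw⟩ := key y hy
  exact hxz.trans ((iff_of_face_eq hχ hz hw).trans hyw.symm)

end Connected

/-- A set of new dimers that misses a site of the loop or string around `p` covers exactly one end
of some old dimer. -/
theorem exists_not_covers_iff {N : Finset L.Link}
    (hN : N ⊆ L.dimers (L.flip p c) \ L.dimers c) {x : L.Site} (hx : x ∈ L.flipSites p c)
    (hxN : ¬ Covers N x) {t : Finset L.Link} (ht : t ⊆ N) (hne : t.Nonempty) :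
    ∃ l ∈ L.dimers c, ¬ (Covers t (L.tail l) ↔ Covers t (L.head l)) := by
  by_contra hn
  push Not at hn
  obtain ⟨l, hl⟩ := hne
  have hl' := Finset.mem_sdiff.1 (hN (ht hl))
  have hs : l ∈ symmDiff (L.dimers c) (L.dimers (L.flip p c)) :=
    Finset.mem_symmDiff.2 (Or.inr hl')
  -- If no old dimer were half covered, being covered by `t` would be constant along the connected
  -- loop or string; but `t` covers an end of `l` and misses `x`.
  have key := iff_of_mem_flipSites (p := p) (c := c) (χ := Covers t) ?_ hx
    (mem_flipSites.2 ⟨l, hs, Or.inl rfl⟩)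
  · obtain ⟨l', hl', hx'⟩ := key.2 ⟨l, hl, Or.inl rfl⟩
    exact hxN ⟨l', ht hl', hx'⟩
  · intro m hm
    rcases Finset.mem_symmDiff.1 hm with hm | hm
    · exact hn m hm.1
    · have hmatch := isMatching_dimers (L.flip p c)
      -- A new dimer is covered by `t` at both ends or at neither, because `t` is part of the new
      -- matching.
      have haux : ∀ x, Touches x m → (Covers t x ↔ m ∈ t) := by
        intro x hxm
        constructor
        · rintro ⟨m', hm', hxm'⟩
          rwa [hmatch m hm.1 m' (Finset.mem_sdiff.1 (hN (ht hm'))).1 x hxm hxm']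
        · exact fun h => ⟨m, h, hxm⟩
      rw [haux _ (Or.inl rfl), haux _ (Or.inr rfl)]

/-- The missed site `x` makes every nonempty product of bonds from `N` vanish between the old
projectors, so only the constant term of the expansion is left. -/
theorem projOn_mul_projOn_mul_projOn {A : Type*} [Ring A] [Algebra ℂ A] {γ : L.Site → A}
    (hγ : IsMajorana γ) {N : Finset L.Link} (hN : N ⊆ L.dimers (L.flip p c) \ L.dimers c)
    {x : L.Site} (hx : x ∈ L.flipSites p c) (hxN : ¬ Covers N x) :
    projOn γ (L.dimers c) * projOn γ N * projOn γ (L.dimers c) =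
      (1 / 2 : ℂ) ^ N.card • projOn γ (L.dimers c) := by
  have hc := isMatching_dimers c
  rw [mul_projOn_mul_eq_smul hγ (D := L.dimers c)
    ((isMatching_dimers (L.flip p c)).mono (hN.trans Finset.sdiff_subset))
    (fun t ht hne => exists_not_covers_iff hN hx hxN ht hne)
    (fun l hl => projOn_mul_bondOp hγ hc hl) (fun l hl => bondOp_mul_projOn hγ hc hl),
    projOn_mul_of_fixed fun l hl => bondOp_mul_projOn hγ hc hl]

end Finite

end TFLattice

/-! ### Transport around a cycle and counting of signs. -/

/-- A vector that returns to its negative after transport around a cycle vanishes. -/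
theorem Equiv.Perm.eq_zero_of_transport {α A : Type*} [Fintype α] [AddCommGroup A] [Module ℂ A]
    (φ : Equiv.Perm α) (a : α) [DecidablePred (φ.SameCycle a)] (m : α → A) (s : α → ℂ)
    (hm : ∀ x, φ.SameCycle a x → m (φ x) = s x • m x)
    (hs : ∏ x with φ.SameCycle a x, s x = -1) : m a = 0 := by
  classical
  have hiter : ∀ k : ℕ, m ((φ ^ k) a) = (∏ j ∈ Finset.range k, s ((φ ^ j) a)) • m a := by
    intro k
    induction k with
    | zero => simp
    | succ k ih =>
      rw [pow_succ', Equiv.Perm.mul_apply, hm _ ⟨k, by simp⟩, ih, Finset.prod_range_succ, smul_smul,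
        mul_comm]
  have hper : a ∈ Function.periodicPts φ :=
    ⟨orderOf φ, orderOf_pos φ, by
      rw [Function.IsPeriodicPt, Function.IsFixedPt, Equiv.Perm.iterate_eq_pow, pow_orderOf_eq_one]
      rfl⟩
  have hprod : ∏ j ∈ Finset.range (Function.minimalPeriod φ a), s ((φ ^ j) a) = -1 := by
    rw [← hs]
    refine Finset.prod_bij (fun j _ => (φ ^ j) a)
      (fun j _ => Finset.mem_filter.2 ⟨Finset.mem_univ _, j, by simp⟩)
      (fun i hi j hj hij => ?_) (fun x hx => ?_) fun _ _ => rfl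
    · refine Function.iterate_injOn_Iio_minimalPeriod (f := φ) (x := a) (by simpa using hi)
        (by simpa using hj) ?_
      simpa [Equiv.Perm.iterate_eq_pow] using hij
    · obtain ⟨k, hk⟩ := (Finset.mem_filter.1 hx).2.exists_nat_pow_eq
      refine ⟨k % Function.minimalPeriod φ a, ?_, ?_⟩
      · simpa using Nat.mod_lt _ (Function.minimalPeriod_pos_of_mem_periodicPts hper)
      · rw [← hk, ← Equiv.Perm.iterate_eq_pow, ← Equiv.Perm.iterate_eq_pow,
          Function.iterate_mod_minimalPeriod_eq]
  have h := hiter (Function.minimalPeriod φ a)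
  rw [hprod, ← Equiv.Perm.iterate_eq_pow, Function.iterate_minimalPeriod, neg_one_smul] at h
  have h2 : (2 : ℂ) • m a = 0 := by
    rw [two_smul]
    nth_rw 2 [h]
    simp
  exact (smul_eq_zero.1 h2).resolve_left two_ne_zero

theorem mul_mul_eq_neg_one_of_odd_ncard {β : Type*} (f : β → Bool) {x y z : β} (hxy : x ≠ y)
    (hxz : x ≠ z) (hyz : y ≠ z)
    (h : Odd {w : β | (w = x ∨ w = y ∨ w = z) ∧ f w = false}.ncard) :
    (if f x = true then 1 else -1 : ℂ) * (if f y = true then 1 else -1) *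
      (if f z = true then 1 else -1) = -1 := by
  classical
  have hset : {w : β | (w = x ∨ w = y ∨ w = z) ∧ f w = false} =
      ((({x, y, z} : Finset β).filter fun w => f w = false : Finset β) : Set β) := by
    ext w
    simp
  rw [hset, Set.ncard_coe_finset, Finset.card_filter, Finset.sum_insert (by simp [hxy, hxz]),
    Finset.sum_insert (by simpa using hyz), Finset.sum_singleton] at h
  revert h
  cases f x <;> cases f y <;> cases f z <;> simp [Nat.odd_iff]

theorem ncard_subtype_and {α : Type*} {P Q : α → Prop} {R : Subtype Q → Prop} :
    {x : Subtype Q | P x.1 ∧ R x}.ncard = {a | P a ∧ ∃ h : Q a, R ⟨a, h⟩}.ncard := by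
  rw [← Set.ncard_image_of_injective _ Subtype.val_injective]
  congr 1
  ext a
  simp only [Set.mem_image, Set.mem_ofPred_eq]
  constructor
  · rintro ⟨⟨a', h⟩, ⟨hP, hR⟩, rfl⟩
    exact ⟨hP, h, hR⟩
  · rintro ⟨hP, h, hR⟩
    exact ⟨⟨a, h⟩, ⟨hP, hR⟩, rfl⟩

namespace TFLattice

open TrivalentMap TrivalentSurface

open scoped Classical

variable {E : Type*} {L : TFLattice E}

/-! ### Orientation signs -/

/-- The sign of the triangle edge from `d` to `rot d`. -/
noncomputable def cornerSign (d : E × Bool) (h : L.IsBulkVertex d) : ℂ :=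
  if L.forward ⟨d, h⟩ = true then 1 else -1

/-- The sign of the edge from `d` to `rev d`. -/
noncomputable def edgeSign (d : E × Bool) : ℂ := if d.2 = true then -1 else 1

theorem cornerSign_mul_self {d : E × Bool} {h : L.IsBulkVertex d} :
    cornerSign d h * cornerSign d h = 1 := by
  unfold cornerSign
  split_ifs <;> norm_num

theorem edgeSign_mul_self {d : E × Bool} : edgeSign d * edgeSign d = 1 := by
  unfold edgeSign
  split_ifs <;> norm_num

theorem sameVertex_iff {d d' : E × Bool} :
    L.SameVertex d d' ↔ d' = d ∨ d' = L.rot d ∨ d' = L.rot (L.rot d) := by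
  constructor
  · rintro ⟨i, hi⟩
    have h3 : L.rot ^ (3 : ℤ) = 1 := by
      ext1 x
      exact L.rot_rot_rot x
    rw [← Int.emod_add_mul_ediv i 3, zpow_add, zpow_mul, h3, one_zpow, mul_one] at hi
    have h0 := Int.emod_nonneg i (show (3 : ℤ) ≠ 0 by norm_num)
    have h1 := Int.emod_lt_of_pos i (show (0 : ℤ) < 3 by norm_num)
    generalize i % 3 = j at *
    interval_cases j
    · exact Or.inl (by simpa using hi.symm)
    · exact Or.inr (Or.inl (by simpa using hi.symm))
    · exact Or.inr (Or.inr hi.symm)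
  · rintro (rfl | rfl | rfl)
    · exact ⟨0, rfl⟩
    · exact ⟨1, rfl⟩
    · exact ⟨2, rfl⟩

/-- This is the Kasteleyn condition of the triangle: an odd number of the three signs are negative.
-/
theorem cornerSign_mul_mul [Finite E] {d : E × Bool} (h : L.IsBulkVertex d) :
    cornerSign d h * cornerSign (L.rot d) h.next *
      cornerSign (L.rot (L.rot d)) h.next.next = -1 := by
  have hk := L.kasteleyn_triangle ⟨d, h⟩
  have hset : {y : L.Corner | L.SameVertex d y.1 ∧ L.forward y = false} =
      {y : L.Corner | (y = ⟨d, h⟩ ∨ y = ⟨L.rot d, h.next⟩ ∨ y = ⟨L.rot (L.rot d), h.next.next⟩) ∧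
        L.forward y = false} := by
    refine Set.ext fun y => and_congr_left fun _ => sameVertex_iff.trans ?_
    have e (d') (h' : L.IsBulkVertex d') : y.1 = d' ↔ y = ⟨d', h'⟩ :=
      ⟨fun h => Subtype.ext h, fun h => congrArg Subtype.val h⟩
    exact or_congr (e _ _) (or_congr (e _ _) (e _ _))
  refine mul_mul_eq_neg_one_of_odd_ncard L.forward ?_ ?_ ?_ (hset ▸ hk)
  · exact fun h' => L.rot_ne d (congrArg Subtype.val h').symm
  · exact fun h' => L.rot_rot_ne d (congrArg Subtype.val h').symm
  · exact fun h' => L.rot_rot_ne_rot d (congrArg Subtype.val h').symm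

/-- The signs of the edges of a plaquette, without its corner signs. -/
theorem prod_edgeSign_mul_cornerSign [Fintype E] (p : L.Plaquette) :
    (∏ d : E × Bool with L.face d = p.1, edgeSign d) *
      ∏ d : E × Bool with L.face d = p.1,
        (if h : L.IsBulkVertex d then -cornerSign d h else 1) = -1 := by
  have h1 : (∏ d : E × Bool with L.face d = p.1, edgeSign d) =
      (-1) ^ {d : E × Bool | L.face d = p.1 ∧ d.2 = true}.ncard := by
    unfold edgeSign
    rw [Finset.prod_ite, Finset.prod_const, Finset.prod_const_one, mul_one, Finset.filter_filter,
      ← Set.ncard_coe_finset]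
    congr 2
    ext d
    simp
  have h2 : (∏ d : E × Bool with L.face d = p.1,
      (if h : L.IsBulkVertex d then -cornerSign d h else 1)) =
      (-1) ^ {x : L.Corner | L.face x.1 = p.1 ∧ L.forward x = true}.ncard := by
    have : ∀ d : E × Bool, (if h : L.IsBulkVertex d then -cornerSign d h else 1) =
        if ∃ h : L.IsBulkVertex d, L.forward ⟨d, h⟩ = true then (-1 : ℂ) else 1 := by
      intro d
      by_cases h : L.IsBulkVertex d
      · unfold cornerSign
        by_cases hf : L.forward ⟨d, h⟩ = true <;> simp [h, hf]
      · simp [h]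
    simp only [this]
    rw [Finset.prod_ite, Finset.prod_const, Finset.prod_const_one, mul_one, Finset.filter_filter,
      ← Set.ncard_coe_finset]
    refine congrArg _ (Eq.trans ?_ (ncard_subtype_and (P := fun d => L.face d = p.1)
      (Q := L.IsBulkVertex) (R := fun x => L.forward x = true)).symm)
    congr 1
    ext d
    simp
  rw [h1, h2, ← pow_add]
  exact (L.kasteleyn_plaquette p).neg_one_pow

/-! ### Bonds at a vertex -/

section Representation

variable {A : Type*} [Ring A] [Algebra ℂ A] {γ : L.Site → A}

theorem bondOp_cornerLink (hγ : IsMajorana γ) {d : E × Bool} (h : L.IsBulkVertex d) :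
    bondOp γ (cornerLink d h) = (Complex.I * cornerSign d h) •
      (γ (siteOf d h.isInterior) * γ (siteOf (L.rot d) h.next.isInterior)) := by
  unfold bondOp cornerSign
  split_ifs with hf
  · rw [(tail_head_of_forward hf).1, (tail_head_of_forward hf).2, mul_one]
  · rw [(tail_head_of_not_forward hf).1, (tail_head_of_not_forward hf).2, hγ.anticomm]
    · rw [mul_neg_one, neg_smul, smul_neg]
    · exact fun h' => L.rot_ne d (congrArg Subtype.val h')

theorem bondOp_edgeLink (hγ : IsMajorana γ) {d : E × Bool} (h : L.IsInterior d.1)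
    (h' : L.IsInterior (rev d).1) :
    bondOp γ (edgeLink (siteOf d h)) = (Complex.I * edgeSign d) •
      (γ (siteOf d h) * γ (siteOf (rev d) h')) := by
  obtain ⟨e, b⟩ := d
  cases b
  · simp only [edgeSign, Bool.false_eq_true, if_false, mul_one]
    rfl
  · simp only [edgeSign, if_true, mul_neg_one]
    rw [hγ.anticomm]
    · rw [neg_smul, smul_neg, neg_neg]
      rfl
    · intro h'
      have := congrArg (fun s : L.Site => s.1.2) h'
      simp [siteOf, rev] at this

/-- The three bonds of a triangle multiply like Pauli matrices. -/
theorem bondOp_cornerLink_mul [Finite E] (hγ : IsMajorana γ) {d : E × Bool} (h : L.IsBulkVertex d) :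
    bondOp γ (cornerLink d h) * bondOp γ (cornerLink (L.rot d) h.next) =
      Complex.I • bondOp γ (cornerLink (L.rot (L.rot d)) h.next.next) := by
  have h3 : siteOf (L.rot (L.rot (L.rot d))) h.next.next.next.isInterior = siteOf d h.isInterior :=
    Subtype.ext (L.rot_rot_rot d)
  have hs := cornerSign_mul_mul h
  have hs2 := cornerSign_mul_self (h := h.next.next)
  have hne : siteOf d h.isInterior ≠ siteOf (L.rot (L.rot d)) h.next.next.isInterior := fun h' =>
    L.rot_rot_ne d (congrArg Subtype.val h').symm
  rw [bondOp_cornerLink hγ, bondOp_cornerLink hγ, bondOp_cornerLink hγ, h3, smul_mul_smul_comm,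
    mul_assoc (γ _), ← mul_assoc (γ (siteOf (L.rot d) _)), hγ.mul_self, one_mul,
    hγ.anticomm _ _ hne, smul_neg, ← neg_smul, smul_smul]
  congr 1
  linear_combination cornerSign (L.rot (L.rot d)) h.next.next * hs -
    (cornerSign d h * cornerSign (L.rot d) h.next) * hs2 -
    (cornerSign d h * cornerSign (L.rot d) h.next +
      cornerSign (L.rot (L.rot d)) h.next.next) * Complex.I_sq

/-! ### Transport of a Majorana operator around a plaquette -/

/-- On a factor absorbed by the bond, the Majorana operators at its two ends agree up to a phase, so
an operator can hop along the link. -/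
theorem mul_majorana_mul_of_fixed_right (hγ : IsMajorana γ) {l : L.Link} {x y : L.Site} {σ : ℂ}
    (hl : bondOp γ l = (Complex.I * σ) • (γ x * γ y)) (hσ : σ * σ = 1) {U V : A}
    (hV : bondOp γ l * V = V) : U * γ y * V = (σ * -Complex.I) • (U * γ x * V) := by
  have h : (Complex.I * σ) • (γ y * V) = γ x * V := by
    conv_rhs => rw [← hV, hl]
    rw [smul_mul_assoc, mul_smul_comm, ← mul_assoc, ← mul_assoc, hγ.mul_self, one_mul]
  rw [mul_assoc, mul_assoc, ← h, mul_smul_comm, smul_smul]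
  have : σ * -Complex.I * (Complex.I * σ) = 1 := by
    linear_combination hσ - σ * σ * Complex.I_sq
  rw [this, one_smul]

theorem mul_majorana_mul_of_fixed_left (hγ : IsMajorana γ) {l : L.Link} {x y : L.Site} {σ : ℂ}
    (hl : bondOp γ l = (Complex.I * σ) • (γ x * γ y)) {U V : A}
    (hU : U * bondOp γ l = U) : U * γ y * V = (σ * Complex.I) • (U * γ x * V) := by
  conv_lhs => rw [← hU, hl]
  rw [mul_smul_comm, smul_mul_assoc, smul_mul_assoc, mul_assoc U, mul_assoc (γ x), hγ.mul_self,
    mul_one, mul_comm]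

variable [Finite E] {p : L.Plaquette} {c : L.Config}

/-- An old dimer is absorbed on the right and a new one on the left, so a Majorana operator can hop
along every toggled link; the side decides the sign of the factor `i`. -/
theorem mul_majorana_mul_of_toggled (hγ : IsMajorana γ) {l : L.Link} {x y : L.Site} {σ : ℂ}
    (hl : bondOp γ l = (Complex.I * σ) • (γ x * γ y)) (hσ : σ * σ = 1)
    (h : l ∈ symmDiff (L.dimers c) (L.dimers (L.flip p c))) :
    projOn γ (L.dimers (L.flip p c) \ L.dimers c) * γ y * projOn γ (L.dimers c) =
      (σ * if L.IsDimer c l then -Complex.I else Complex.I) •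
        (projOn γ (L.dimers (L.flip p c) \ L.dimers c) * γ x * projOn γ (L.dimers c)) := by
  rcases Finset.mem_symmDiff.1 h with h | h
  · rw [if_pos (mem_dimers.1 h.1)]
    exact mul_majorana_mul_of_fixed_right hγ hl hσ
      (bondOp_mul_projOn hγ (isMatching_dimers c) h.1)
  · rw [if_neg fun hd => h.2 (mem_dimers.2 hd)]
    exact mul_majorana_mul_of_fixed_left hγ hl (projOn_mul_bondOp hγ
      ((isMatching_dimers _).mono Finset.sdiff_subset) (Finset.mem_sdiff.2 h))

/-- The phase that turns the transport along a plaquette into multiplication by signs. -/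
noncomputable def gauge (p : L.Plaquette) (c : L.Config) (d : E × Bool) : ℂ :=
  if faceSpin c (L.face (rev d)) = faceSpin c p.1 then 1 else Complex.I

/-- One step along the face crosses the edge of `d` and then the triangle at its end, always along
toggled links. The factors `±i` of the hops are absorbed by the gauge, and the triangle sign makes
the direct route and the detour agree. -/
theorem transport_facePerm (hγ : IsMajorana γ) {d : E × Bool} (hd : L.face d = p.1)
    (h : L.IsInterior d.1) (h' : L.IsInterior (L.facePerm d).1)
    (hb : L.IsBulkVertex (L.facePerm d)) :
    gauge p c (L.facePerm d) • (projOn γ (L.dimers (L.flip p c) \ L.dimers c) *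
        γ (siteOf (L.facePerm d) h') * projOn γ (L.dimers c)) =
      (edgeSign d * -cornerSign (L.facePerm d) hb) •
        (gauge p c d • (projOn γ (L.dimers (L.flip p c) \ L.dimers c) * γ (siteOf d h) *
          projOn γ (L.dimers c))) := by
  have hd' : L.face (L.facePerm d) = p.1 := by rw [L.face_facePerm, hd]
  have hrot := L.rot_facePerm d
  have hsite : siteOf (rev d) (show L.IsInterior (rev d).1 from h) =
      siteOf (L.rot (L.facePerm d)) hb.next.isInterior := Subtype.ext hrot.symm
  have hsite3 : siteOf (L.rot (L.rot (L.rot (L.facePerm d)))) hb.next.next.next.isInterior =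
      siteOf (L.facePerm d) h' := Subtype.ext (L.rot_rot_rot _)
  have h1 := mul_majorana_mul_of_toggled (p := p) (c := c) hγ
    (bondOp_edgeLink hγ h (show L.IsInterior (rev d).1 from h)) edgeSign_mul_self
    (edgeLink_mem_symmDiff_iff.2 (Or.inl hd))
  have e1 : L.IsDimer c (edgeLink (siteOf d h)) ↔
      faceSpin c p.1 = faceSpin c (L.face (rev d)) := by
    rw [isDimer_edgeLink, ← hd]
    rfl
  have hg : gauge p c (L.facePerm d) =
      if faceSpin c (L.face (L.rot (L.rot (L.facePerm d)))) = faceSpin c p.1 then 1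
      else Complex.I := by
    rw [gauge, L.face_rev]
  have hs := cornerSign_mul_mul hb
  have hs0 := cornerSign_mul_self (h := hb)
  rw [hsite, if_congr e1 rfl rfl] at h1
  rw [hg, gauge]
  -- These are the two faces other than `p` at the vertex. Equal spins give the direct route along
  -- one triangle edge, opposite spins the detour along the other two.
  by_cases hr : faceSpin c (L.face (L.rot (L.facePerm d))) =
      faceSpin c (L.face (L.rot (L.rot (L.facePerm d))))
  · have h2 := mul_majorana_mul_of_toggled (p := p) (c := c) hγ (bondOp_cornerLink hγ hb)
      cornerSign_mul_self (cornerLink_mem_symmDiff_of_eq hb hd' hr)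
    have e2 : L.IsDimer c (cornerLink _ hb) ↔ faceSpin c p.1 ≠ faceSpin c (L.face (rev d)) := by
      rw [isDimer_cornerLink, hd', ← hr, hrot, and_self]
    rw [if_congr e2 rfl rfl, h1] at h2
    rw [← hr, hrot]
    change _ • (_ * γ (siteOf (L.facePerm d) hb.isInterior) * _) = _
    generalize (projOn γ (L.dimers (L.flip p c) \ L.dimers c) * γ (siteOf d h) *
      projOn γ (L.dimers c)) = m0 at *
    generalize (projOn γ (L.dimers (L.flip p c) \ L.dimers c) *
      γ (siteOf (L.facePerm d) hb.isInterior) * projOn γ (L.dimers c)) = m3 at *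
    generalize edgeSign d = t at *
    generalize cornerSign (L.facePerm d) hb = k0 at *
    by_cases ha : faceSpin c p.1 = faceSpin c (L.face (rev d))
    · simp only [ha, if_true, ne_eq, not_true, if_false] at h2 ⊢
      have h3 : (k0 * -Complex.I) • (k0 * Complex.I) • m3 = m3 := by
        rw [smul_smul]
        have : k0 * -Complex.I * (k0 * Complex.I) = 1 := by
          linear_combination hs0 - k0 * k0 * Complex.I_sq
        rw [this, one_smul]
      rw [← h2, smul_smul] at h3
      rw [← h3, smul_smul, smul_smul]
      congr 1
      linear_combination (t * k0) * Complex.I_sq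
    · have ha' : ¬ faceSpin c (L.face (rev d)) = faceSpin c p.1 := fun h => ha h.symm
      simp only [ha, ha', if_true, ne_eq, not_false_eq_true, if_false] at h2 ⊢
      have h3 : (k0 * Complex.I) • (k0 * -Complex.I) • m3 = m3 := by
        rw [smul_smul]
        have : k0 * Complex.I * (k0 * -Complex.I) = 1 := by
          linear_combination hs0 - k0 * k0 * Complex.I_sq
        rw [this, one_smul]
      rw [← h2, smul_smul] at h3
      rw [← h3, smul_smul, smul_smul]
      congr 1
      linear_combination (t * k0 * Complex.I) * Complex.I_sq
  · have ht := cornerLink_mem_symmDiff_of_ne (c := c) hb hd' hr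
    have h2 := mul_majorana_mul_of_toggled (p := p) (c := c) hγ (bondOp_cornerLink hγ hb.next)
      cornerSign_mul_self ht.1
    have h3 := mul_majorana_mul_of_toggled (p := p) (c := c) hγ (bondOp_cornerLink hγ hb.next.next)
      cornerSign_mul_self ht.2
    have e2 : L.IsDimer c (cornerLink _ hb.next) ↔
        faceSpin c p.1 ≠ faceSpin c (L.face (rev d)) := by
      rw [isDimer_cornerLink, L.rot_rot_rot, hd']
      rw [hrot] at hr ⊢
      exact ⟨fun h => h.2.symm, fun h => ⟨hr, h.symm⟩⟩
    have e3 : L.IsDimer c (cornerLink _ hb.next.next) ↔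
        faceSpin c p.1 = faceSpin c (L.face (rev d)) := by
      rw [isDimer_cornerLink, L.rot_rot_rot, hd']
      rw [hrot] at hr ⊢
      revert hr
      cases faceSpin c p.1 <;> cases faceSpin c (L.face (rev d)) <;>
        cases faceSpin c (L.face (L.rot (rev d))) <;> simp
    have e4 : faceSpin c (L.face (L.rot (L.rot (L.facePerm d)))) = faceSpin c p.1 ↔
        faceSpin c p.1 ≠ faceSpin c (L.face (rev d)) := by
      rw [hrot] at hr ⊢
      revert hr
      cases faceSpin c p.1 <;> cases faceSpin c (L.face (rev d)) <;>
        cases faceSpin c (L.face (L.rot (rev d))) <;> simp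
    rw [if_congr e2 rfl rfl, h1] at h2
    rw [if_congr e3 rfl rfl, h2, hsite3] at h3
    rw [if_congr e4 rfl rfl, h3, smul_smul, smul_smul, smul_smul, smul_smul]
    congr 1
    generalize cornerSign (L.facePerm d) hb = k0 at *
    generalize cornerSign (L.rot (L.facePerm d)) hb.next = k1 at *
    generalize cornerSign (L.rot (L.rot (L.facePerm d))) hb.next.next = k2 at *
    -- By the Kasteleyn condition the detour has the opposite sign to the direct triangle edge.
    have hk : k1 * k2 = -k0 := by linear_combination k0 * hs - k1 * k2 * hs0
    by_cases ha : faceSpin c p.1 = faceSpin c (L.face (rev d))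
    · simp only [ha, if_true, ne_eq, not_true, if_false]
      linear_combination edgeSign d * hk + (k1 * k2 * edgeSign d) *
        (Complex.I ^ 2 - 1) * Complex.I_sq
    · have ha' : ¬ faceSpin c (L.face (rev d)) = faceSpin c p.1 := fun h => ha h.symm
      simp only [ha, ha', if_true, ne_eq, not_false_eq_true, if_false]
      linear_combination edgeSign d * Complex.I * hk - (k1 * k2 * edgeSign d * Complex.I) *
        Complex.I_sq

/-- Around a bulk plaquette the transport closes up, and the Kasteleyn condition makes the product
of the step signs equal to `-1`. -/
theorem mul_majorana_mul_eq_zero (hγ : IsMajorana γ) (hp : ¬ L.IsBoundary p) {x : L.Site}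
    (hx : L.face x.1 = p.1) :
    projOn γ (L.dimers (L.flip p c) \ L.dimers c) * γ x * projOn γ (L.dimers c) = 0 := by
  have := Fintype.ofFinite E
  have hint : ∀ d, L.face d = p.1 → L.IsInterior d.1 := fun d hd =>
    L.isInterior_of_not_isBoundary hp hd
  have hbulk : ∀ d, L.face d = p.1 → L.IsBulkVertex (L.facePerm d) := fun d hd =>
    L.isBulkVertex_facePerm (hint d hd) (hint _ (by rw [L.face_facePerm, hd]))
  have hcyc : ∀ d, L.facePerm.SameCycle x.1 d ↔ L.face d = p.1 := fun d => by
    rw [← L.face_eq_iff, hx, eq_comm]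
  -- The default values `0` and `1` are never reached on this cycle, since all edges and vertices of
  -- a bulk plaquette are off the boundary.
  have key := Equiv.Perm.eq_zero_of_transport L.facePerm x.1
    (fun d => if h : L.IsInterior d.1 then
      gauge p c d • (projOn γ (L.dimers (L.flip p c) \ L.dimers c) * γ (siteOf d h) *
        projOn γ (L.dimers c)) else 0)
    (fun d => edgeSign d *
      if h : L.IsBulkVertex (L.facePerm d) then -cornerSign (L.facePerm d) h else 1) ?_ ?_
  · rw [dif_pos x.2] at key
    refine (smul_eq_zero.1 key).resolve_left ?_
    unfold gauge
    split_ifs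
    · exact one_ne_zero
    · exact Complex.I_ne_zero
  · intro d hd
    rw [hcyc] at hd
    have hd' : L.face (L.facePerm d) = p.1 := by rw [L.face_facePerm, hd]
    rw [dif_pos (hint d hd), dif_pos (hint _ hd'), dif_pos (hbulk d hd)]
    exact transport_facePerm hγ hd _ _ _
  · simp only [hcyc]
    rw [Finset.prod_mul_distrib]
    rw [← prod_edgeSign_mul_cornerSign p]
    congr 1
    -- The corner sign of a step belongs to its endpoint, so the product is reindexed by one step
    -- along the face.
    refine Finset.prod_equiv L.facePerm (fun d => ?_) fun d _ => rfl
    simp only [Finset.mem_filter, Finset.mem_univ, true_and, L.face_facePerm]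

/-- For a bulk plaquette one of the new projectors is redundant. -/
theorem projOn_mul_projOn_eq_erase (hγ : IsMajorana γ) (hp : ¬ L.IsBoundary p) {x : L.Site}
    (hx : L.face x.1 = p.1) {l : L.Link} (hl : l ∈ L.dimers (L.flip p c) \ L.dimers c)
    (hxl : Touches x l) :
    projOn γ (L.dimers (L.flip p c) \ L.dimers c) * projOn γ (L.dimers c) =
      projOn γ ((L.dimers (L.flip p c) \ L.dimers c).erase l) * projOn γ (L.dimers c) := by
  have h0 := mul_majorana_mul_eq_zero (c := c) hγ hp hx
  have hm : IsMatching (L.dimers (L.flip p c) \ L.dimers c) :=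
    (isMatching_dimers _).mono Finset.sdiff_subset
  generalize L.dimers (L.flip p c) \ L.dimers c = N at *
  have hc : Commute (γ x) (projOn γ (N.erase l)) := by
    refine commute_projOn_of_not_covers hγ ?_
    rintro ⟨l', hl', hx'⟩
    exact Finset.ne_of_mem_erase hl' (hm l' (Finset.mem_of_mem_erase hl') l hl x hx' hxl)
  have hN : projOn γ N = projOp γ l * projOn γ (N.erase l) := by
    conv_lhs => rw [← Finset.insert_erase hl]
    exact projOn_insert hγ (by simp) (by rwa [Finset.insert_erase hl])
  -- Conjugation by `γ x` turns the complement of the projector of `l` into the projector itself.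
  -- This rebuilds the product over all new dimers with `γ x` to its right, which the old projector
  -- sends to zero.
  have h1 : (1 - projOp γ l) * projOn γ (N.erase l) * projOn γ (L.dimers c) = 0 := by
    rw [← majorana_mul_projOp_mul hγ hxl, mul_assoc _ (γ x), hc.eq, ← mul_assoc,
      mul_assoc (γ x), ← hN, mul_assoc, mul_assoc, ← mul_assoc (projOn γ N), h0, mul_zero]
  rw [hN]
  rw [sub_mul, one_mul, sub_mul, sub_eq_zero] at h1
  exact h1.symm

end Representation

end TFLattice

/-! ### Plaquettes at a boundary vertex. -/

namespace TrivalentSurface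

open TrivalentMap

variable {E : Type*} (S : TrivalentSurface E)

theorem isBoundary_of_face_rot_mem_hole {p : S.Plaquette} {d : E × Bool}
    (h : S.face (S.rot d) ∈ S.hole) (hd : S.face d = p.1 ∨ S.face (rev d) = p.1) :
    S.IsBoundary p := by
  rcases hd with hd | hd
  · refine ⟨rev (S.rot d), ?_, by rwa [rev_rev]⟩
    rw [S.face_rev, S.rot_rot_rot, hd]
  · refine ⟨S.rot (S.rot d), by rw [← S.face_rev, hd], ?_⟩
    rwa [S.face_rev, S.rot_rot_rot]

theorem mem_sharedBoundaryVertices {p q : S.Plaquette} (hpq : p ≠ q) {d : E × Bool}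
    (h : S.face (S.rot d) ∈ S.hole) (hp : S.face d = p.1 ∨ S.face (rev d) = p.1)
    (hq : S.face d = q.1 ∨ S.face (rev d) = q.1) : d ∈ S.sharedBoundaryVertices p q := by
  refine ⟨h, ?_⟩
  have hne : p.1 ≠ q.1 := fun h => hpq (Subtype.ext h)
  rcases hp with hp | hp <;> rcases hq with hq | hq
  · exact absurd (hp.symm.trans hq) hne
  · exact Or.inl ⟨hp, hq⟩
  · exact Or.inr ⟨hq, hp⟩
  · exact absurd (hp.symm.trans hq) hne

end TrivalentSurface

namespace TFLattice

open TrivalentMap TrivalentSurface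

open scoped Classical

variable {E : Type*} {L : TFLattice E}

theorem projOn_majorana_apply {s : Finset L.Link} {v : L.Fock} (h : ∀ l ∈ s, L.bond l v = v) :
    projOn L.majorana s v = v := by
  have hl : ∀ l ∈ s, projOp L.majorana l v = v := by
    intro l hl
    change (1 / 2 : ℂ) • (v + L.bond l v) = v
    rw [h l hl, ← two_smul ℂ, smul_smul]
    norm_num
  unfold projOn orderedProd
  have : ∀ t : List L.Link, (∀ l ∈ t, projOp L.majorana l v = v) →
      (t.map (projOp L.majorana)).prod v = v := by
    intro t
    induction t with
    | nil => intro _; rfl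
    | cons l t ih =>
      intro ht
      rw [List.map_cons, List.prod_cons, Module.End.mul_apply,
        ih fun l' hl' => ht l' (by simp [hl']), ht l (by simp)]
  exact this _ fun l h' => hl l (by simpa using h')

theorem bond_projOn_apply {s : Finset L.Link} (hs : IsMatching s) {l : L.Link} (hl : l ∈ s)
    (v : L.Fock) : L.bond l (projOn L.majorana s v) = projOn L.majorana s v :=
  LinearMap.congr_fun (bondOp_mul_projOn isMajorana_majorana hs hl) v

variable [Finite E]

/-! ### Counting sites -/

theorem card_filter_covers {s : Finset L.Link} (hs : IsMatching s) :
    (Finset.univ.filter (Covers s)).card = 2 * s.card := by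
  have h : Finset.univ.filter (Covers s) = s.biUnion fun l => {L.tail l, L.head l} := by
    ext x
    simp [Covers, Touches, eq_comm]
  rw [h, Finset.card_biUnion, Finset.sum_congr rfl fun l _ => Finset.card_pair (tail_ne_head l),
    Finset.sum_const, smul_eq_mul, mul_comm]
  intro l hl l' hl' hne
  refine Finset.disjoint_left.2 fun x hx hx' => hne (hs l hl l' hl' x ?_ ?_)
  · simpa [Touches, eq_comm] using hx
  · simpa [Touches, eq_comm] using hx'

/-- The sites of the string around `p` that are unpaired after the flip. -/
noncomputable def openEnds (p : L.Plaquette) (c : L.Config) : Finset L.Site :=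
  (L.flipSites p c).filter fun x => ¬ Covers (L.dimers (L.flip p c)) x

variable {p q : L.Plaquette} {c : L.Config}

/-- The sites of the string that are paired after the flip are the ends of the new dimers, two for
each; the others are the open ends. The division rounds down, so zero open ends contribute `0` and
one or two contribute `1`. -/
theorem flipLength_eq (p : L.Plaquette) (c : L.Config) :
    L.flipLength p c =
      (L.dimers (L.flip p c) \ L.dimers c).card + ((openEnds p c).card + 1) / 2 := by
  have h : (L.flipSites p c).filter (fun x => Covers (L.dimers (L.flip p c)) x) =
      Finset.univ.filter (Covers (L.dimers (L.flip p c) \ L.dimers c)) := by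
    ext x
    simp only [Finset.mem_filter, Finset.mem_univ, true_and]
    constructor
    · rintro ⟨hx, l', hl', hxl'⟩
      obtain ⟨l, hl, hxl⟩ := mem_flipSites.1 hx
      refine ⟨l', Finset.mem_sdiff.2 ⟨hl', fun hc => ?_⟩, hxl'⟩
      rcases Finset.mem_symmDiff.1 hl with hl | hl
      · have := isMatching_dimers _ l hl.1 l' hc x hxl hxl'
        exact hl.2 (this ▸ hl')
      · have := isMatching_dimers _ l hl.1 l' hl' x hxl hxl'
        exact hl.2 (this ▸ hc)
    · rintro ⟨l, hl, hxl⟩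
      have hl' := Finset.mem_sdiff.1 hl
      exact ⟨mem_flipSites.2 ⟨l, Finset.mem_symmDiff.2 (Or.inr hl'), hxl⟩, l, hl'.1, hxl⟩
  have hm : IsMatching (L.dimers (L.flip p c) \ L.dimers c) :=
    (isMatching_dimers _).mono Finset.sdiff_subset
  have hcard := Finset.card_filter_add_card_filter_not (s := L.flipSites p c)
    (fun x => Covers (L.dimers (L.flip p c)) x)
  rw [h, card_filter_covers hm] at hcard
  unfold flipLength openEnds
  omega

/-- An open end is thus decided by the spins of the two plaquettes at a boundary vertex of `p`, so
only nearest neighbours of `p` can affect it. -/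
theorem mem_openEnds {x : L.Site} : x ∈ openEnds p c ↔
    L.face (L.rot x.1) ∈ L.hole ∧ (L.face x.1 = p.1 ∨ L.face (rev x.1) = p.1) ∧
      faceSpin (L.flip p c) (L.face x.1) ≠ faceSpin (L.flip p c) (L.face (rev x.1)) := by
  rw [openEnds, Finset.mem_filter, covers_dimers_iff, not_or, not_not]
  constructor
  · rintro ⟨hx, hh, hs⟩
    refine ⟨hh, ?_, hs⟩
    obtain ⟨l, hl, hxl⟩ := mem_flipSites.1 hx
    rcases touches_iff.1 hxl with rfl | ⟨h, rfl⟩ | ⟨h, rfl⟩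
    · exact edgeLink_mem_symmDiff_iff.1 hl
    · exact absurd hh h.2.1
    · have := h.next.2.1
      rw [L.rot_rot_rot] at this
      exact absurd hh this
  · rintro ⟨hh, hf, hs⟩
    exact ⟨mem_flipSites_of_face hf, hh, hs⟩

theorem openEnds_eq_empty (hp : ¬ L.IsBoundary p) : openEnds p c = ∅ := by
  refine Finset.eq_empty_of_forall_notMem fun x hx => ?_
  have := mem_openEnds.1 hx
  exact hp (L.isBoundary_of_face_rot_mem_hole this.1 this.2.1)

/-- Flipping a plaquette that is not consecutive to `p` does not affect the ends of the string. -/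
theorem openEnds_flip (hpq : p ≠ q) (h : ¬ L.NearestNeighbors p q) :
    openEnds p (L.flip q c) = openEnds p c := by
  ext x
  rw [mem_openEnds, mem_openEnds, flip_comm]
  refine and_congr_right fun hh => and_congr_right fun hp => ?_
  have hq : ¬ (L.face x.1 = q.1 ∨ L.face (rev x.1) = q.1) := fun hq =>
    h ⟨x.1, L.mem_sharedBoundaryVertices hpq hh hp hq⟩
  rw [not_or] at hq
  rw [faceSpin_flip _ q, faceSpin_flip _ q, if_neg hq.1, if_neg hq.2]

/-! ### The flip operators on constrained states -/

/-- The normalization of the flip operator. -/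
noncomputable def flipConst (p : L.Plaquette) (c : L.Config) : ℂ :=
  (((2 : ℝ) ^ (((L.flipLength p c : ℝ) - 1) / 2) : ℝ) : ℂ)

/-- The projectors of the dimers common to both covers are absorbed by the factor on the right. -/
theorem projOn_sdiff_mul_projOn {A : Type*} [Ring A] [Algebra ℂ A] {γ : L.Site → A}
    (hγ : IsMajorana γ) (c c' : L.Config) :
    projOn γ (L.dimers c' \ L.dimers c) * projOn γ (L.dimers c) =
      projOn γ (L.dimers c') * projOn γ (L.dimers c) := by
  have hd : Disjoint (L.dimers c' \ L.dimers c) (L.dimers c' ∩ L.dimers c) :=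
    Finset.disjoint_sdiff_inter _ _
  have hu : (L.dimers c' \ L.dimers c) ∪ (L.dimers c' ∩ L.dimers c) = L.dimers c' :=
    Finset.sdiff_union_inter _ _
  have h := projOn_union hγ hd (by rw [hu]; exact isMatching_dimers c')
  rw [hu] at h
  rw [h, mul_assoc, projOn_mul_of_fixed fun l hl =>
    bondOp_mul_projOn hγ (isMatching_dimers c) (Finset.mem_inter.1 hl).2]

theorem projOn_apply_of_mem {ψ : L.State} (hψ : ψ ∈ L.constrained) (c : L.Config) :
    projOn L.majorana (L.dimers c) (ψ c) = ψ c :=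
  projOn_majorana_apply (hψ c)

/-- The constraint on `ψ` allows the product over new dimers to be replaced by the full projector of
the target cover. -/
theorem F_apply {ψ : L.State} (hψ : ψ ∈ L.constrained) (p : L.Plaquette) (c : L.Config) :
    L.F p ψ c = flipConst p (L.flip p c) • projOn L.majorana (L.dimers c) (ψ (L.flip p c)) := by
  have h := LinearMap.congr_fun
    (projOn_sdiff_mul_projOn (L := L) isMajorana_majorana (L.flip p c) c) (ψ (L.flip p c))
  rw [Module.End.mul_apply, Module.End.mul_apply, projOn_apply_of_mem hψ] at h
  rw [← h]
  change L.flipFermion p (L.flip p c) (ψ (L.flip p c)) = _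
  unfold flipFermion
  rw [flip_flip]
  rfl

theorem F_mem_constrained {ψ : L.State} (hψ : ψ ∈ L.constrained) (p : L.Plaquette) :
    L.F p ψ ∈ L.constrained := by
  intro c l hl
  rw [F_apply hψ, map_smul, bond_projOn_apply (isMatching_dimers c) hl]

theorem flipConst_mul_flipConst {p q : L.Plaquette} {c c' : L.Config} :
    flipConst p c * flipConst q c' =
      (((2 : ℝ) ^ (((L.flipLength p c : ℝ) + L.flipLength q c') / 2 - 1) : ℝ) : ℂ) := by
  unfold flipConst
  rw [← Complex.ofReal_mul, ← Real.rpow_add two_pos]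
  congr 2
  ring

theorem flipLength_flip : L.flipLength p (L.flip p c) = L.flipLength p c := by
  unfold flipLength flipSites
  rw [flip_flip, symmDiff_comm]

/-- Dropping the redundant new projector leaves a set that misses a site of the loop, so each of the
remaining ones contributes `1 / 2`. There is one fewer of them than new dimers, which is what the
two normalizations compensate. -/
theorem F_F_self (hp : ¬ L.IsBoundary p) {ψ : L.State} (hψ : ψ ∈ L.constrained) :
    L.F p (L.F p ψ) = ψ := by
  funext c
  obtain ⟨d, hd⟩ := Quotient.exists_rep p.1
  have hd : L.face d = p.1 := hd
  let x : L.Site := siteOf d (L.isInterior_of_not_isBoundary hp hd)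
  have hx : L.face x.1 = p.1 := hd
  have hxs : x ∈ L.flipSites p c := mem_flipSites_of_face (Or.inl hx)
  -- A bulk plaquette has no open ends, so `x` is paired after the flip. Its new partner link cannot
  -- be an old dimer, since some toggled link also ends at `x`.
  obtain ⟨l, hl, hxl⟩ : Covers (L.dimers (L.flip p c) \ L.dimers c) x := by
    by_contra hn
    have hno : x ∉ openEnds p c := by simp [openEnds_eq_empty hp]
    have hc : Covers (L.dimers (L.flip p c)) x := by
      by_contra h
      exact hno (Finset.mem_filter.2 ⟨hxs, h⟩)
    obtain ⟨l', hl', hxl'⟩ := hc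
    obtain ⟨l, hl, hxl⟩ := mem_flipSites.1 hxs
    have hlc : l' ∈ L.dimers c := by
      by_contra h
      exact hn ⟨l', Finset.mem_sdiff.2 ⟨hl', h⟩, hxl'⟩
    rcases Finset.mem_symmDiff.1 hl with h | h
    · exact h.2 ((isMatching_dimers _ l h.1 l' hlc x hxl hxl') ▸ hl')
    · exact h.2 ((isMatching_dimers _ l h.1 l' hl' x hxl hxl') ▸ hlc)
  have hop : projOn L.majorana (L.dimers c) * projOn L.majorana (L.dimers (L.flip p c)) *
      projOn L.majorana (L.dimers c) =
      (1 / 2 : ℂ) ^ ((L.dimers (L.flip p c) \ L.dimers c).card - 1) •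
        projOn L.majorana (L.dimers c) := by
    rw [mul_assoc, ← projOn_sdiff_mul_projOn isMajorana_majorana,
      projOn_mul_projOn_eq_erase isMajorana_majorana hp hx hl hxl, ← mul_assoc,
      projOn_mul_projOn_mul_projOn isMajorana_majorana (Finset.erase_subset _ _) hxs,
      Finset.card_erase_of_mem hl]
    rintro ⟨l', hl', hxl'⟩
    refine Finset.ne_of_mem_erase hl' (isMatching_dimers (L.flip p c) l' ?_ l ?_ x hxl' hxl)
    · exact (Finset.mem_sdiff.1 (Finset.mem_of_mem_erase hl')).1
    · exact (Finset.mem_sdiff.1 hl).1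
  have happ := LinearMap.congr_fun hop (ψ c)
  rw [Module.End.mul_apply, Module.End.mul_apply, LinearMap.smul_apply,
    projOn_apply_of_mem hψ c] at happ
  rw [F_apply (F_mem_constrained hψ p), F_apply hψ, flip_flip, map_smul, happ, smul_smul, smul_smul,
    flipConst_mul_flipConst, flipLength_flip, flipLength_eq, openEnds_eq_empty hp]
  have hpos : 0 < (L.dimers (L.flip p c) \ L.dimers c).card := Finset.card_pos.2 ⟨l, hl⟩
  generalize (L.dimers (L.flip p c) \ L.dimers c).card = n at *
  obtain ⟨n, rfl⟩ : ∃ m, n = m + 1 := ⟨n - 1, by omega⟩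
  -- Here `(0 + 1) / 2 = 0` in the natural numbers, so both string lengths equal the number `n + 1`
  -- of new dimers.
  have h1 : (((n + 1 + ((∅ : Finset L.Site).card + 1) / 2 : ℕ) : ℝ) +
      ((n + 1 + ((∅ : Finset L.Site).card + 1) / 2 : ℕ) : ℝ)) / 2 - 1 = (n : ℝ) := by
    simp
  rw [h1, Real.rpow_natCast, Nat.add_sub_cancel]
  push_cast
  rw [← mul_pow]
  norm_num

end TFLattice

/-! ### Pauli-type identities -/

section Pauli

variable {A : Type*} [Ring A] [Algebra ℂ A]

/-- If one factor of a bond is absorbed on the left and the other on the right, the bond acts as the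
scalar `κ`. -/
theorem mul_pauli_mul {U V W B S T : A} {κ : ℂ} (hB : B = κ • (S * T)) (hU : U * S = U)
    (hV : T * V = V) (hW : Commute T W) : U * B * W * V = κ • (U * W * V) := by
  rw [hB, mul_smul_comm, smul_mul_assoc, smul_mul_assoc, ← mul_assoc, hU, mul_assoc U, hW.eq,
    mul_assoc, mul_assoc W, hV, mul_assoc]

theorem mul_pauli_mul_of_anticomm {U V W B S T e : A} {κ : ℂ} (hB : B = κ • (S * T))
    (hU : U * S = U) (hV : T * V = V) (hW : Commute T W) (he : T * e = -(e * T)) :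
    U * B * (e * W) * V = -κ • (U * (e * W) * V) := by
  rw [hB, mul_smul_comm, smul_mul_assoc, smul_mul_assoc, ← mul_assoc U, hU, mul_assoc U,
    ← mul_assoc T, he, neg_mul, mul_assoc e, hW.eq, mul_neg, neg_mul, mul_assoc U, mul_assoc e,
    mul_assoc W, hV, smul_neg, neg_smul, mul_assoc U, mul_assoc e]

end Pauli

/-! ### Scaled projectors and the dimers at a shared vertex. -/

namespace TFLattice

open TrivalentMap TrivalentSurface

open scoped Classical

variable {E : Type*} {L : TFLattice E}

/-- The complex number `√2`. -/
noncomputable def sqrtTwo : ℂ := ((Real.sqrt 2 : ℝ) : ℂ)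

theorem sqrtTwo_mul_self : sqrtTwo * sqrtTwo = 2 := by
  unfold sqrtTwo
  rw [← Complex.ofReal_mul, Real.mul_self_sqrt (by norm_num)]
  norm_num

theorem sqrtTwo_ne_zero : sqrtTwo ≠ 0 := by
  intro h
  have := sqrtTwo_mul_self
  rw [h] at this
  norm_num at this

section Algebra

variable {A : Type*} [Ring A] [Algebra ℂ A] {γ : L.Site → A}

/-- The projector of a link, scaled by `√2`. -/
noncomputable def scaledProj (γ : L.Site → A) (l : L.Link) : A := sqrtTwo • projOp γ l

/-- The product of the scaled projectors of the links in `s`. -/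
noncomputable def scaledProjOn (γ : L.Site → A) (s : Finset L.Link) : A :=
  orderedProd s (scaledProj γ)

theorem scaledProjOn_eq (s : Finset L.Link) :
    scaledProjOn γ s = sqrtTwo ^ s.card • projOn γ s :=
  orderedProd_smul s (projOp γ) sqrtTwo

theorem scaledProj_eq (l : L.Link) :
    scaledProj γ l = (sqrtTwo / 2) • (1 + bondOp γ l) := by
  unfold scaledProj projOp
  rw [smul_smul]
  congr 1
  ring

theorem IsMatching.commute_scaledProj (hγ : IsMajorana γ) {s : Finset L.Link} (hs : IsMatching s) :
    ∀ l ∈ s, ∀ l' ∈ s, Commute (scaledProj γ l) (scaledProj γ l') := fun l hl l' hl' =>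
  ((hs.commute_projOp hγ l hl l' hl').smul_left _).smul_right _

theorem commute_scaledProjOn {a : A} {s : Finset L.Link}
    (h : ∀ l ∈ s, ∀ x, Touches x l → Commute a (γ x)) : Commute a (scaledProjOn γ s) :=
  commute_orderedProd fun l hl => (commute_projOp (commute_bondOp (h l hl))).smul_right _

theorem commute_majorana_scaledProjOn (hγ : IsMajorana γ) {s : Finset L.Link} {x : L.Site}
    (h : ¬ Covers s x) : Commute (γ x) (scaledProjOn γ s) :=
  commute_orderedProd fun l hl => (commute_projOp
    (commute_bondOp_of_not_touches hγ fun hx => h ⟨l, hl, hx⟩)).smul_right _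

/-- For `κ = i` and `κ = -i` the resulting scalars are `phase` and `phaseInv`, the sources of all
phases below. -/
theorem mul_scaledProj_mul {U V W : A} {l : L.Link} {κ : ℂ}
    (h : U * bondOp γ l * W * V = κ • (U * W * V)) :
    U * scaledProj γ l * W * V = (sqrtTwo / 2 * (1 + κ)) • (U * W * V) := by
  rw [scaledProj_eq, mul_smul_comm, smul_mul_assoc, smul_mul_assoc, mul_add, mul_one, add_mul,
    add_mul, h, mul_smul, add_smul, one_smul]

theorem scaledProjOn_singleton {l : L.Link} : scaledProjOn γ {l} = scaledProj γ l :=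
  orderedProd_singleton

theorem scaledProjOn_empty : scaledProjOn γ (∅ : Finset L.Link) = 1 := orderedProd_empty

end Algebra

theorem cornerLink_inj {d d' : E × Bool} {h : L.IsBulkVertex d} {h' : L.IsBulkVertex d'} :
    cornerLink d h = cornerLink d' h' ↔ d = d' :=
  ⟨fun e => congrArg Subtype.val (Sum.inr_injective e), fun e => by subst e; rfl⟩

theorem edgeLink_ne_cornerLink {x : L.Site} {d : E × Bool} {h : L.IsBulkVertex d} :
    edgeLink x ≠ cornerLink d h := Sum.inl_ne_inr

theorem ne_of_faces {d : E × Bool} {p q : L.Plaquette} (hp : L.face d = p.1)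
    (hq : L.face (rev d) = q.1) : p.1 ≠ q.1 :=
  hp ▸ hq ▸ L.face_ne d

theorem forall_sameVertex {d : E × Bool} {P : ∀ d', L.IsBulkVertex d' → Prop}
    (hb : L.IsBulkVertex d) (h0 : P d hb) (h1 : P (L.rot d) hb.next)
    (h2 : P (L.rot (L.rot d)) hb.next.next) :
    ∀ d' h', L.SameVertex d d' → P d' h' := by
  intro d' h' hd'
  rcases sameVertex_iff.1 hd' with rfl | rfl | rfl
  exacts [h0, h1, h2]

/-- The spins around a vertex of an edge shared by `p` and `q` after flips of `p` and `q`. -/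
theorem faceSpin_vertex {d : E × Bool} {p q : L.Plaquette} (hp : L.face d = p.1)
    (hq : L.face (rev d) = q.1) (c : L.Config) :
    faceSpin (L.flip p c) (L.face d) = !faceSpin c p.1 ∧
    faceSpin (L.flip p c) (L.face (L.rot d)) = faceSpin c (L.face (L.rot d)) ∧
    faceSpin (L.flip p c) (L.face (L.rot (L.rot d))) = faceSpin c q.1 ∧
    faceSpin (L.flip q c) (L.face d) = faceSpin c p.1 ∧
    faceSpin (L.flip q c) (L.face (L.rot d)) = faceSpin c (L.face (L.rot d)) ∧
    faceSpin (L.flip q c) (L.face (L.rot (L.rot d))) = !faceSpin c q.1 := by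
  have hne := ne_of_faces hp hq
  have h1 := L.face_ne_face_rot d
  have h2 := L.face_ne_face_rot (L.rot d)
  rw [L.face_rev] at hq
  simp only [faceSpin_flip, hp, hq, hne, hne.symm, if_true, if_false]
  rw [hp] at h1
  rw [hq] at h2
  simp [h1.symm, h2]

section Finite

variable [Finite E]

/-- The links covered in `c'` but neither in `c` nor in `c''`. -/
noncomputable def middle (c c' c'' : L.Config) : Finset L.Link :=
  L.dimers c' \ (L.dimers c ∪ L.dimers c'')

theorem isMatching_middle (c c' c'' : L.Config) : IsMatching (middle c c' c'') :=
  (isMatching_dimers c').mono Finset.sdiff_subset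

theorem mem_middle {c c' c'' : L.Config} {l : L.Link} :
    l ∈ middle c c' c'' ↔ L.IsDimer c' l ∧ ¬ L.IsDimer c l ∧ ¬ L.IsDimer c'' l := by
  simp only [middle, Finset.mem_sdiff, Finset.mem_union, mem_dimers, not_or]

/-- The triangle edges at the vertex of `d`. -/
noncomputable def vertexLinks (d : E × Bool) : Finset L.Link :=
  Finset.univ.filter fun l => ∃ d', L.SameVertex d d' ∧ ∃ h, l = cornerLink d' h

theorem mem_vertexLinks {d : E × Bool} {l : L.Link} :
    l ∈ vertexLinks d ↔ ∃ d', L.SameVertex d d' ∧ ∃ h, l = cornerLink d' h := by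
  simp [vertexLinks]

theorem sameVertex_of_touches {d : E × Bool} {l : L.Link} (hl : l ∈ vertexLinks d) {x : L.Site}
    (hx : Touches x l) : L.SameVertex d x.1 := by
  obtain ⟨d', hd', h, rfl⟩ := mem_vertexLinks.1 hl
  rcases touches_cornerLink.1 hx with hx | hx
  · rwa [hx]
  · rw [hx]
    exact Equiv.Perm.sameCycle_apply_right.2 hd'

variable {d : E × Bool} {s : Finset L.Link}

theorem inter_vertexLinks_eq_singleton {d₀ : E × Bool} (h₀ : L.IsBulkVertex d₀)
    (hd₀ : L.SameVertex d d₀)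
    (h : ∀ d' h', L.SameVertex d d' → (cornerLink d' h' ∈ s ↔ d' = d₀)) :
    s ∩ vertexLinks d = {cornerLink d₀ h₀} := by
  ext l
  rw [Finset.mem_inter, mem_vertexLinks, Finset.mem_singleton]
  constructor
  · rintro ⟨hl, d', hd', h', rfl⟩
    exact cornerLink_inj.2 ((h d' h' hd').1 hl)
  · rintro rfl
    exact ⟨(h d₀ h₀ hd₀).2 rfl, d₀, hd₀, h₀, rfl⟩

theorem inter_vertexLinks_eq_empty
    (h : ∀ d' h', L.SameVertex d d' → cornerLink d' h' ∉ s) : s ∩ vertexLinks d = ∅ := by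
  refine Finset.eq_empty_of_forall_notMem fun l hl => ?_
  rw [Finset.mem_inter, mem_vertexLinks] at hl
  obtain ⟨hl, d', hd', h', rfl⟩ := hl
  exact h d' h' hd' hl

section Vertex

variable {p q : L.Plaquette} {c : L.Config}

theorem mem_middle_cornerLink (hp : L.face d = p.1) (hq : L.face (rev d) = q.1)
    (hb : L.IsBulkVertex d) :
    (cornerLink d hb ∈ middle c (L.flip p c) (L.flip p (L.flip q c)) ↔
      faceSpin c p.1 = faceSpin c q.1 ∧ faceSpin c (L.face (L.rot d)) = faceSpin c p.1) ∧
    (cornerLink (L.rot d) hb.next ∈ middle c (L.flip p c) (L.flip p (L.flip q c)) ↔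
      faceSpin c p.1 ≠ faceSpin c q.1 ∧ faceSpin c (L.face (L.rot d)) = faceSpin c p.1) ∧
    (cornerLink (L.rot (L.rot d)) hb.next.next ∈
      middle c (L.flip p c) (L.flip p (L.flip q c)) ↔
      faceSpin c p.1 = faceSpin c q.1 ∧ faceSpin c (L.face (L.rot d)) ≠ faceSpin c p.1) ∧
    (cornerLink d hb ∈ middle c (L.flip q c) (L.flip p (L.flip q c)) ↔
      faceSpin c p.1 = faceSpin c q.1 ∧ faceSpin c (L.face (L.rot d)) ≠ faceSpin c p.1) ∧
    (cornerLink (L.rot d) hb.next ∈ middle c (L.flip q c) (L.flip p (L.flip q c)) ↔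
      faceSpin c p.1 ≠ faceSpin c q.1 ∧ faceSpin c (L.face (L.rot d)) ≠ faceSpin c p.1) ∧
    (cornerLink (L.rot (L.rot d)) hb.next.next ∈
      middle c (L.flip q c) (L.flip p (L.flip q c)) ↔
      faceSpin c p.1 = faceSpin c q.1 ∧ faceSpin c (L.face (L.rot d)) = faceSpin c p.1) := by
  obtain ⟨h1, h2, h3, h4, h5, h6⟩ := faceSpin_vertex hp hq c
  obtain ⟨k1, k2, k3, -⟩ := faceSpin_vertex hp hq (L.flip q c)
  rw [← hp, h4] at k1
  rw [h5] at k2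
  rw [← hq, L.face_rev, h6] at k3
  rw [L.face_rev] at hq
  simp only [mem_middle, isDimer_cornerLink, L.rot_rot_rot, h1, h2, h3, h4, h5, h6, k1, k2, k3]
  simp only [hp, hq]
  generalize faceSpin c p.1 = a
  generalize faceSpin c q.1 = b
  generalize faceSpin c (L.face (L.rot d)) = r
  cases a <;> cases b <;> cases r <;> simp

/-- The first three lines tell which triangle bonds are absorbed by `V`, the last three which are
absorbed by `U`. -/
theorem cornerLink_mem_dimers (hp : L.face d = p.1) (hq : L.face (rev d) = q.1)
    (hb : L.IsBulkVertex d) :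
    (cornerLink d hb ∈ L.dimers c ↔
      faceSpin c p.1 ≠ faceSpin c (L.face (L.rot d)) ∧ faceSpin c p.1 ≠ faceSpin c q.1) ∧
    (cornerLink (L.rot d) hb.next ∈ L.dimers c ↔
      faceSpin c (L.face (L.rot d)) ≠ faceSpin c p.1 ∧ faceSpin c p.1 = faceSpin c q.1) ∧
    (cornerLink (L.rot (L.rot d)) hb.next.next ∈ L.dimers c ↔
      faceSpin c q.1 ≠ faceSpin c p.1 ∧ faceSpin c p.1 = faceSpin c (L.face (L.rot d))) ∧
    (cornerLink d hb ∈ L.dimers (L.flip p (L.flip q c)) ↔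
      faceSpin c p.1 = faceSpin c (L.face (L.rot d)) ∧ faceSpin c p.1 ≠ faceSpin c q.1) ∧
    (cornerLink (L.rot d) hb.next ∈ L.dimers (L.flip p (L.flip q c)) ↔
      faceSpin c (L.face (L.rot d)) = faceSpin c p.1 ∧ faceSpin c p.1 = faceSpin c q.1) ∧
    (cornerLink (L.rot (L.rot d)) hb.next.next ∈ L.dimers (L.flip p (L.flip q c)) ↔
      faceSpin c q.1 ≠ faceSpin c p.1 ∧ faceSpin c p.1 ≠ faceSpin c (L.face (L.rot d))) := by
  obtain ⟨h1, h2, h3, h4, h5, h6⟩ := faceSpin_vertex hp hq c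
  obtain ⟨k1, k2, k3, -⟩ := faceSpin_vertex hp hq (L.flip q c)
  rw [← hp, h4] at k1
  rw [h5] at k2
  rw [← hq, L.face_rev, h6] at k3
  rw [L.face_rev] at hq
  simp only [mem_dimers, isDimer_cornerLink, L.rot_rot_rot, k1, k2, k3]
  simp only [hp, hq]
  generalize faceSpin c p.1 = a
  generalize faceSpin c q.1 = b
  generalize faceSpin c (L.face (L.rot d)) = r
  cases a <;> cases b <;> cases r <;> simp

/-- The parts of the intermediate dimer covers at a vertex shared by `p` and `q`, if these have
equal spins. -/
theorem middle_inter_vertexLinks_of_eq (hp : L.face d = p.1) (hq : L.face (rev d) = q.1)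
    (hb : L.IsBulkVertex d) (hs : faceSpin c p.1 = faceSpin c q.1) :
    (faceSpin c (L.face (L.rot d)) = faceSpin c p.1 →
      middle c (L.flip p c) (L.flip p (L.flip q c)) ∩ vertexLinks d = {cornerLink d hb} ∧
      middle c (L.flip q c) (L.flip p (L.flip q c)) ∩ vertexLinks d =
        {cornerLink _ hb.next.next}) ∧
    (faceSpin c (L.face (L.rot d)) ≠ faceSpin c p.1 →
      middle c (L.flip p c) (L.flip p (L.flip q c)) ∩ vertexLinks d =
        {cornerLink _ hb.next.next} ∧
      middle c (L.flip q c) (L.flip p (L.flip q c)) ∩ vertexLinks d = {cornerLink d hb}) := by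
  obtain ⟨h1, h2, h3, h4, h5, h6⟩ := mem_middle_cornerLink (c := c) hp hq hb
  have e0 := L.rot_ne d
  have e1 := L.rot_rot_ne d
  have e2 := L.rot_rot_ne_rot d
  have sv : L.SameVertex d d := sameVertex_iff.2 (Or.inl rfl)
  have sv2 : L.SameVertex d (L.rot (L.rot d)) := sameVertex_iff.2 (Or.inr (Or.inr rfl))
  refine ⟨fun hr => ⟨?_, ?_⟩, fun hr => ⟨?_, ?_⟩⟩
  · refine inter_vertexLinks_eq_singleton hb sv (forall_sameVertex hb ?_ ?_ ?_)
    · simp [h1, hs, hr]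
    · simp [h2, hs, e0]
    · simp [h3, hs, hr, e1]
  · refine inter_vertexLinks_eq_singleton hb.next.next sv2 (forall_sameVertex hb ?_ ?_ ?_)
    · simp [h4, hs, hr, e1.symm]
    · simp [h5, hs, e2.symm]
    · simp [h6, hs, hr]
  · refine inter_vertexLinks_eq_singleton hb.next.next sv2 (forall_sameVertex hb ?_ ?_ ?_)
    · rw [hs] at hr; simp [h1, hs, hr, e1.symm]
    · simp [h2, hs, e2.symm]
    · rw [hs] at hr; simp [h3, hs, hr]
  · refine inter_vertexLinks_eq_singleton hb sv (forall_sameVertex hb ?_ ?_ ?_)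
    · rw [hs] at hr; simp [h4, hs, hr]
    · simp [h5, hs, e0]
    · rw [hs] at hr; simp [h6, hs, hr, e1]

/-- The parts of the intermediate dimer covers at a vertex shared by `p` and `q`, if these have
opposite spins. -/
theorem middle_inter_vertexLinks_of_ne (hp : L.face d = p.1) (hq : L.face (rev d) = q.1)
    (hb : L.IsBulkVertex d) (hs : faceSpin c p.1 ≠ faceSpin c q.1) :
    (faceSpin c (L.face (L.rot d)) = faceSpin c p.1 →
      middle c (L.flip p c) (L.flip p (L.flip q c)) ∩ vertexLinks d = {cornerLink _ hb.next} ∧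
      middle c (L.flip q c) (L.flip p (L.flip q c)) ∩ vertexLinks d = ∅) ∧
    (faceSpin c (L.face (L.rot d)) ≠ faceSpin c p.1 →
      middle c (L.flip p c) (L.flip p (L.flip q c)) ∩ vertexLinks d = ∅ ∧
      middle c (L.flip q c) (L.flip p (L.flip q c)) ∩ vertexLinks d =
        {cornerLink _ hb.next}) := by
  obtain ⟨h1, h2, h3, h4, h5, h6⟩ := mem_middle_cornerLink (c := c) hp hq hb
  have e0 := L.rot_ne d
  have e2 := L.rot_rot_ne_rot d
  have sv : L.SameVertex d (L.rot d) := sameVertex_iff.2 (Or.inr (Or.inl rfl))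
  refine ⟨fun hr => ⟨?_, ?_⟩, fun hr => ⟨?_, ?_⟩⟩
  · refine inter_vertexLinks_eq_singleton hb.next sv (forall_sameVertex hb ?_ ?_ ?_)
    · simp [h1, hs, e0.symm]
    · simp [h2, hs, hr]
    · simp [h3, hs, e2]
  · refine inter_vertexLinks_eq_empty (forall_sameVertex hb ?_ ?_ ?_)
    · simp [h4, hs]
    · simp [h5, hr]
    · simp [h6, hs]
  · refine inter_vertexLinks_eq_empty (forall_sameVertex hb ?_ ?_ ?_)
    · simp [h1, hs]
    · simp [h2, hr]
    · simp [h3, hs]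
  · refine inter_vertexLinks_eq_singleton hb.next sv (forall_sameVertex hb ?_ ?_ ?_)
    · simp [h4, hs, e0.symm]
    · simp [h5, hs, hr]
    · simp [h6, hs, e2]

/-! ### The identity at a shared vertex -/

variable {A : Type*} [Ring A] [Algebra ℂ A] {γ : L.Site → A}

/-- The Pauli-type product, read cyclically in both orders, expresses the triangle bond not touching
`d` through the two that do. -/
theorem bondOp_rot_eq (hγ : IsMajorana γ) (hb : L.IsBulkVertex d) :
    bondOp γ (cornerLink (L.rot d) hb.next) = Complex.I •
      (bondOp γ (cornerLink d hb) * bondOp γ (cornerLink (L.rot (L.rot d)) hb.next.next)) ∧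
    bondOp γ (cornerLink (L.rot d) hb.next) = -Complex.I •
      (bondOp γ (cornerLink (L.rot (L.rot d)) hb.next.next) * bondOp γ (cornerLink d hb)) := by
  have h0 := bondOp_cornerLink_mul hγ hb
  have h2 := bondOp_cornerLink_mul hγ hb.next.next
  have e3 : cornerLink (L.rot (L.rot (L.rot d))) hb.next.next.next = cornerLink d hb :=
    cornerLink_inj.2 (L.rot_rot_rot d)
  have e4 : cornerLink (L.rot (L.rot (L.rot (L.rot d)))) hb.next.next.next.next =
    cornerLink (L.rot d) hb.next := cornerLink_inj.2 (L.rot_rot_rot _)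
  rw [e3, e4] at h2
  constructor
  · have : bondOp γ (cornerLink d hb) * (bondOp γ (cornerLink d hb) *
        bondOp γ (cornerLink (L.rot d) hb.next)) = bondOp γ (cornerLink (L.rot d) hb.next) := by
      rw [← mul_assoc, bondOp_mul_self hγ, one_mul]
    rw [← this, h0, mul_smul_comm]
  · rw [h2, smul_smul]
    have : -Complex.I * Complex.I = 1 := by linear_combination -Complex.I_sq
    rw [this, one_smul]

/-- An operator that commutes with the Majorana operators at the vertex of `d`. -/
def CommutesAt (γ : L.Site → A) (d : E × Bool) (W : A) : Prop :=
  ∀ x : L.Site, L.SameVertex d x.1 → Commute W (γ x)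

theorem CommutesAt.commute_bondOp {W : A} (hW : CommutesAt γ d W) {l : L.Link}
    (hl : l ∈ vertexLinks d) : Commute W (bondOp γ l) :=
  TFLattice.commute_bondOp fun _ hx => hW _ (sameVertex_of_touches hl hx)

theorem cornerLink_mem_vertexLinks (hb : L.IsBulkVertex d) :
    cornerLink d hb ∈ vertexLinks d ∧ cornerLink (L.rot d) hb.next ∈ vertexLinks d ∧
      cornerLink (L.rot (L.rot d)) hb.next.next ∈ vertexLinks d :=
  ⟨mem_vertexLinks.2 ⟨_, sameVertex_iff.2 (Or.inl rfl), _, rfl⟩,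
    mem_vertexLinks.2 ⟨_, sameVertex_iff.2 (Or.inr (Or.inl rfl)), _, rfl⟩,
    mem_vertexLinks.2 ⟨_, sameVertex_iff.2 (Or.inr (Or.inr rfl)), _, rfl⟩⟩

/-- The bond of the edge at `d` anticommutes with the two triangle edges at `d` and commutes with
the third. -/
theorem bondOp_edgeLink_commute (hγ : IsMajorana γ) (hb : L.IsBulkVertex d)
    (hrev : ¬ L.SameVertex d (rev d)) :
    bondOp γ (cornerLink d hb) * bondOp γ (edgeLink (siteOf d hb.isInterior)) =
      -(bondOp γ (edgeLink (siteOf d hb.isInterior)) * bondOp γ (cornerLink d hb)) ∧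
    Commute (bondOp γ (cornerLink (L.rot d) hb.next))
      (bondOp γ (edgeLink (siteOf d hb.isInterior))) ∧
    bondOp γ (cornerLink (L.rot (L.rot d)) hb.next.next) *
        bondOp γ (edgeLink (siteOf d hb.isInterior)) =
      -(bondOp γ (edgeLink (siteOf d hb.isInterior)) *
        bondOp γ (cornerLink (L.rot (L.rot d)) hb.next.next)) := by
  have hrv : ∀ d', L.SameVertex d d' → d' ≠ rev d := fun d' h h' => hrev (h' ▸ h)
  have hmem := cornerLink_mem_vertexLinks hb
  have hrevc : ∀ l ∈ vertexLinks d, Commute (γ (siteOf (rev d) hb.isInterior)) (bondOp γ l) :=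
    fun l hl => commute_bondOp_of_not_touches hγ fun ht => hrev (sameVertex_of_touches hl ht)
  have hedge := bondOp_edgeLink hγ hb.isInterior (show L.IsInterior (rev d).1 from hb.isInterior)
  have hanti : ∀ l ∈ vertexLinks d, Touches (siteOf d hb.isInterior) l →
      bondOp γ l * bondOp γ (edgeLink (siteOf d hb.isInterior)) =
        -(bondOp γ (edgeLink (siteOf d hb.isInterior)) * bondOp γ l) := by
    intro l hl ht
    rw [hedge, mul_smul_comm, smul_mul_assoc, ← smul_neg, ← mul_assoc, bondOp_mul_of_touches hγ ht,
      neg_mul, mul_assoc, ← (hrevc l hl).eq, mul_assoc]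
  refine ⟨hanti _ hmem.1 (touches_cornerLink.2 (Or.inl rfl)), ?_,
    hanti _ hmem.2.2 (touches_cornerLink.2 (Or.inr (L.rot_rot_rot d).symm))⟩
  rw [hedge]
  refine Commute.smul_right (Commute.mul_right ?_ (hrevc _ hmem.2.1).symm) _
  refine (commute_bondOp_of_not_touches hγ fun ht => ?_).symm
  rcases touches_cornerLink.1 ht with h | h
  · exact L.rot_ne d h.symm
  · exact L.rot_rot_ne d h.symm

/-- The phase `(1 + i) / √2`. -/
noncomputable def phase : ℂ := sqrtTwo / 2 * (1 + Complex.I)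

/-- The phase `(1 - i) / √2`. -/
noncomputable def phaseInv : ℂ := sqrtTwo / 2 * (1 + -Complex.I)

theorem phase_mul_phaseInv : phase * phaseInv = 1 := by
  unfold phase phaseInv
  linear_combination (1 / 2 : ℂ) * sqrtTwo_mul_self - sqrtTwo * sqrtTwo / 4 * Complex.I_sq

section VertexIdentity

variable {U V : A}

/-- For opposite spins, one of the two orders has an intermediate triangle dimer and the other none.
Its bond is `±i` times a product of an initial and a final dimer bond, so it acts as a scalar. With
the bond of the shared edge in between, the sign changes and the phase is inverted. -/
theorem vertex_identity_of_ne (hγ : IsMajorana γ) (hp : L.face d = p.1)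
    (hq : L.face (rev d) = q.1) (hb : L.IsBulkVertex d) (hrev : ¬ L.SameVertex d (rev d))
    (hs : faceSpin c p.1 ≠ faceSpin c q.1)
    (hU : ∀ l ∈ L.dimers (L.flip p (L.flip q c)), U * bondOp γ l = U)
    (hV : ∀ l ∈ L.dimers c, bondOp γ l * V = V) {W : A} (hW : CommutesAt γ d W) :
    U * scaledProjOn γ (middle c (L.flip p c) (L.flip p (L.flip q c)) ∩ vertexLinks d) * W * V =
      phase • (U * scaledProjOn γ
        (middle c (L.flip q c) (L.flip p (L.flip q c)) ∩ vertexLinks d) * W * V) ∧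
    U * scaledProjOn γ (middle c (L.flip p c) (L.flip p (L.flip q c)) ∩ vertexLinks d) *
        (bondOp γ (edgeLink (siteOf d hb.isInterior)) * W) * V =
      phaseInv • (U * scaledProjOn γ
        (middle c (L.flip q c) (L.flip p (L.flip q c)) ∩ vertexLinks d) *
        (bondOp γ (edgeLink (siteOf d hb.isInterior)) * W) * V) := by
  obtain ⟨m1, -, m3, m4, -, m6⟩ := cornerLink_mem_dimers (c := c) hp hq hb
  obtain ⟨v1, v2, v3⟩ := cornerLink_mem_vertexLinks hb
  obtain ⟨e1, -, e3⟩ := bondOp_edgeLink_commute hγ hb hrev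
  obtain ⟨b1, b2⟩ := bondOp_rot_eq hγ hb
  have hpi := phase_mul_phaseInv
  by_cases hr : faceSpin c (L.face (L.rot d)) = faceSpin c p.1
  · obtain ⟨r2, r3⟩ := (middle_inter_vertexLinks_of_ne hp hq hb hs).1 hr
    rw [r2, r3, scaledProjOn_singleton, scaledProjOn_empty, mul_one]
    have hA := hU _ (m4.2 ⟨hr.symm, hs⟩)
    have hC := hV _ (m3.2 ⟨hs.symm, hr.symm⟩)
    have hCW := (hW.commute_bondOp v3).symm
    exact ⟨mul_scaledProj_mul (mul_pauli_mul b1 hA hC hCW),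
      mul_scaledProj_mul (mul_pauli_mul_of_anticomm b1 hA hC hCW e3)⟩
  · obtain ⟨r2, r3⟩ := (middle_inter_vertexLinks_of_ne hp hq hb hs).2 hr
    rw [r2, r3, scaledProjOn_singleton, scaledProjOn_empty, mul_one]
    have hC := hU _ (m6.2 ⟨hs.symm, fun h => hr h.symm⟩)
    have hA := hV _ (m1.2 ⟨fun h => hr h.symm, hs⟩)
    have hAW := (hW.commute_bondOp v1).symm
    -- In this case the intermediate dimer belongs to the order that flips `q` first, so the
    -- computed factor stands on the other side and has to be inverted.
    have h1 := mul_scaledProj_mul (mul_pauli_mul b2 hC hA hAW)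
    have h2 := mul_scaledProj_mul (mul_pauli_mul_of_anticomm b2 hC hA hAW e1)
    rw [neg_neg] at h2
    rw [h1, h2, smul_smul, smul_smul]
    change _ = (phase * phaseInv) • _ ∧ _ = (phaseInv * phase) • _
    rw [mul_comm phaseInv, hpi, one_smul, one_smul]
    exact ⟨rfl, rfl⟩

/-- For equal spins each order has one intermediate triangle dimer, and they are the two corners
touching `d`. The third triangle bond is absorbed on one side, and multiplying by it turns one into
the other. -/
theorem vertex_identity_of_eq (hγ : IsMajorana γ) (hp : L.face d = p.1)
    (hq : L.face (rev d) = q.1) (hb : L.IsBulkVertex d)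
    (hs : faceSpin c p.1 = faceSpin c q.1)
    (hU : ∀ l ∈ L.dimers (L.flip p (L.flip q c)), U * bondOp γ l = U)
    (hV : ∀ l ∈ L.dimers c, bondOp γ l * V = V) :
    ∃ l m : L.Link, (l = cornerLink d hb ∨ l = cornerLink _ hb.next.next) ∧
      (m = cornerLink d hb ∨ m = cornerLink _ hb.next.next) ∧
      middle c (L.flip p c) (L.flip p (L.flip q c)) ∩ vertexLinks d = {l} ∧
      middle c (L.flip q c) (L.flip p (L.flip q c)) ∩ vertexLinks d = {m} ∧
      ∀ W, CommutesAt γ d W →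
        U * bondOp γ l * W * V = -Complex.I • (U * bondOp γ m * W * V) := by
  obtain ⟨-, m2, -, -, m5, -⟩ := cornerLink_mem_dimers (c := c) hp hq hb
  obtain ⟨v1, v2, v3⟩ := cornerLink_mem_vertexLinks hb
  obtain ⟨b1, b2⟩ := bondOp_rot_eq hγ hb
  have hsq1 := bondOp_mul_self hγ (cornerLink d hb)
  have hsq3 := bondOp_mul_self hγ (cornerLink _ hb.next.next)
  have hI : -Complex.I * Complex.I = 1 := by linear_combination -Complex.I_sq
  by_cases hr : faceSpin c (L.face (L.rot d)) = faceSpin c p.1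
  · obtain ⟨r2, r3⟩ := (middle_inter_vertexLinks_of_eq hp hq hb hs).1 hr
    refine ⟨_, _, Or.inl rfl, Or.inr rfl, r2, r3, fun W _ => ?_⟩
    have hB := hU _ (m5.2 ⟨hr, hs⟩)
    have hBA : bondOp γ (cornerLink (L.rot d) hb.next) * bondOp γ (cornerLink d hb) =
        -Complex.I • bondOp γ (cornerLink _ hb.next.next) := by
      rw [b2, smul_mul_assoc, mul_assoc, hsq1, mul_one]
    conv_lhs => rw [← hB, mul_assoc U, hBA]
    rw [mul_smul_comm, smul_mul_assoc, smul_mul_assoc]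
  · obtain ⟨r2, r3⟩ := (middle_inter_vertexLinks_of_eq hp hq hb hs).2 hr
    refine ⟨_, _, Or.inr rfl, Or.inl rfl, r2, r3, fun W hW => ?_⟩
    have hB := hV _ (m2.2 ⟨hr, hs⟩)
    have hCB : bondOp γ (cornerLink _ hb.next.next) * bondOp γ (cornerLink (L.rot d) hb.next) =
        -Complex.I • bondOp γ (cornerLink d hb) := by
      rw [b2, mul_smul_comm, ← mul_assoc, hsq3, one_mul]
    conv_lhs => rw [← hB, mul_assoc (U * _), ← mul_assoc W, (hW.commute_bondOp v2).eq, ← mul_assoc,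
      ← mul_assoc, mul_assoc U, hCB]
    rw [mul_smul_comm, smul_mul_assoc, smul_mul_assoc]

end VertexIdentity

end Vertex

end Finite

end TFLattice

/-! ### Cancellation of phases between the two ends of an edge. -/

section Swap

variable {A : Type*} [Ring A] [Algebra ℂ A]

/-- Primed factors belong to the second end of an edge, where the two orders have exchanged roles;
the same factor `κ` then appears on both sides. -/
theorem mul_mul_swap {U V Z x x' y y' : A} {κ : ℂ}
    (h : U * x * (x' * Z) * V = κ • (U * y * (x' * Z) * V))
    (h' : U * y' * (y * Z) * V = κ • (U * x' * (y * Z) * V))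
    (hc : Commute y x') (hc' : Commute y y') : U * (x * x') * Z * V = U * (y * y') * Z * V := by
  have e1 : U * (x * x') * Z * V = U * x * (x' * Z) * V := by simp only [mul_assoc]
  have e2 : U * (y * y') * Z * V = U * y' * (y * Z) * V := by
    rw [hc'.eq]; simp only [mul_assoc]
  have e3 : U * y * (x' * Z) * V = U * x' * (y * Z) * V := by
    rw [mul_assoc U, ← mul_assoc y, hc.eq]; simp only [mul_assoc]
  rw [e1, e2, h, h', e3]

/-- Moving `e` from right to left through the product changes the sign and nothing else. -/
theorem mul_eq_zero_of_anticomm {U V X Z e : A} (hU : U * e = U) (hV : e * V = V)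
    (hX : X * e = -(e * X)) (hZ : Commute Z e) : U * X * Z * V = 0 := by
  have h : U * X * Z * V = -(U * X * Z * V) := by
    conv_lhs => rw [← hV, mul_assoc (U * X), ← mul_assoc Z, hZ.eq, ← mul_assoc, ← mul_assoc,
      mul_assoc U, hX, mul_neg, ← mul_assoc, hU, neg_mul, neg_mul]
  have h2 : (2 : ℂ) • (U * X * Z * V) = 0 := by
    rw [two_smul]
    nth_rw 2 [h]
    simp
  exact (smul_eq_zero.1 h2).resolve_left two_ne_zero

end Swap

namespace TFLattice

open TrivalentMap TrivalentSurface

open scoped Classical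

variable {E : Type*} {L : TFLattice E} {p q : L.Plaquette} {d d' : E × Bool}

/-! ### Edges shared by two plaquettes -/

/-- The half-edge `d` has the plaquette `p` on its left and `q` on its right. -/
def Separates (p q : L.Plaquette) (d : E × Bool) : Prop := L.face d = p.1 ∧ L.face (rev d) = q.1

theorem Separates.rev (h : Separates p q d) : Separates q p (rev d) :=
  ⟨h.2, by rw [rev_rev]; exact h.1⟩

theorem Separates.ne (h : Separates p q d) : p ≠ q := fun e =>
  ne_of_faces h.1 h.2 (congrArg Subtype.val e)

theorem Separates.isInterior (h : Separates p q d) : L.IsInterior d.1 :=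
  L.isInterior_iff.2 ⟨h.1 ▸ p.2, h.2 ▸ q.2⟩

theorem Separates.eq_of_sameVertex (h : Separates p q d) (h' : Separates p q d')
    (hv : L.SameVertex d d') : d' = d := by
  have hf := h.1.trans h'.1.symm
  rcases sameVertex_iff.1 hv with e | e | e
  · exact e
  · exact absurd (e ▸ hf) (L.face_ne_face_rot d)
  · exact absurd (e ▸ hf) (L.face_ne_face_rot_rot d)

/-- The faces around a vertex differ from each other, so `p` and `q` cannot lie on both sides in
both senses. For `d' = d` this says that the edge is not a loop. -/
theorem Separates.not_sameVertex_rev (h : Separates p q d) (h' : Separates p q d') :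
    ¬ L.SameVertex d (TrivalentMap.rev d') := by
  intro hv
  rcases sameVertex_iff.1 hv with e | e | e
  · exact ne_of_faces h.1 h.2 (h.1.symm.trans ((congrArg L.face e).symm.trans h'.2))
  · have h1 : L.face (L.rot (L.rot d)) = L.face (L.rot d) := by
      rw [← L.face_rev, ← e, h.2, h'.2]
    exact L.face_ne_face_rot _ h1.symm
  · have h1 : L.face d' = L.face (L.rot d) := by
      rw [← rev_rev d', e, L.face_rev, L.rot_rot_rot]
    exact L.face_ne_face_rot d (h.1.trans (h'.1.symm.trans h1))

/-- The half-edge `z` starts at one of the two ends of the edge of `d`. -/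
def AtEdge (L : TFLattice E) (d z : E × Bool) : Prop :=
  L.SameVertex d z ∨ L.SameVertex (rev d) z

/-- Different edges shared by two plaquettes have no common end. -/
theorem Separates.eq_of_atEdge (h : Separates p q d) (h' : Separates p q d') {z : E × Bool}
    (hz : AtEdge L d z) (hz' : AtEdge L d' z) : d' = d := by
  rcases hz with hz | hz <;> rcases hz' with hz' | hz'
  · exact h.eq_of_sameVertex h' (hz.trans hz'.symm)
  · exact absurd (hz.trans hz'.symm) (h.not_sameVertex_rev h')
  · exact absurd (hz'.trans hz.symm) (h'.not_sameVertex_rev h)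
  · exact TrivalentMap.rev.injective (h.rev.eq_of_sameVertex h'.rev (hz.trans hz'.symm))

section Finite

variable [Finite E]

/-- The type I link of the half-edge `d`. -/
noncomputable def edgeLinks (d : E × Bool) : Finset L.Link :=
  Finset.univ.filter fun l => ∃ h, l = edgeLink (siteOf d h)

/-- The link of the half-edge `d`, together with the triangle edges at its two ends. -/
noncomputable def edgeNbhd (d : E × Bool) : Finset L.Link :=
  vertexLinks d ∪ vertexLinks (rev d) ∪ edgeLinks d

theorem mem_edgeLinks {l : L.Link} : l ∈ edgeLinks d ↔ ∃ h, l = edgeLink (siteOf d h) := by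
  simp [edgeLinks]

theorem edgeLinks_eq (h : L.IsInterior d.1) : edgeLinks d = {edgeLink (siteOf d h)} := by
  ext l
  rw [mem_edgeLinks, Finset.mem_singleton]
  exact ⟨fun ⟨_, e⟩ => e, fun e => ⟨h, e⟩⟩

theorem atEdge_of_touches {l : L.Link} (hl : l ∈ edgeNbhd d) {x : L.Site} (hx : Touches x l) :
    AtEdge L d x.1 := by
  rw [edgeNbhd, Finset.mem_union, Finset.mem_union] at hl
  rcases hl with (hl | hl) | hl
  · exact Or.inl (sameVertex_of_touches hl hx)
  · exact Or.inr (sameVertex_of_touches hl hx)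
  · obtain ⟨h, rfl⟩ := mem_edgeLinks.1 hl
    have h1 : x.1.1 = d.1 := touches_edgeLink.1 hx
    have h2 : x.1 = d ∨ x.1 = rev d := by
      by_cases h2 : x.1.2 = d.2
      · exact Or.inl (Prod.ext h1 h2)
      · exact Or.inr (Prod.ext h1 (Bool.eq_not_of_ne h2))
    rcases h2 with h2 | h2
    · exact Or.inl (sameVertex_iff.2 (Or.inl h2))
    · exact Or.inr (sameVertex_iff.2 (Or.inl h2))

/-- A link that is affected both by flipping `p` and by flipping `q` is next to a shared edge. -/
theorem exists_separates_of_mem_symmDiff (hpq : p ≠ q) {c c' : L.Config} {l : L.Link}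
    (hl : l ∈ symmDiff (L.dimers c) (L.dimers (L.flip p c)))
    (hl' : l ∈ symmDiff (L.dimers c') (L.dimers (L.flip q c'))) :
    ∃ d, Separates p q d ∧ l ∈ edgeNbhd d := by
  have hne : p.1 ≠ q.1 := fun h => hpq (Subtype.ext h)
  rcases exists_eq_edgeLink_or_cornerLink l with ⟨x, rfl⟩ | ⟨d, hd, rfl⟩
  · rcases edgeLink_mem_symmDiff_iff.1 hl with h | h <;>
      rcases edgeLink_mem_symmDiff_iff.1 hl' with h' | h'
    · exact absurd (h.symm.trans h') hne
    · exact ⟨x.1, ⟨h, h'⟩, Finset.mem_union_right _ (mem_edgeLinks.2 ⟨x.2, rfl⟩)⟩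
    · exact ⟨rev x.1, ⟨h, by rw [rev_rev]; exact h'⟩,
        Finset.mem_union_right _ (mem_edgeLinks.2 ⟨x.2, rfl⟩)⟩
    · exact absurd (h.symm.trans h') hne
  · have key : ∀ z, L.SameVertex z d → L.face z = p.1 →
        (L.face (L.rot z) = q.1 ∨ L.face (L.rot (L.rot z)) = q.1) →
        ∃ d', Separates p q d' ∧ cornerLink d hd ∈ edgeNbhd d' := by
      intro z hz hp hq
      rcases hq with hq | hq
      · refine ⟨rev (L.rot z), ⟨by rw [L.face_rev, L.rot_rot_rot, hp], by rw [rev_rev, hq]⟩,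
          Finset.mem_union_left _ (Finset.mem_union_right _ (mem_vertexLinks.2 ⟨d, ?_, hd, rfl⟩))⟩
        rw [rev_rev]
        exact Equiv.Perm.sameCycle_apply_left.2 hz
      · exact ⟨z, ⟨hp, by rw [L.face_rev, hq]⟩, Finset.mem_union_left _
          (Finset.mem_union_left _ (mem_vertexLinks.2 ⟨d, hz, hd, rfl⟩))⟩
    have s1 : L.SameVertex (L.rot d) d :=
      Equiv.Perm.sameCycle_apply_left.2 (Equiv.Perm.SameCycle.refl _ _)
    have s2 : L.SameVertex (L.rot (L.rot d)) d := Equiv.Perm.sameCycle_apply_left.2 s1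
    have e := L.rot_rot_rot d
    rcases face_eq_of_cornerLink_mem_symmDiff hl with h | h | h <;>
      rcases face_eq_of_cornerLink_mem_symmDiff hl' with h' | h' | h'
    · exact absurd (h.symm.trans h') hne
    · exact key d (Equiv.Perm.SameCycle.refl _ _) h (Or.inl h')
    · exact key d (Equiv.Perm.SameCycle.refl _ _) h (Or.inr h')
    · exact key _ s1 h (Or.inr (by rw [e]; exact h'))
    · exact absurd (h.symm.trans h') hne
    · exact key _ s1 h (Or.inl h')
    · exact key _ s2 h (Or.inl (by rw [e]; exact h'))
    · exact key _ s2 h (Or.inr (by rw [e]; exact h'))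
    · exact absurd (h.symm.trans h') hne

/-- The half-edges that separate `p` from `q`. -/
noncomputable def sharedEdges (p q : L.Plaquette) : Finset (E × Bool) :=
  (Set.toFinite {d | Separates p q d}).toFinset

theorem mem_sharedEdges : d ∈ sharedEdges p q ↔ Separates p q d := by simp [sharedEdges]

/-- A dimer present only in between is created by one flip and destroyed by the other, so both flips
affect it. -/
theorem middle_subset_left (hpq : p ≠ q) {c : L.Config} :
    middle c (L.flip p c) (L.flip p (L.flip q c)) ⊆ (sharedEdges p q).biUnion edgeNbhd := by
  intro l hl
  obtain ⟨h1, h2, h3⟩ := mem_middle.1 hl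
  rw [flip_comm] at h3
  obtain ⟨d, hd, hld⟩ := exists_separates_of_mem_symmDiff (c := c) (c' := L.flip p c) (l := l) hpq
    (mem_symmDiff_dimers.2 (by tauto)) (mem_symmDiff_dimers.2 (by tauto))
  exact Finset.mem_biUnion.2 ⟨d, mem_sharedEdges.2 hd, hld⟩

theorem middle_subset_right (hpq : p ≠ q) {c : L.Config} :
    middle c (L.flip q c) (L.flip p (L.flip q c)) ⊆ (sharedEdges p q).biUnion edgeNbhd := by
  intro l hl
  obtain ⟨h1, h2, h3⟩ := mem_middle.1 hl
  obtain ⟨d, hd, hld⟩ := exists_separates_of_mem_symmDiff (c := L.flip q c) (c' := c) (l := l) hpq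
    (mem_symmDiff_dimers.2 (by tauto)) (mem_symmDiff_dimers.2 (by tauto))
  exact Finset.mem_biUnion.2 ⟨d, mem_sharedEdges.2 hd, hld⟩

end Finite

end TFLattice

/-! ### Exchanging the flips along one shared edge. -/

namespace TFLattice

open TrivalentMap TrivalentSurface

open scoped Classical

variable {E : Type*} {L : TFLattice E} {p q : L.Plaquette} {d d' : E × Bool} {c : L.Config}

theorem CommutesAt.mul {A : Type*} [Ring A] {γ : L.Site → A} {W W' : A} (h : CommutesAt γ d W)
    (h' : CommutesAt γ d W') :
    CommutesAt γ d (W * W') := fun x hx => (h x hx).mul_left (h' x hx)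

variable {A : Type*} [Ring A] [Algebra ℂ A] {γ : L.Site → A} {U V : A}

theorem commutesAt_scaledProjOn (hγ : IsMajorana γ) {s : Finset L.Link}
    (h : ∀ l ∈ s, ∀ x, Touches x l → ¬ L.SameVertex d x.1) :
    CommutesAt γ d (scaledProjOn γ s) := fun x hx =>
  (commute_majorana_scaledProjOn hγ fun ⟨l, hl, hxl⟩ => h l hl x hxl hx).symm

theorem CommutesAt.commute_edgeLink {W : A} (h : CommutesAt γ d W) (h' : CommutesAt γ (rev d) W)
    (hi : L.IsInterior d.1) : Commute W (bondOp γ (edgeLink (siteOf d hi))) := by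
  refine TFLattice.commute_bondOp fun x hx => ?_
  have h1 : x.1.1 = d.1 := touches_edgeLink.1 hx
  by_cases h2 : x.1.2 = d.2
  · exact h x (sameVertex_iff.2 (Or.inl (Prod.ext h1 h2)))
  · exact h' x (sameVertex_iff.2 (Or.inl (Prod.ext h1 (Bool.eq_not_of_ne h2))))

theorem isDimer_edgeLink_of_separates (h : Separates p q d) :
    (L.IsDimer c (edgeLink (siteOf d h.isInterior)) ↔ faceSpin c p.1 = faceSpin c q.1) ∧
    (L.IsDimer (L.flip p c) (edgeLink (siteOf d h.isInterior)) ↔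
      faceSpin c p.1 ≠ faceSpin c q.1) ∧
    (L.IsDimer (L.flip q c) (edgeLink (siteOf d h.isInterior)) ↔
      faceSpin c p.1 ≠ faceSpin c q.1) ∧
    (L.IsDimer (L.flip p (L.flip q c)) (edgeLink (siteOf d h.isInterior)) ↔
      faceSpin c p.1 = faceSpin c q.1) := by
  have hne := ne_of_faces h.1 h.2
  have key : ∀ c, L.IsDimer c (edgeLink (siteOf d h.isInterior)) ↔
      faceSpin c p.1 = faceSpin c q.1 := by
    intro c
    rw [isDimer_edgeLink]
    change faceSpin c (L.face d) = faceSpin c (L.face (rev d)) ↔ _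
    rw [h.1, h.2]
  simp only [key, faceSpin_flip, hne, hne.symm, if_true, if_false]
  cases faceSpin c p.1 <;> cases faceSpin c q.1 <;> simp

section Finite

variable [Finite E]

theorem commute_scaledProjOn_of_commutesAt {W : A} (hW : CommutesAt γ d W) (s : Finset L.Link) :
    Commute W (scaledProjOn γ (s ∩ vertexLinks d)) :=
  commute_scaledProjOn fun _ hl x hx =>
    hW x (sameVertex_of_touches (Finset.mem_inter.1 hl).2 hx)

/-- The parts of a matching around an edge. -/
theorem scaledProjOn_inter_edgeNbhd (hγ : IsMajorana γ) {s : Finset L.Link} (hs : IsMatching s)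
    (hd : ¬ L.SameVertex d (rev d)) : scaledProjOn γ (s ∩ edgeNbhd d) =
      scaledProjOn γ (s ∩ vertexLinks d) * scaledProjOn γ (s ∩ vertexLinks (rev d)) *
        scaledProjOn γ (s ∩ edgeLinks d) := by
  have h1 : s ∩ edgeNbhd d =
      (s ∩ vertexLinks d ∪ s ∩ vertexLinks (rev d)) ∪ s ∩ edgeLinks d := by
    rw [edgeNbhd, Finset.inter_union_distrib_left, Finset.inter_union_distrib_left]
  have hm : IsMatching ((s ∩ vertexLinks d ∪ s ∩ vertexLinks (rev d)) ∪ s ∩ edgeLinks d) :=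
    h1 ▸ hs.mono Finset.inter_subset_left
  rw [h1]
  unfold scaledProjOn
  rw [orderedProd_union _ (hm.commute_scaledProj hγ),
    orderedProd_union _ ((hm.mono Finset.subset_union_left).commute_scaledProj hγ)]
  · refine Finset.disjoint_left.2 fun l hl hl' => ?_
    have hl := (Finset.mem_inter.1 hl).2
    have hl' := (Finset.mem_inter.1 hl').2
    exact hd ((sameVertex_of_touches hl (Or.inl rfl)).trans
      (sameVertex_of_touches hl' (Or.inl rfl)).symm)
  · refine Finset.disjoint_left.2 fun l hl hl' => ?_
    obtain ⟨h, rfl⟩ := mem_edgeLinks.1 (Finset.mem_inter.1 hl').2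
    rw [Finset.mem_union, Finset.mem_inter, Finset.mem_inter, mem_vertexLinks,
      mem_vertexLinks] at hl
    rcases hl with ⟨-, d', -, h', e⟩ | ⟨-, d', -, h', e⟩
    · exact edgeLink_ne_cornerLink e
    · exact edgeLink_ne_cornerLink e

theorem middle_inter_edgeLinks_of_eq (h : Separates p q d)
    (hs : faceSpin c p.1 = faceSpin c q.1) (c' c'' : L.Config) :
    middle c c' c'' ∩ edgeLinks d = ∅ := by
  refine Finset.eq_empty_of_forall_notMem fun l hl => ?_
  rw [Finset.mem_inter, mem_middle] at hl
  obtain ⟨⟨-, h1, -⟩, h2⟩ := hl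
  obtain ⟨hi, rfl⟩ := mem_edgeLinks.1 h2
  refine h1 ((isDimer_edgeLink _ _).2 ?_)
  change faceSpin c (L.face d) = faceSpin c (L.face (rev d))
  rw [h.1, h.2, hs]

theorem middle_inter_edgeLinks_of_ne (h : Separates p q d)
    (hs : faceSpin c p.1 ≠ faceSpin c q.1) :
    middle c (L.flip p c) (L.flip p (L.flip q c)) ∩ edgeLinks d =
      {edgeLink (siteOf d h.isInterior)} ∧
    middle c (L.flip q c) (L.flip p (L.flip q c)) ∩ edgeLinks d =
      {edgeLink (siteOf d h.isInterior)} := by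
  obtain ⟨h1, h2, h3, h4⟩ := isDimer_edgeLink_of_separates (c := c) h
  rw [edgeLinks_eq h.isInterior]
  constructor <;>
  · rw [Finset.inter_eq_right, Finset.singleton_subset_iff, mem_middle]
    tauto

/-- For opposite spins the intermediate triangle dimer, if there is one, does not touch the
half-edge `d`. -/
theorem scaledProjOn_middle_commute_edge (hγ : IsMajorana γ) (h : Separates p q d)
    (hb : L.IsBulkVertex d) (hs : faceSpin c p.1 ≠ faceSpin c q.1) :
    Commute (scaledProjOn γ
        (middle c (L.flip p c) (L.flip p (L.flip q c)) ∩ vertexLinks d))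
      (bondOp γ (edgeLink (siteOf d h.isInterior))) ∧
    Commute (scaledProjOn γ
        (middle c (L.flip q c) (L.flip p (L.flip q c)) ∩ vertexLinks d))
      (bondOp γ (edgeLink (siteOf d h.isInterior))) := by
  have hc := (bondOp_edgeLink_commute hγ hb (h.not_sameVertex_rev h)).2.1
  have hc' : Commute (scaledProj γ (cornerLink (L.rot d) hb.next))
      (bondOp γ (edgeLink (siteOf d h.isInterior))) :=
    (commute_projOp hc.symm).symm.smul_left _
  have hr := middle_inter_vertexLinks_of_ne h.1 h.2 hb hs
  by_cases h' : faceSpin c (L.face (L.rot d)) = faceSpin c p.1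
  · rw [(hr.1 h').1, (hr.1 h').2, scaledProjOn_singleton, scaledProjOn_empty]
    exact ⟨hc', Commute.one_left _⟩
  · rw [(hr.2 h').1, (hr.2 h').2, scaledProjOn_singleton, scaledProjOn_empty]
    exact ⟨Commute.one_left _, hc'⟩

/-- Around an edge shared by `p` and `q`, the two intermediate dimer covers give the same matrix
elements. -/
theorem edge_identity (hγ : IsMajorana γ) (h : Separates p q d) (hb : L.IsBulkVertex d)
    (hb' : L.IsBulkVertex (rev d))
    (hU : ∀ l ∈ L.dimers (L.flip p (L.flip q c)), U * bondOp γ l = U)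
    (hV : ∀ l ∈ L.dimers c, bondOp γ l * V = V) {Z : A} (hZ : CommutesAt γ d Z)
    (hZ' : CommutesAt γ (rev d) Z) :
    U * scaledProjOn γ (middle c (L.flip p c) (L.flip p (L.flip q c)) ∩ edgeNbhd d) * Z * V =
    U * scaledProjOn γ (middle c (L.flip q c) (L.flip p (L.flip q c)) ∩ edgeNbhd d) * Z * V := by
  have hv := h.not_sameVertex_rev h
  have hv' : ¬ L.SameVertex (rev d) (rev (rev d)) := h.rev.not_sameVertex_rev h.rev
  have hcomm : ∀ s : Finset L.Link, CommutesAt γ d (scaledProjOn γ (s ∩ vertexLinks (rev d))) :=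
    fun s => commutesAt_scaledProjOn hγ fun l hl x hx hx' =>
      hv (hx'.trans (sameVertex_of_touches (Finset.mem_inter.1 hl).2 hx).symm)
  have hcomm' : ∀ s : Finset L.Link, CommutesAt γ (rev d) (scaledProjOn γ (s ∩ vertexLinks d)) :=
    fun s => commutesAt_scaledProjOn hγ fun l hl x hx hx' =>
      hv ((sameVertex_of_touches (Finset.mem_inter.1 hl).2 hx).trans hx'.symm)
  have hU' : ∀ l ∈ L.dimers (L.flip q (L.flip p c)), U * bondOp γ l = U := by
    rwa [flip_comm]
  rw [scaledProjOn_inter_edgeNbhd hγ (isMatching_middle _ _ _) hv,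
    scaledProjOn_inter_edgeNbhd hγ (isMatching_middle _ _ _) hv]
  by_cases hs : faceSpin c p.1 = faceSpin c q.1
  · rw [middle_inter_edgeLinks_of_eq h hs, middle_inter_edgeLinks_of_eq h hs, scaledProjOn_empty,
      mul_one, mul_one]
    obtain ⟨l, m, hl, hm, el, em, hlm⟩ := vertex_identity_of_eq hγ h.1 h.2 hb hs hU hV
    obtain ⟨m', l', hm', hl', em', el', hlm'⟩ :=
      vertex_identity_of_eq hγ h.rev.1 h.rev.2 hb' hs.symm hU' hV
    rw [flip_comm q p] at em' el'
    have hlv : l ∈ vertexLinks d := (Finset.mem_inter.1 (el ▸ Finset.mem_singleton_self l)).2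
    have hmv : m ∈ vertexLinks d := (Finset.mem_inter.1 (em ▸ Finset.mem_singleton_self m)).2
    have hlv' : l' ∈ vertexLinks (rev d) :=
      (Finset.mem_inter.1 (el' ▸ Finset.mem_singleton_self l')).2
    have hmv' : m' ∈ vertexLinks (rev d) :=
      (Finset.mem_inter.1 (em' ▸ Finset.mem_singleton_self m')).2
    have hat : ∀ l ∈ vertexLinks (rev d), CommutesAt γ d (bondOp γ l) := fun l hl x hx =>
      (commute_bondOp_of_not_touches hγ fun hxl =>
        hv (hx.trans (sameVertex_of_touches hl hxl).symm)).symm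
    have hat' : ∀ l ∈ vertexLinks d, CommutesAt γ (rev d) (bondOp γ l) := fun l hl x hx =>
      (commute_bondOp_of_not_touches hγ fun hxl =>
        hv ((sameVertex_of_touches hl hxl).trans hx.symm)).symm
    have hedge := isDimer_edgeLink_of_separates (c := c) h
    have hUe := hU _ (mem_dimers.2 (hedge.2.2.2.2 hs))
    have hVe := hV _ (mem_dimers.2 (hedge.1.2 hs))
    have hZe := hZ.commute_edgeLink hZ' h.isInterior
    have hb1 := bondOp_edgeLink_commute hγ hb hv
    have hb2 := bondOp_edgeLink_commute hγ hb' hv'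
    -- For equal spins the shared edge is a dimer before and after. Its bond anticommutes with a
    -- single intermediate triangle bond, so in the expansion only the constant and the product over
    -- both ends survive.
    have hz : ∀ k, (k = cornerLink d hb ∨ k = cornerLink _ hb.next.next) →
        U * bondOp γ k * Z * V = 0 := by
      rintro k (rfl | rfl)
      · exact mul_eq_zero_of_anticomm hUe hVe hb1.1 hZe
      · exact mul_eq_zero_of_anticomm hUe hVe hb1.2.2 hZe
    have hz' : ∀ k, (k = cornerLink (rev d) hb' ∨ k = cornerLink _ hb'.next.next) →
        U * bondOp γ k * Z * V = 0 := by
      rintro k (rfl | rfl)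
      · exact mul_eq_zero_of_anticomm hUe hVe hb2.1 hZe
      · exact mul_eq_zero_of_anticomm hUe hVe hb2.2.2 hZe
    rw [el, em, el', em']
    simp only [scaledProjOn_singleton, scaledProj_eq]
    have hexp : ∀ X Y : A, U * X * Z * V = 0 → U * Y * Z * V = 0 →
        U * ((sqrtTwo / 2) • (1 + X) * (sqrtTwo / 2) • (1 + Y)) * Z * V =
          (sqrtTwo / 2 * (sqrtTwo / 2)) • (U * Z * V + U * (X * Y) * Z * V) := by
      intro X Y hX hY
      rw [smul_mul_smul_comm, mul_smul_comm, smul_mul_assoc, smul_mul_assoc]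
      congr 1
      have : U * ((1 + X) * (1 + Y)) * Z * V =
          U * Z * V + U * X * Z * V + U * Y * Z * V + U * (X * Y) * Z * V := by
        noncomm_ring
      rw [this, hX, hY, add_zero, add_zero]
    rw [hexp _ _ (hz l hl) (hz' l' hl'), hexp _ _ (hz m hm) (hz' m' hm')]
    congr 2
    exact mul_mul_swap (hlm _ ((hat l' hlv').mul hZ)) (hlm' _ ((hat' m hmv).mul hZ'))
      ((hat l' hlv').commute_bondOp hmv).symm ((hat m' hmv').commute_bondOp hmv).symm
  · obtain ⟨e1, e2⟩ := middle_inter_edgeLinks_of_ne h hs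
    rw [e1, e2, scaledProjOn_singleton]
    have hs' : faceSpin c q.1 ≠ faceSpin c p.1 := fun h => hs h.symm
    have v := fun W => vertex_identity_of_ne (W := W) hγ h.1 h.2 hb hv hs hU hV
    have v' := fun W => vertex_identity_of_ne (W := W) hγ h.rev.1 h.rev.2 hb' hv' hs' hU' hV
    have k := scaledProjOn_middle_commute_edge hγ h hb hs
    have k' := scaledProjOn_middle_commute_edge (c := c) hγ h.rev hb' hs'
    rw [flip_comm q p] at k'
    simp only [flip_comm q p] at v'
    have cm : ∀ s t : Finset L.Link, Commute (scaledProjOn γ (s ∩ vertexLinks d))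
        (scaledProjOn γ (t ∩ vertexLinks (rev d))) := fun s t =>
      (commute_scaledProjOn_of_commutesAt (hcomm t) s).symm
    have hedge : bondOp γ (edgeLink (siteOf (rev d) hb'.isInterior)) =
      bondOp γ (edgeLink (siteOf d h.isInterior)) := rfl
    rw [hedge] at k'
    generalize middle c (L.flip p c) (L.flip p (L.flip q c)) = R at *
    generalize middle c (L.flip q c) (L.flip p (L.flip q c)) = R' at *
    -- This is the constant term of the projector of the shared edge: the factor `phase` at one end
    -- meets the same factor, with the orders exchanged, at the other.
    have h1 := mul_mul_swap (Z := Z) (v _ ((hcomm R).mul hZ)).1 (v' _ ((hcomm' R').mul hZ')).1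
      (cm _ _) (cm _ _)
    -- This is the bond term; the same cancellation takes place with `phaseInv`.
    have h2 := mul_mul_swap (U := U) (V := V)
      (Z := bondOp γ (edgeLink (siteOf d h.isInterior)) * Z)
      (x := scaledProjOn γ (R ∩ vertexLinks d)) (x' := scaledProjOn γ (R ∩ vertexLinks (rev d)))
      (y := scaledProjOn γ (R' ∩ vertexLinks d)) (y' := scaledProjOn γ (R' ∩ vertexLinks (rev d)))
      (κ := phaseInv) ?_ ?_ (cm _ _) (cm _ _)
    · rw [scaledProj_eq]
      have hexp : ∀ X b : A, U * (X * (sqrtTwo / 2) • (1 + b)) * Z * V =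
          (sqrtTwo / 2) • (U * X * Z * V + U * X * (b * Z) * V) := by
        intro X b
        rw [mul_smul_comm, mul_smul_comm, smul_mul_assoc, smul_mul_assoc]
        congr 1
        noncomm_ring
      rw [hexp, hexp, h1, h2]
    · rw [← mul_assoc (scaledProjOn γ (R ∩ vertexLinks (rev d))), k'.2.eq, mul_assoc (bondOp _ _)]
      exact (v _ ((hcomm R).mul hZ)).2
    · rw [← mul_assoc (scaledProjOn γ (R' ∩ vertexLinks d)), k.2.eq, mul_assoc (bondOp _ _)]
      exact (v' _ ((hcomm' R').mul hZ')).2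

end Finite

end TFLattice

/-! ### Assembling the shared edges and matching the normalizations. -/

/-- With `s`, `t`, `u` the covers before, between and after two flips, the dimers created in the two
steps are the lasting ones, the intermediate ones, and those removed and restored. -/
theorem card_sdiff_add_card_sdiff {α : Type*} [DecidableEq α] (s t u : Finset α) :
    (u \ t).card + (t \ s).card =
      (u \ s).card + (t \ (s ∪ u)).card + ((s ∩ u) \ t).card := by
  have h1 : (u \ t).card = ((u \ s) \ t).card + ((s ∩ u) \ t).card := by
    rw [← Finset.card_union_of_disjoint]
    · congr 1; ext x; simp only [Finset.mem_union, Finset.mem_sdiff, Finset.mem_inter]; tauto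
    · refine Finset.disjoint_left.2 fun x => ?_
      simp only [Finset.mem_sdiff, Finset.mem_inter]; tauto
  have h2 : (t \ s).card = (t \ (s ∪ u)).card + ((u \ s) ∩ t).card := by
    rw [← Finset.card_union_of_disjoint]
    · congr 1; ext x
      simp only [Finset.mem_union, Finset.mem_sdiff, Finset.mem_inter]; tauto
    · refine Finset.disjoint_left.2 fun x => ?_
      simp only [Finset.mem_sdiff, Finset.mem_inter, Finset.mem_union]; tauto
  have h3 := Finset.card_sdiff_add_card_inter (u \ s) t
  omega

namespace TFLattice

open TrivalentMap TrivalentSurface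

open scoped Classical

variable {E : Type*} {L : TFLattice E} {p q : L.Plaquette} {d d' : E × Bool} {c : L.Config}

theorem faceSpin_flip_eq_xor (c : L.Config) (p : L.Plaquette) (f : L.Face) :
    faceSpin (L.flip p c) f = xor (decide (f = p.1)) (faceSpin c f) := by
  rw [faceSpin_flip]
  by_cases h : f = p.1 <;> simp [h]

/-- An exhaustion over spins and incidences. It makes the dimers that are removed and restored the
same for both orders. -/
theorem isDimer_flip_iff {l : L.Link} (h : L.IsDimer c l)
    (h' : L.IsDimer (L.flip p (L.flip q c)) l) :
    L.IsDimer (L.flip p c) l ↔ L.IsDimer (L.flip q c) l := by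
  rcases exists_eq_edgeLink_or_cornerLink l with ⟨x, rfl⟩ | ⟨d, hd, rfl⟩
  · simp only [isDimer_edgeLink, faceSpin_flip_eq_xor] at h h' ⊢
    revert h h'
    generalize faceSpin c (L.face x.1) = a
    generalize faceSpin c (L.face (rev x.1)) = b
    generalize decide (L.face x.1 = p.1) = u
    generalize decide (L.face (rev x.1) = p.1) = v
    generalize decide (L.face x.1 = q.1) = u'
    generalize decide (L.face (rev x.1) = q.1) = v'
    cases a <;> cases b <;> cases u <;> cases v <;> cases u' <;> cases v' <;> simp
  · simp only [isDimer_cornerLink, faceSpin_flip_eq_xor] at h h' ⊢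
    revert h h'
    generalize faceSpin c (L.face d) = a
    generalize faceSpin c (L.face (L.rot d)) = b
    generalize faceSpin c (L.face (L.rot (L.rot d))) = r
    generalize decide (L.face d = p.1) = u
    generalize decide (L.face (L.rot d) = p.1) = v
    generalize decide (L.face (L.rot (L.rot d)) = p.1) = w
    generalize decide (L.face d = q.1) = u'
    generalize decide (L.face (L.rot d) = q.1) = v'
    generalize decide (L.face (L.rot (L.rot d)) = q.1) = w'
    rintro ⟨h1, h2⟩ ⟨h3, h4⟩
    obtain rfl : b = !a := Bool.eq_not_of_ne h1.symm
    obtain rfl : r = !a := Bool.eq_not_of_ne h2.symm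
    cases a <;> cases u <;> cases v <;> cases w <;> cases u' <;> cases v' <;> cases w' <;> simp_all

theorem Separates.isBulkVertex_and_rev (h : Separates p q d) (hn : ¬ L.NearestNeighbors p q) :
    L.IsBulkVertex d ∧ L.IsBulkVertex (TrivalentMap.rev d) := by
  refine ⟨L.isBulkVertex_iff.2 ⟨h.isInterior, fun hh => hn ⟨d, hh, Or.inl h⟩⟩,
    L.isBulkVertex_iff.2 ⟨h.isInterior, fun hh => hn ⟨TrivalentMap.rev d, hh, Or.inr h.rev⟩⟩⟩

theorem not_nearestNeighbors (h : ¬ (L.IsBoundary p ∧ L.IsBoundary q)) :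
    ¬ L.NearestNeighbors p q := by
  rintro ⟨d, hd, ⟨h1, h2⟩ | ⟨h1, h2⟩⟩
  · exact h ⟨L.isBoundary_of_face_rot_mem_hole hd (Or.inl h1),
      L.isBoundary_of_face_rot_mem_hole hd (Or.inr h2)⟩
  · exact h ⟨L.isBoundary_of_face_rot_mem_hole hd (Or.inr h2),
      L.isBoundary_of_face_rot_mem_hole hd (Or.inl h1)⟩

/-- An operator that commutes with the Majorana operators at both ends of the edge of `d`. -/
def CommutesAtEdge {A : Type*} [Ring A] (γ : L.Site → A) (d : E × Bool) (W : A) : Prop :=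
  CommutesAt γ d W ∧ CommutesAt γ (rev d) W

theorem CommutesAtEdge.mul {A : Type*} [Ring A] {γ : L.Site → A} {W W' : A}
    (h : CommutesAtEdge γ d W) (h' : CommutesAtEdge γ d W') :
    CommutesAtEdge γ d (W * W') := ⟨h.1.mul h'.1, h.2.mul h'.2⟩

theorem commutesAtEdge_scaledProjOn {A : Type*} [Ring A] [Algebra ℂ A] {γ : L.Site → A}
    (hγ : IsMajorana γ) {s : Finset L.Link}
    (h : ∀ l ∈ s, ∀ x, Touches x l → ¬ AtEdge L d x.1) :
    CommutesAtEdge γ d (scaledProjOn γ s) :=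
  ⟨commutesAt_scaledProjOn hγ fun l hl x hx h' => h l hl x hx (Or.inl h'),
    commutesAt_scaledProjOn hγ fun l hl x hx h' => h l hl x hx (Or.inr h')⟩

section Finite

variable [Finite E]

/-- Open ends do not depend on the order for plaquettes that are not nearest neighbours, nor do
lasting or restored dimers. Only the intermediate dimers make a difference. -/
theorem flipLength_add_flipLength (hpq : p ≠ q) (h : ¬ L.NearestNeighbors p q) :
    L.flipLength p (L.flip q c) + L.flipLength q c +
        (middle c (L.flip p c) (L.flip p (L.flip q c))).card =
      L.flipLength q (L.flip p c) + L.flipLength p c +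
        (middle c (L.flip q c) (L.flip p (L.flip q c))).card := by
  have h' : ¬ L.NearestNeighbors q p := by
    rintro ⟨d, hd, h1⟩
    exact h ⟨d, hd, h1.symm⟩
  simp only [flipLength_eq, openEnds_flip hpq h, openEnds_flip hpq.symm h', flip_comm q p]
  have h1 := card_sdiff_add_card_sdiff (L.dimers c) (L.dimers (L.flip p c))
    (L.dimers (L.flip p (L.flip q c)))
  have h2 := card_sdiff_add_card_sdiff (L.dimers c) (L.dimers (L.flip q c))
    (L.dimers (L.flip p (L.flip q c)))
  have h3 : (L.dimers c ∩ L.dimers (L.flip p (L.flip q c))) \ L.dimers (L.flip p c) =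
      (L.dimers c ∩ L.dimers (L.flip p (L.flip q c))) \ L.dimers (L.flip q c) := by
    ext l
    simp only [Finset.mem_sdiff, Finset.mem_inter, mem_dimers]
    exact and_congr_right fun hl => not_congr (isDimer_flip_iff hl.1 hl.2)
  rw [h3] at h1
  unfold middle
  omega

variable {A : Type*} [Ring A] [Algebra ℂ A] {γ : L.Site → A} {U V : A}

/-- Dimers shared with the final cover are absorbed by `U`, those shared with the initial cover by
`V`. -/
theorem mul_projOn_mul_eq_middle (hγ : IsMajorana γ) {c c' c'' : L.Config}
    (hU : ∀ l ∈ L.dimers c'', U * bondOp γ l = U)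
    (hV : ∀ l ∈ L.dimers c, bondOp γ l * V = V) :
    U * projOn γ (L.dimers c') * V = U * projOn γ (middle c c' c'') * V := by
  have h : L.dimers c' = (L.dimers c' ∩ L.dimers c'') ∪
      (middle c c' c'' ∪ (L.dimers c' ∩ L.dimers c) \ L.dimers c'') := by
    ext l
    simp only [middle, Finset.mem_union, Finset.mem_inter, Finset.mem_sdiff]
    tauto
  have hm : IsMatching ((L.dimers c' ∩ L.dimers c'') ∪
      (middle c c' c'' ∪ (L.dimers c' ∩ L.dimers c) \ L.dimers c'')) :=
    h ▸ isMatching_dimers c'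
  rw [h, projOn_union hγ _ hm, projOn_union hγ _ (hm.mono Finset.subset_union_right), ← mul_assoc,
    mul_projOn_of_fixed fun l hl => hU l (Finset.mem_inter.1 hl).2, mul_assoc, mul_assoc,
    projOn_mul_of_fixed fun l hl => hV l (Finset.mem_inter.1 (Finset.mem_sdiff.1 hl).1).2,
    mul_assoc]
  · refine Finset.disjoint_left.2 fun l => ?_
    simp only [middle, Finset.mem_union, Finset.mem_inter, Finset.mem_sdiff]
    tauto
  · refine Finset.disjoint_left.2 fun l => ?_
    simp only [middle, Finset.mem_union, Finset.mem_inter, Finset.mem_sdiff]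
    tauto

theorem not_atEdge_of_touches {T : Finset (E × Bool)} (hT : ∀ d' ∈ T, Separates p q d')
    (hd : Separates p q d) (hdT : d ∉ T) {l : L.Link} (hl : l ∈ T.biUnion edgeNbhd) {x : L.Site}
    (hx : Touches x l) : ¬ AtEdge L d x.1 := by
  obtain ⟨d', hd', hl⟩ := Finset.mem_biUnion.1 hl
  intro h
  exact hdT (hd.eq_of_atEdge (hT d' hd') h (atEdge_of_touches hl hx) ▸ hd')

theorem scaledProjOn_inter_insert (hγ : IsMajorana γ) {s : Finset L.Link} (hs : IsMatching s)
    {T : Finset (E × Bool)} (hT : ∀ d' ∈ T, Separates p q d') (hd : Separates p q d)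
    (hdT : d ∉ T) : scaledProjOn γ (s ∩ (insert d T).biUnion edgeNbhd) =
      scaledProjOn γ (s ∩ edgeNbhd d) * scaledProjOn γ (s ∩ T.biUnion edgeNbhd) := by
  rw [Finset.biUnion_insert, Finset.inter_union_distrib_left]
  refine orderedProd_union ?_ (IsMatching.commute_scaledProj hγ ?_)
  · refine Finset.disjoint_left.2 fun l hl hl' => ?_
    exact not_atEdge_of_touches hT hd hdT (Finset.mem_inter.1 hl').2 (Or.inl rfl)
      (atEdge_of_touches (Finset.mem_inter.1 hl).2 (Or.inl rfl))
  · rw [← Finset.inter_union_distrib_left]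
    exact hs.mono Finset.inter_subset_left

theorem CommutesAtEdge.commute_scaledProjOn {W : A} (h : CommutesAtEdge γ d W)
    (s : Finset L.Link) : Commute W (scaledProjOn γ (s ∩ edgeNbhd d)) :=
  TFLattice.commute_scaledProjOn fun _ hl x hx =>
    (atEdge_of_touches (Finset.mem_inter.1 hl).2 hx).elim (h.1 x) (h.2 x)

/-- Around a set of edges shared by `p` and `q`, the two intermediate dimer covers give the same
matrix elements. -/
theorem edges_identity (hγ : IsMajorana γ)
    (hU : ∀ l ∈ L.dimers (L.flip p (L.flip q c)), U * bondOp γ l = U)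
    (hV : ∀ l ∈ L.dimers c, bondOp γ l * V = V) (T : Finset (E × Bool))
    (hT : ∀ d ∈ T, Separates p q d)
    (hb : ∀ d ∈ T, L.IsBulkVertex d ∧ L.IsBulkVertex (rev d)) {Z : A}
    (hZ : ∀ d ∈ T, CommutesAtEdge γ d Z) :
    U * scaledProjOn γ (middle c (L.flip p c) (L.flip p (L.flip q c)) ∩
        T.biUnion edgeNbhd) * Z * V =
    U * scaledProjOn γ (middle c (L.flip q c) (L.flip p (L.flip q c)) ∩
        T.biUnion edgeNbhd) * Z * V := by
  induction T using Finset.induction_on generalizing Z with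
  | empty => simp
  | insert d T hdT ih =>
    have hd := hT d (Finset.mem_insert_self d T)
    have hT' : ∀ d' ∈ T, Separates p q d' := fun d' h => hT d' (Finset.mem_insert_of_mem h)
    have ih := fun Z => ih (Z := Z) hT' fun d' h => hb d' (Finset.mem_insert_of_mem h)
    rw [scaledProjOn_inter_insert hγ (isMatching_middle _ _ _) hT' hd hdT,
      scaledProjOn_inter_insert hγ (isMatching_middle _ _ _) hT' hd hdT]
    have hcT : ∀ s : Finset L.Link,
        CommutesAtEdge γ d (scaledProjOn γ (s ∩ T.biUnion edgeNbhd)) := fun s =>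
      commutesAtEdge_scaledProjOn hγ fun l hl x hx =>
        not_atEdge_of_touches hT' hd hdT (Finset.mem_inter.1 hl).2 hx
    have hcd : ∀ s : Finset L.Link, ∀ d' ∈ T,
        CommutesAtEdge γ d' (scaledProjOn γ (s ∩ edgeNbhd d)) := fun s d' hd' =>
      commutesAtEdge_scaledProjOn hγ fun l hl x hx hx' =>
        hdT (hd.eq_of_atEdge (hT' d' hd')
          (atEdge_of_touches (Finset.mem_inter.1 hl).2 hx) hx' ▸ hd')
    have hZd := hZ d (Finset.mem_insert_self d T)
    have hbd := hb d (Finset.mem_insert_self d T)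
    have h1 := edge_identity hγ hd hbd.1 hbd.2 hU hV
      ((hcT (middle c (L.flip p c) (L.flip p (L.flip q c)))).mul hZd).1
      ((hcT (middle c (L.flip p c) (L.flip p (L.flip q c)))).mul hZd).2
    have h2 := ih _ fun d' hd' =>
      (hcd (middle c (L.flip q c) (L.flip p (L.flip q c))) d' hd').mul
        (hZ d' (Finset.mem_insert_of_mem hd'))
    refine mul_mul_swap (κ := 1) ?_ ?_ ?_ ?_
    · rw [one_smul]; exact h1
    · rw [one_smul]; exact h2.symm
    · exact ((hcT _).commute_scaledProjOn _).symm
    · exact ((hcT _).commute_scaledProjOn _).symm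

/-- The intermediate dimers all lie around shared edges, and both ends of such an edge are bulk
vertices because `p` and `q` are not nearest neighbours. -/
theorem scaledProjOn_middle_eq (hγ : IsMajorana γ) (hpq : p ≠ q) (hn : ¬ L.NearestNeighbors p q)
    (hU : ∀ l ∈ L.dimers (L.flip p (L.flip q c)), U * bondOp γ l = U)
    (hV : ∀ l ∈ L.dimers c, bondOp γ l * V = V) :
    U * scaledProjOn γ (middle c (L.flip p c) (L.flip p (L.flip q c))) * V =
    U * scaledProjOn γ (middle c (L.flip q c) (L.flip p (L.flip q c))) * V := by
  have h := edges_identity hγ hU hV (sharedEdges p q) (fun d => mem_sharedEdges.1)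
    (fun d hd => (mem_sharedEdges.1 hd).isBulkVertex_and_rev hn) (Z := 1)
    fun d _ => ⟨fun x _ => Commute.one_left _, fun x _ => Commute.one_left _⟩
  rwa [Finset.inter_eq_left.2 (middle_subset_left hpq),
    Finset.inter_eq_left.2 (middle_subset_right hpq), mul_one, mul_one] at h

theorem sqrtTwo_pow (n : ℕ) : sqrtTwo ^ n = (((2 : ℝ) ^ ((n : ℝ) / 2) : ℝ) : ℂ) := by
  unfold sqrtTwo
  rw [Real.sqrt_eq_rpow, ← Complex.ofReal_pow, ← Real.rpow_natCast, ← Real.rpow_mul two_pos.le]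
  congr 2
  ring

/-- The fermionic parts of the two products of flips of `p` and `q` agree. -/
theorem smul_projOn_mul_projOn_mul_projOn (hγ : IsMajorana γ) (hpq : p ≠ q)
    (hn : ¬ L.NearestNeighbors p q) :
    (flipConst p (L.flip q c) * flipConst q c) •
      (projOn γ (L.dimers (L.flip p (L.flip q c))) * projOn γ (L.dimers (L.flip q c)) *
        projOn γ (L.dimers c)) =
    (flipConst q (L.flip p c) * flipConst p c) •
      (projOn γ (L.dimers (L.flip p (L.flip q c))) * projOn γ (L.dimers (L.flip p c)) *
        projOn γ (L.dimers c)) := by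
  have hU : ∀ l ∈ L.dimers (L.flip p (L.flip q c)),
      projOn γ (L.dimers (L.flip p (L.flip q c))) * bondOp γ l = _ :=
    fun l hl => projOn_mul_bondOp hγ (isMatching_dimers _) hl
  have hV : ∀ l ∈ L.dimers c, bondOp γ l * projOn γ (L.dimers c) = _ :=
    fun l hl => bondOp_mul_projOn hγ (isMatching_dimers _) hl
  have h := scaledProjOn_middle_eq hγ hpq hn hU hV
  rw [scaledProjOn_eq, scaledProjOn_eq, mul_smul_comm, mul_smul_comm, smul_mul_assoc,
    smul_mul_assoc, ← mul_projOn_mul_eq_middle hγ hU hV,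
    ← mul_projOn_mul_eq_middle hγ hU hV] at h
  -- A factor `√2` for each intermediate dimer makes the scaled identity applicable; the powers of
  -- two left over agree by the count of string lengths.
  refine smul_right_injective _ (pow_ne_zero
    (middle c (L.flip p c) (L.flip p (L.flip q c))).card sqrtTwo_ne_zero) ?_
  dsimp only
  rw [smul_comm _ (flipConst q (L.flip p c) * flipConst p c), h, smul_smul, smul_smul,
    flipConst_mul_flipConst, flipConst_mul_flipConst, sqrtTwo_pow, sqrtTwo_pow,
    ← Complex.ofReal_mul, ← Complex.ofReal_mul, ← Real.rpow_add two_pos, ← Real.rpow_add two_pos]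
  congr 3
  have hl := congrArg (fun n : ℕ => (n : ℝ)) (flipLength_add_flipLength (c := c) hpq hn)
  push_cast at hl
  linarith

theorem F_F_apply {ψ : L.State} (hψ : ψ ∈ L.constrained) (p q : L.Plaquette) (c : L.Config) :
    L.F p (L.F q ψ) (L.flip p (L.flip q c)) = (flipConst p (L.flip q c) * flipConst q c) •
      projOn L.majorana (L.dimers (L.flip p (L.flip q c)))
        (projOn L.majorana (L.dimers (L.flip q c)) (projOn L.majorana (L.dimers c) (ψ c))) := by
  rw [F_apply (F_mem_constrained hψ q), flip_flip, F_apply hψ, flip_flip, map_smul, smul_smul,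
    projOn_apply_of_mem hψ]

theorem F_comm (hn : ¬ L.NearestNeighbors p q) {ψ : L.State} (hψ : ψ ∈ L.constrained) :
    L.F p (L.F q ψ) = L.F q (L.F p ψ) := by
  by_cases hpq : p = q
  · rw [hpq]
  funext f
  obtain ⟨c, rfl⟩ : ∃ c, f = L.flip p (L.flip q c) :=
    ⟨L.flip q (L.flip p f), by rw [flip_flip, flip_flip]⟩
  have h := LinearMap.congr_fun (smul_projOn_mul_projOn_mul_projOn (c := c)
    (isMajorana_majorana (L := L)) hpq hn) (ψ c)
  simp only [LinearMap.smul_apply, Module.End.mul_apply] at h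
  rw [F_F_apply hψ, h]
  conv_rhs => rw [flip_comm p q, F_F_apply hψ]
  rw [flip_comm p q]

end Finite

end TFLattice

namespace TFLattice

open TrivalentMap TrivalentSurface

open scoped Classical

variable {E : Type*} {L : TFLattice E} {p q : L.Plaquette} {d : E × Bool} {c : L.Config}

/-! ### Consecutive boundary plaquettes -/

/-- Both phases have nonzero imaginary part, while `k` and `k'` are real. -/
theorem sub_mul_phase_ne_zero {k k' : ℝ} (hk' : k' ≠ 0) :
    (k : ℂ) - k' * phase ≠ 0 ∧ (k : ℂ) - k' * phaseInv ≠ 0 := by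
  have hs : Real.sqrt 2 ≠ 0 := by positivity
  have h1 : ((k : ℂ) - k' * phase).im = -(k' * (Real.sqrt 2 / 2)) := by
    simp [phase, sqrtTwo]
  have h2 : ((k : ℂ) - k' * phaseInv).im = k' * (Real.sqrt 2 / 2) := by
    simp [phaseInv, sqrtTwo]
  have h3 : k' * (Real.sqrt 2 / 2) ≠ 0 := by positivity
  constructor <;> intro h
  · rw [h, Complex.zero_im, zero_eq_neg] at h1
    exact h3 h1
  · rw [h, Complex.zero_im] at h2
    exact h3 h2.symm

section Algebra

variable {A : Type*} [Ring A]

theorem conj_mul_mul {U Z V g : A} (hg : g * g = 1) (hU : Commute g U) (hZ : Commute g Z)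
    (hV : Commute g V) : g * (U * Z * V) * g = U * Z * V := by
  rw [((hU.mul_right hZ).mul_right hV).eq, mul_assoc, hg, mul_one]

theorem conj_mul_mul_of_anticomm {U Z V g e : A} (hg : g * g = 1) (hU : Commute g U)
    (hZ : Commute g Z) (hV : Commute g V) (he : e * g = -(g * e)) :
    g * (U * (e * Z) * V) * g = -(U * (e * Z) * V) := by
  have h : g * (U * (e * Z) * V) * g = U * (g * e) * (Z * (V * g)) := by
    rw [← mul_assoc, ← mul_assoc, hU.eq]
    simp only [mul_assoc]
  rw [h, ← neg_eq_iff_eq_neg.2 he, ← hV.eq, ← mul_assoc Z, ← hZ.eq]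
  have h' : U * -(e * g) * (g * Z * V) = -(U * (e * (g * g * Z)) * V) := by noncomm_ring
  rw [h', hg, one_mul]

variable [Algebra ℂ A]

/-- Conjugation by `g` supplies a second equation with the sign of `Y` reversed. Adding and
subtracting isolates `X` and `Y`, each with a nonzero coefficient. -/
theorem eq_zero_of_smul_add_eq {X Y g : A} (hX : g * X * g = X) (hY : g * Y * g = -Y) {k k' : ℝ}
    (hk' : k' ≠ 0) (h : (k : ℂ) • (X + Y) = (k' : ℂ) • (phase • X + phaseInv • Y)) :
    X = 0 ∧ Y = 0 := by
  have h' : (k : ℂ) • (X - Y) = (k' : ℂ) • (phase • X - phaseInv • Y) := by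
    have := congrArg (fun a => g * a * g) h
    simp only [mul_smul_comm, smul_mul_assoc, mul_add, add_mul, hX, hY, smul_neg] at this
    simpa only [sub_eq_add_neg] using this
  obtain ⟨h1, h2⟩ := sub_mul_phase_ne_zero (k := k) hk'
  constructor
  · have : (2 * ((k : ℂ) - k' * phase)) • X = 0 := by
      linear_combination (norm := module) h + h'
    exact (smul_eq_zero.1 this).resolve_left (mul_ne_zero two_ne_zero h1)
  · have : (2 * ((k : ℂ) - k' * phaseInv)) • Y = 0 := by
      linear_combination (norm := module) h - h'
    exact (smul_eq_zero.1 this).resolve_left (mul_ne_zero two_ne_zero h2)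

theorem eq_zero_of_smul_eq_smul {S S' X Y g : A} (hX : g * X * g = X) (hY : g * Y * g = -Y)
    {k k' : ℝ} (hk' : k' ≠ 0) (h : (k : ℂ) • S = (k' : ℂ) • S') {m n : ℕ}
    (hS : sqrtTwo ^ m • S = (sqrtTwo / 2) • (X + Y))
    (hS' : sqrtTwo ^ n • S' = (sqrtTwo / 2) • (phase • X + phaseInv • Y)) : S = 0 := by
  have hs : sqrtTwo / 2 ≠ 0 := div_ne_zero sqrtTwo_ne_zero two_ne_zero
  have key : ((k * Real.sqrt 2 ^ n : ℝ) : ℂ) • (X + Y) =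
      ((k' * Real.sqrt 2 ^ m : ℝ) : ℂ) • (phase • X + phaseInv • Y) := by
    refine smul_right_injective _ hs ?_
    dsimp only
    rw [smul_comm, ← hS, smul_comm (sqrtTwo / 2), ← hS']
    push_cast
    change ((k : ℂ) * sqrtTwo ^ n) • sqrtTwo ^ m • S = ((k' : ℂ) * sqrtTwo ^ m) • sqrtTwo ^ n • S'
    linear_combination (norm := module) (sqrtTwo ^ n * sqrtTwo ^ m) • h
  have h2 : Real.sqrt 2 ≠ 0 := by positivity
  obtain ⟨rfl, rfl⟩ := eq_zero_of_smul_add_eq hX hY (mul_ne_zero hk' (pow_ne_zero m h2)) key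
  rw [add_zero, smul_zero] at hS
  exact (smul_eq_zero.1 hS).resolve_left (pow_ne_zero m sqrtTwo_ne_zero)

end Algebra

section Finite

variable [Finite E] {A : Type*} [Ring A] [Algebra ℂ A] {γ : L.Site → A}

theorem vertexLinks_eq_empty (h : L.face (L.rot d) ∈ L.hole) :
    (vertexLinks d : Finset L.Link) = ∅ := by
  refine Finset.eq_empty_of_forall_notMem fun l hl => ?_
  obtain ⟨d', hd', hb, rfl⟩ := mem_vertexLinks.1 hl
  rcases sameVertex_iff.1 hd' with rfl | rfl | rfl
  · exact hb.2.1 h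
  · exact hb.1 h
  · exact hb.next.next.1 (by rw [L.rot_rot_rot]; exact h)

/-- Between plaquettes of opposite spins, the site at a boundary vertex is unpaired. -/
theorem not_covers_of_separates (h : Separates p q d) (hd : L.face (L.rot d) ∈ L.hole)
    (hs : faceSpin c p.1 ≠ faceSpin c q.1) :
    ¬ Covers (L.dimers c) (siteOf d h.isInterior) := by
  intro hcov
  rcases covers_dimers_iff.1 hcov with h1 | h1
  · exact h1 hd
  · change faceSpin c (L.face d) = faceSpin c (L.face (rev d)) at h1
    rw [h.1, h.2] at h1
    exact hs h1

/-- All other shared edges can be exchanged freely. At the edge of `d` only the inner end has a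
triangle, so the constant term and the bond term of its projector acquire the phases `phase` and
`phaseInv` with nothing to cancel them. The Majorana operator at the unpaired site commutes with the
initial and final projectors and tells the two terms apart. -/
theorem projOn_eq_zero_of_smul_eq (hγ : IsMajorana γ) (h : Separates p q d)
    (hd : L.face (L.rot d) ∈ L.hole) (hb : L.IsBulkVertex (rev d))
    (hbulk : ∀ d', Separates p q d' → d' ≠ d → L.IsBulkVertex d' ∧ L.IsBulkVertex (rev d'))
    (hs : faceSpin c p.1 ≠ faceSpin c q.1)
    (hr : faceSpin c (L.face (L.rot (rev d))) = faceSpin c q.1) {k k' : ℝ} (hk' : k' ≠ 0)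
    (hkk : (k : ℂ) • (projOn γ (L.dimers (L.flip p (L.flip q c))) *
        projOn γ (L.dimers (L.flip p c)) * projOn γ (L.dimers c)) =
      (k' : ℂ) • (projOn γ (L.dimers (L.flip p (L.flip q c))) *
        projOn γ (L.dimers (L.flip q c)) * projOn γ (L.dimers c))) :
    projOn γ (L.dimers (L.flip p (L.flip q c))) * projOn γ (L.dimers (L.flip p c)) *
      projOn γ (L.dimers c) = 0 := by
  have hU : ∀ l ∈ L.dimers (L.flip p (L.flip q c)),
      projOn γ (L.dimers (L.flip p (L.flip q c))) * bondOp γ l = _ :=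
    fun l hl => projOn_mul_bondOp hγ (isMatching_dimers _) hl
  have hV : ∀ l ∈ L.dimers c, bondOp γ l * projOn γ (L.dimers c) = _ :=
    fun l hl => bondOp_mul_projOn hγ (isMatching_dimers _) hl
  have hU' : ∀ l ∈ L.dimers (L.flip q (L.flip p c)),
      projOn γ (L.dimers (L.flip p (L.flip q c))) * bondOp γ l =
        projOn γ (L.dimers (L.flip p (L.flip q c))) := by
    rw [flip_comm q p]; exact hU
  have hpq := h.ne
  have hv := h.not_sameVertex_rev h
  have hv' : ¬ L.SameVertex (rev d) (rev (rev d)) := h.rev.not_sameVertex_rev h.rev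
  let w : L.Site := siteOf d h.isInterior
  have hs4 : faceSpin (L.flip p (L.flip q c)) p.1 ≠ faceSpin (L.flip p (L.flip q c)) q.1 := by
    have hne := ne_of_faces h.1 h.2
    simp only [faceSpin_flip, hne, hne.symm, if_true, if_false]
    simpa using hs
  have hwU := commute_projOn_of_not_covers hγ (not_covers_of_separates h hd hs4)
  have hwV := commute_projOn_of_not_covers hγ (not_covers_of_separates h hd hs)
  let T := (sharedEdges p q).erase d
  have hT : ∀ d' ∈ T, Separates p q d' := fun d' hd' =>
    mem_sharedEdges.1 (Finset.mem_of_mem_erase hd')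
  have hdT : d ∉ T := Finset.notMem_erase _ _
  have hTins : insert d T = sharedEdges p q := Finset.insert_erase (mem_sharedEdges.2 h)
  -- A boundary vertex carries no triangle edges, so the end `d` contributes no factor.
  have split : ∀ s : Finset L.Link, IsMatching s → s ⊆ (sharedEdges p q).biUnion edgeNbhd →
      scaledProjOn γ s = scaledProjOn γ (s ∩ vertexLinks (rev d)) *
        scaledProjOn γ (s ∩ edgeLinks d) * scaledProjOn γ (s ∩ T.biUnion edgeNbhd) := by
    intro s hsm hsub
    conv_lhs => rw [← Finset.inter_eq_left.2 hsub, ← hTins]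
    rw [scaledProjOn_inter_insert hγ hsm hT h hdT, scaledProjOn_inter_edgeNbhd hγ hsm hv,
      vertexLinks_eq_empty hd, Finset.inter_empty, scaledProjOn_empty, one_mul]
  have hZat : ∀ s : Finset L.Link,
      CommutesAtEdge γ d (scaledProjOn γ (s ∩ T.biUnion edgeNbhd)) := fun s =>
    commutesAtEdge_scaledProjOn hγ fun l hl x hx =>
      not_atEdge_of_touches hT h hdT (Finset.mem_inter.1 hl).2 hx
  obtain ⟨e1, e2⟩ := middle_inter_edgeLinks_of_ne h hs
  obtain ⟨r3, r2⟩ := (middle_inter_vertexLinks_of_ne h.rev.1 h.rev.2 hb (Ne.symm hs)).1 hr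
  have v := fun W => vertex_identity_of_ne (W := W) hγ h.rev.1 h.rev.2 hb hv' (Ne.symm hs) hU' hV
  rw [flip_comm q p] at r2 r3
  simp only [flip_comm q p] at v
  have hedge : bondOp γ (edgeLink (siteOf (rev d) hb.isInterior)) =
    bondOp γ (edgeLink (siteOf d h.isInterior)) := rfl
  rw [r2, hedge, scaledProjOn_empty, mul_one] at v
  have s2 := split _ (isMatching_middle c (L.flip p c) _) (middle_subset_left hpq)
  have s3 := split _ (isMatching_middle c (L.flip q c) _) (middle_subset_right hpq)
  rw [r2, e1, scaledProjOn_empty, one_mul, scaledProjOn_singleton] at s2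
  rw [e2, scaledProjOn_singleton] at s3
  have heT : ∀ d' ∈ T, CommutesAtEdge γ d'
      (scaledProjOn γ {edgeLink (siteOf d h.isInterior)}) := by
    intro d' hd'
    refine commutesAtEdge_scaledProjOn hγ fun l hl x hx hx' => ?_
    rw [Finset.mem_singleton] at hl
    have hmem : l ∈ edgeNbhd d := Finset.mem_union_right _ (mem_edgeLinks.2 ⟨_, hl⟩)
    exact hdT (h.eq_of_atEdge (hT d' hd') (atEdge_of_touches hmem hx) hx' ▸ hd')
  rw [scaledProjOn_singleton] at heT
  have hT2 := edges_identity hγ hU hV T hT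
    (fun d' hd' => hbulk d' (hT d' hd') (Finset.ne_of_mem_erase hd')) heT
  have hew : bondOp γ (edgeLink (siteOf d h.isInterior)) * γ w =
      -(γ w * bondOp γ (edgeLink (siteOf d h.isInterior))) :=
    bondOp_mul_of_touches hγ (touches_self_edgeLink w)
  have hZe := fun s => (hZat s).1.commute_edgeLink (hZat s).2 h.isInterior
  have hZw := fun s => (hZat s).1 w (sameVertex_iff.2 (Or.inl rfl))
  have a2 := congrArg (fun a => projOn γ (L.dimers (L.flip p (L.flip q c))) * a *
    projOn γ (L.dimers c)) s2
  have a3 := congrArg (fun a => projOn γ (L.dimers (L.flip p (L.flip q c))) * a *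
    projOn γ (L.dimers c)) s3
  rw [scaledProjOn_eq, mul_smul_comm, smul_mul_assoc, ← mul_projOn_mul_eq_middle hγ hU hV] at a2 a3
  generalize middle c (L.flip p c) (L.flip p (L.flip q c)) = R at *
  generalize middle c (L.flip q c) (L.flip p (L.flip q c)) = R' at *
  have hv3 := v _ (hZat R').2
  have hZc := (hZw R').symm
  have hQZ : ∀ s : Finset L.Link, Commute (scaledProj γ (edgeLink (siteOf d h.isInterior)))
      (scaledProjOn γ (s ∩ T.biUnion edgeNbhd)) := fun s =>
    ((commute_projOp (hZe s)).smul_right _).symm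
  rw [(hQZ R).eq, ← mul_assoc, hT2, mul_assoc _ (scaledProjOn γ _), ← (hQZ R').eq] at a2
  generalize projOn γ (L.dimers (L.flip p (L.flip q c))) = U at *
  generalize projOn γ (L.dimers c) = V at *
  generalize scaledProjOn γ (R' ∩ T.biUnion edgeNbhd) = Z at *
  generalize scaledProjOn γ (R' ∩ vertexLinks (rev d)) = B at *
  rw [scaledProj_eq] at a2 a3
  generalize bondOp γ (edgeLink (siteOf d h.isInterior)) = e at *
  refine eq_zero_of_smul_eq_smul (conj_mul_mul (hγ.mul_self w) hwU hZc hwV)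
    (conj_mul_mul_of_anticomm (hγ.mul_self w) hwU hZc hwV hew) hk' hkk (a2.trans ?_) (a3.trans ?_)
  · rw [smul_mul_assoc, mul_smul_comm, smul_mul_assoc]
    congr 1
    noncomm_ring
  · rw [← hv3.1, ← hv3.2, mul_smul_comm, smul_mul_assoc, mul_smul_comm, smul_mul_assoc]
    congr 1
    noncomm_ring

theorem projOn_mul_projOn_flip_mul_projOn (hγ : IsMajorana γ) {x : L.Site}
    (hx : x ∈ L.flipSites p c) (hxc : ¬ Covers (L.dimers (L.flip p c)) x) :
    projOn γ (L.dimers c) * projOn γ (L.dimers (L.flip p c)) * projOn γ (L.dimers c) =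
      (1 / 2 : ℂ) ^ (L.dimers (L.flip p c) \ L.dimers c).card • projOn γ (L.dimers c) := by
  rw [mul_assoc, ← projOn_sdiff_mul_projOn hγ, ← mul_assoc]
  exact projOn_mul_projOn_mul_projOn hγ subset_rfl hx fun ⟨l, hl, hxl⟩ =>
    hxc ⟨l, (Finset.mem_sdiff.1 hl).1, hxl⟩

/-- Starting from the configuration with all spins up, flips of two plaquettes at a boundary vertex
do not annihilate the states compatible with the dimers. -/
theorem projOn_mul_projOn_mul_projOn_ne_zero [Nontrivial A] (hγ : IsMajorana γ)
    (h : Separates p q d) (hd : L.face (L.rot d) ∈ L.hole) :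
    projOn γ (L.dimers (L.flip q fun _ => true)) * projOn γ (L.dimers fun _ => true) *
      projOn γ (L.dimers (L.flip p fun _ => true)) ≠ 0 := by
  intro h0
  let x : L.Site := siteOf d h.isInterior
  have hne := ne_of_faces h.1 h.2
  have htrue : ∀ r : L.Plaquette, faceSpin (fun _ => true : L.Config) r.1 = true :=
    faceSpin_coe (fun _ => true : L.Config)
  have hp := projOn_mul_projOn_flip_mul_projOn (c := fun _ => true) hγ (p := p) (x := x)
    (mem_flipSites_of_face (Or.inl h.1)) (not_covers_of_separates h hd (by
      simp [faceSpin_flip, htrue, hne.symm]))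
  have hq := projOn_mul_projOn_flip_mul_projOn (c := fun _ => true) hγ (p := q) (x := x)
    (mem_flipSites_of_face (Or.inr h.2)) (not_covers_of_separates h hd (by
      simp [faceSpin_flip, htrue, hne]))
  have key := congrArg (fun a => projOn γ (L.dimers fun _ => true) * a *
    projOn γ (L.dimers fun _ => true)) h0
  simp only [mul_zero, zero_mul] at key
  rw [← mul_assoc, ← mul_assoc, hq, smul_mul_assoc, smul_mul_assoc, hp, smul_smul] at key
  refine projOn_ne_zero hγ (isMatching_dimers (fun _ => true : L.Config))
    ((smul_eq_zero.1 key).resolve_left ?_)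
  exact mul_ne_zero (pow_ne_zero _ (by norm_num)) (pow_ne_zero _ (by norm_num))

theorem single_mem_constrained (c : L.Config) (v : L.Fock) :
    (Pi.single c (projOn L.majorana (L.dimers c) v) : L.State) ∈ L.constrained := by
  intro c' l hl
  by_cases h : c' = c
  · subst h
    rw [Pi.single_eq_same, bond_projOn_apply (isMatching_dimers _) hl]
  · rw [Pi.single_eq_of_ne h, map_zero]

/-- Uniqueness of the shared boundary vertex makes the other end of its edge, and both ends of every
other shared edge, bulk vertices. -/
theorem exists_F_ne (h : Separates p q d) (hd : L.face (L.rot d) ∈ L.hole)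
    (hu : ∀ d' ∈ L.sharedBoundaryVertices p q, d' = d) :
    ∃ ψ ∈ L.constrained, L.F p (L.F q ψ) ≠ L.F q (L.F p ψ) := by
  by_contra hall
  push Not at hall
  have hrev : ∀ d : E × Bool, rev d ≠ d := fun d hd => by
    have := congrArg Prod.snd hd
    simp [rev] at this
  have hb : L.IsBulkVertex (rev d) := L.isBulkVertex_iff.2 ⟨h.isInterior, fun hh =>
    hrev d (hu _ ⟨hh, Or.inr h.rev⟩)⟩
  have hbulk : ∀ d', Separates p q d' → d' ≠ d → L.IsBulkVertex d' ∧ L.IsBulkVertex (rev d') := by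
    intro d' hd' hne
    refine ⟨L.isBulkVertex_iff.2 ⟨hd'.isInterior, fun hh => hne (hu _ ⟨hh, Or.inl hd'⟩)⟩,
      L.isBulkVertex_iff.2 ⟨hd'.isInterior, fun hh => h.not_sameVertex_rev hd' ?_⟩⟩
    exact sameVertex_iff.2 (Or.inl (hu _ ⟨hh, Or.inr hd'.rev⟩))
  have hne := ne_of_faces h.1 h.2
  have htrue : ∀ f ∉ L.hole, faceSpin (fun _ => true : L.Config) f = true :=
    fun f hf => faceSpin_of_not_mem _ hf
  have hrp : L.face (L.rot (rev d)) ≠ p.1 := by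
    have := L.face_ne_face_rot (L.rot (rev d))
    rwa [← L.face_rev, rev_rev, h.1] at this
  -- With `p` already flipped, the order that flips `p` first passes through the uniform
  -- configuration, and the site of `d` is unpaired both initially and finally.
  obtain ⟨c, hc⟩ : ∃ c : L.Config, c = L.flip p fun _ => true := ⟨_, rfl⟩
  have hcp : L.flip p c = fun _ => true := by rw [hc, flip_flip]
  have hcq : L.flip p (L.flip q c) = L.flip q fun _ => true := by rw [flip_comm, hcp]
  have hs : faceSpin c p.1 ≠ faceSpin c q.1 := by
    simp [hc, faceSpin_flip, htrue _ p.2, htrue _ q.2, hne.symm]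
  have hr : faceSpin c (L.face (L.rot (rev d))) = faceSpin c q.1 := by
    simp [hc, faceSpin_flip, htrue _ hb.2.1, htrue _ q.2, hne.symm, hrp]
  have hop : (flipConst q (L.flip p c) * flipConst p c) •
      (projOn L.majorana (L.dimers (L.flip p (L.flip q c))) *
        projOn L.majorana (L.dimers (L.flip p c)) * projOn L.majorana (L.dimers c)) =
      (flipConst p (L.flip q c) * flipConst q c) •
      (projOn L.majorana (L.dimers (L.flip p (L.flip q c))) *
        projOn L.majorana (L.dimers (L.flip q c)) * projOn L.majorana (L.dimers c)) := by
    refine LinearMap.ext fun v => ?_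
    have hψ := single_mem_constrained c v
    have h1 := congrFun (hall _ hψ) (L.flip p (L.flip q c))
    rw [F_F_apply hψ, flip_comm p q, F_F_apply hψ, Pi.single_eq_same,
      projOn_majorana_apply fun l hl => bond_projOn_apply (isMatching_dimers c) hl v] at h1
    simp only [LinearMap.smul_apply, Module.End.mul_apply]
    rw [flip_comm p q, h1]
  rw [flipConst_mul_flipConst, flipConst_mul_flipConst] at hop
  have hzero := projOn_eq_zero_of_smul_eq isMajorana_majorana h hd hb hbulk hs hr
    (Real.rpow_pos_of_pos two_pos _).ne' hop
  rw [hcq, hcp, hc] at hzero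
  exact projOn_mul_projOn_mul_projOn_ne_zero isMajorana_majorana h hd hzero

end Finite

end TFLattice

/-! ### Commuting involutions -/

section Involution

variable {ι V : Type*} [AddCommGroup V] [Module ℂ V]

/-- An eigenvalue of a sum of commuting involutions is at most their number. -/
theorem le_card_of_sum_apply_eq_smul {W : Submodule ℂ V} {F : ι → Module.End ℂ V} (s : Finset ι)
    (hW : ∀ i ∈ s, ∀ ψ ∈ W, F i ψ ∈ W) (hF : ∀ i ∈ s, ∀ ψ ∈ W, F i (F i ψ) = ψ)
    (hc : ∀ i ∈ s, ∀ j ∈ s, ∀ ψ ∈ W, F i (F j ψ) = F j (F i ψ)) {ψ : V} (hψ : ψ ∈ W)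
    (hψ0 : ψ ≠ 0) {r : ℝ} (h : ∑ i ∈ s, F i ψ = (r : ℂ) • ψ) : r ≤ s.card := by
  classical
  induction s using Finset.induction_on generalizing ψ r with
  | empty =>
    rw [Finset.sum_empty] at h
    have : (r : ℂ) = 0 := (smul_eq_zero.1 h.symm).resolve_right hψ0
    simpa using (Complex.ofReal_eq_zero.1 this).le
  | insert i s hi ih =>
    have hmem : i ∈ insert i s := Finset.mem_insert_self i s
    have ih := fun φ => ih (ψ := φ) (fun j hj => hW j (Finset.mem_insert_of_mem hj))
      (fun j hj => hF j (Finset.mem_insert_of_mem hj))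
      (fun j hj k hk => hc j (Finset.mem_insert_of_mem hj) k (Finset.mem_insert_of_mem hk))
    have h' : ∑ j ∈ insert i s, F j (F i ψ) = (r : ℂ) • F i ψ := by
      rw [← map_smul, ← h, map_sum]
      exact Finset.sum_congr rfl fun j hj => hc j hj i hmem ψ hψ
    rw [Finset.sum_insert hi] at h h'
    rw [hF i hmem ψ hψ] at h'
    rw [Finset.card_insert_of_notMem hi]
    push_cast
    -- If `ψ + F i ψ` is nonzero it is fixed by `F i`; otherwise `ψ - F i ψ` is nonzero and negated.
    -- The eigenvalue of the remaining sum shifts by one accordingly.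
    by_cases h0 : ψ + F i ψ = 0
    · have hm : ψ - F i ψ ≠ 0 := by
        intro h1
        have : (2 : ℂ) • ψ = 0 := by linear_combination (norm := module) h0 + h1
        exact hψ0 ((smul_eq_zero.1 this).resolve_left two_ne_zero)
      have := ih _ (W.sub_mem hψ (hW i hmem ψ hψ)) hm (r := r + 1) (by
        simp only [map_sub, Finset.sum_sub_distrib]
        push_cast
        linear_combination (norm := module) h - h')
      linarith
    · have := ih _ (W.add_mem hψ (hW i hmem ψ hψ)) h0 (r := r - 1) (by
        simp only [map_add, Finset.sum_add_distrib]
        push_cast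
        linear_combination (norm := module) h + h')
      linarith

end Involution

namespace TFLattice

open TrivalentMap TrivalentSurface

open scoped Classical

variable {E : Type*} {L : TFLattice E}

theorem flip_apply_of_ne {p q : L.Plaquette} {c : L.Config}
    (h : q ≠ p) : L.flip p c q = c q := by simp [flip, h]

variable [Finite E] {p q : L.Plaquette} {b c : L.Config}

/-! ### Ground states for fixed boundary spins -/

/-- Which sites are paired depends only on the boundary spins, and each dimer pairs two sites. -/
theorem card_dimers_eq (h : ∀ p, L.IsBoundary p → c p = b p) :
    (L.dimers c).card = (L.dimers b).card := by
  have h1 := card_filter_covers (isMatching_dimers c)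
  have h2 := card_filter_covers (isMatching_dimers b)
  have h3 : Finset.univ.filter (Covers (L.dimers c)) =
      Finset.univ.filter (Covers (L.dimers b)) := by
    refine Finset.filter_congr fun x _ => ?_
    rw [covers_dimers_iff, covers_dimers_iff]
    by_cases hx : L.face (L.rot x.1) ∈ L.hole
    · have hi := L.isInterior_iff.1 x.2
      rw [faceSpin_of_not_mem _ hi.1, faceSpin_of_not_mem _ hi.2, faceSpin_of_not_mem _ hi.1,
        faceSpin_of_not_mem _ hi.2,
        h ⟨_, hi.1⟩ (L.isBoundary_of_face_rot_mem_hole hx (Or.inl rfl)),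
        h ⟨_, hi.2⟩ (L.isBoundary_of_face_rot_mem_hole hx (Or.inr rfl))]
    · simp [hx]
  rw [h3] at h1
  omega

theorem mem_boundarySector {ψ : L.State} : ψ ∈ L.boundarySector b ↔
    ψ ∈ L.constrained ∧ ∀ c, (∃ p, L.IsBoundary p ∧ c p ≠ b p) → ψ c = 0 := Iff.rfl

/-- The bulk plaquettes. -/
noncomputable def bulkPlaquettes (L : TFLattice E) : Finset L.Plaquette :=
  Finset.univ.filter fun p => ¬ L.IsBoundary p

theorem mem_bulkPlaquettes : p ∈ L.bulkPlaquettes ↔ ¬ L.IsBoundary p := by simp [bulkPlaquettes]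

theorem fermionHamiltonian_apply {ψ : L.State} (hψ : ψ ∈ L.boundarySector b) :
    L.fermionHamiltonian ψ = -((L.dimers b).card : ℂ) • ψ := by
  funext c
  change -∑ l ∈ L.dimers c, L.bond l (ψ c) = -((L.dimers b).card : ℂ) • ψ c
  rw [Finset.sum_congr rfl fun l hl => hψ.1 c l hl, Finset.sum_const]
  by_cases hc : ∃ p, L.IsBoundary p ∧ c p ≠ b p
  · rw [hψ.2 c hc, smul_zero, smul_zero, neg_zero]
  · push Not at hc
    rw [card_dimers_eq hc, neg_smul, Nat.cast_smul_eq_nsmul]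

theorem bulkHamiltonian_apply {ψ : L.State} (hψ : ψ ∈ L.boundarySector b) :
    L.bulkHamiltonian ψ =
      -∑ q ∈ L.bulkPlaquettes, L.F q ψ - ((L.dimers b).card : ℂ) • ψ := by
  unfold bulkHamiltonian
  rw [LinearMap.add_apply, LinearMap.neg_apply, LinearMap.sum_apply, fermionHamiltonian_apply hψ,
    neg_smul, ← sub_eq_add_neg]
  rfl

theorem F_apply_eq_zero {ψ : L.State} (h : ψ (L.flip p c) = 0) : L.F p ψ c = 0 := by
  change L.flipFermion p (L.flip p c) (ψ (L.flip p c)) = 0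
  rw [h, map_zero]

theorem F_mem_boundarySector {ψ : L.State} (hψ : ψ ∈ L.boundarySector b) (p : L.Plaquette) :
    L.F p ψ ∈ L.boundarySector (L.flip p b) := by
  refine ⟨F_mem_constrained hψ.1 p, ?_⟩
  rintro c ⟨q, hq, hne⟩
  refine F_apply_eq_zero (hψ.2 _ ⟨q, hq, ?_⟩)
  by_cases hqp : q = p
  · subst hqp
    simpa [flip, eq_comm, Bool.not_eq_eq_eq_not] using hne
  · rw [flip_apply_of_ne hqp] at hne ⊢
    exact hne

theorem boundarySector_flip (hp : ¬ L.IsBoundary p) :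
    L.boundarySector (L.flip p b) = L.boundarySector b := by
  ext ψ
  rw [mem_boundarySector, mem_boundarySector]
  refine and_congr_right fun _ => forall_congr' fun c => imp_congr_left (exists_congr fun q =>
    and_congr_right fun hq => ?_)
  have hqp : q ≠ p := fun h => hp (h ▸ hq)
  rw [flip_apply_of_ne hqp]

theorem F_mem_boundarySector_of_not_isBoundary (hp : ¬ L.IsBoundary p) {ψ : L.State}
    (hψ : ψ ∈ L.boundarySector b) : L.F p ψ ∈ L.boundarySector b :=
  boundarySector_flip (b := b) hp ▸ F_mem_boundarySector hψ p

theorem F_comm_of_not_isBoundary (hp : ¬ L.IsBoundary p) {ψ : L.State} (hψ : ψ ∈ L.constrained) :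
    L.F p (L.F q ψ) = L.F q (L.F p ψ) :=
  F_comm (not_nearestNeighbors fun h => hp h.1) hψ

/-- A state fixed by the flips of the plaquettes in `s`, whose spins outside `s` are those of
`b`. -/
theorem exists_forall_F_eq (b : L.Config) (s : Finset L.Plaquette) (hs : s ⊆ L.bulkPlaquettes) :
    ∃ ψ ∈ L.constrained, ψ b ≠ 0 ∧ (∀ q ∈ s, L.F q ψ = ψ) ∧
      ∀ c, ψ c ≠ 0 → ∀ q ∉ s, c q = b q := by
  induction s using Finset.induction_on with
  | empty =>
    obtain ⟨v, hv⟩ : ∃ v, projOn L.majorana (L.dimers b) v ≠ 0 := by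
      by_contra h
      push Not at h
      exact projOn_ne_zero isMajorana_majorana (isMatching_dimers b) (LinearMap.ext h)
    refine ⟨_, single_mem_constrained b v, by rwa [Pi.single_eq_same], by simp, ?_⟩
    intro c hc q _
    by_contra hne
    have hcb : c ≠ b := fun h => hne (congrFun h q)
    exact hc (Pi.single_eq_of_ne hcb _)
  | insert p s hp ih =>
    obtain ⟨ψ, hψ, hb, hF, hsupp⟩ := ih ((Finset.subset_insert _ _).trans hs)
    have hpb := mem_bulkPlaquettes.1 (hs (Finset.mem_insert_self p s))
    -- Symmetrizing under `F p` keeps the invariance under the earlier flips because the bulk flips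
    -- commute.
    refine ⟨ψ + L.F p ψ, add_mem hψ (F_mem_constrained hψ p), ?_, ?_, ?_⟩
    -- The spin at `p` was still frozen in `ψ`, so the added term has no component at `b` and cannot
    -- cancel the old one.
    · have h0 : ψ (L.flip p b) = 0 := by
        by_contra h
        simpa [flip] using hsupp _ h p hp
      rwa [Pi.add_apply, F_apply_eq_zero h0, add_zero]
    · intro q hq
      rw [map_add]
      rcases Finset.mem_insert.1 hq with rfl | hq
      · rw [F_F_self hpb hψ, add_comm]
      · rw [← F_comm_of_not_isBoundary hpb hψ, hF q hq]
    · intro c hc q hq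
      rw [Finset.mem_insert, not_or] at hq
      by_cases h : ψ c = 0
      · have h' : ψ (L.flip p c) ≠ 0 := by
          intro h'
          rw [Pi.add_apply, h, F_apply_eq_zero h', add_zero] at hc
          exact hc rfl
        have := hsupp _ h' q hq.2
        rwa [flip_apply_of_ne hq.1] at this
      · exact hsupp c h q hq.2

/-- The lowest energy for the boundary spins of `b`. -/
noncomputable def groundEnergy (b : L.Config) : ℝ :=
  -(L.bulkPlaquettes.card : ℝ) - (L.dimers b).card

theorem sum_F_eq_of_bulkHamiltonian {ψ : L.State} (hψ : ψ ∈ L.boundarySector b) {e : ℝ}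
    (h : L.bulkHamiltonian ψ = (e : ℂ) • ψ) :
    ∑ q ∈ L.bulkPlaquettes, L.F q ψ = ((-e - (L.dimers b).card : ℝ) : ℂ) • ψ := by
  rw [bulkHamiltonian_apply hψ] at h
  push_cast
  linear_combination (norm := module) -h

/-- The fermion term is constant in the sector, and each bulk flip contributes at most one; a state
fixed by all of them attains the bound. -/
theorem isLeast_groundEnergy (b : L.Config) : IsLeast (L.sectorEnergies b) (groundEnergy b) := by
  constructor
  · obtain ⟨ψ, hψ, hb, hF, hsupp⟩ := exists_forall_F_eq b L.bulkPlaquettes subset_rfl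
    have hmem : ψ ∈ L.boundarySector b := by
      refine ⟨hψ, ?_⟩
      rintro c ⟨p, hp, hne⟩
      by_contra h
      exact hne (hsupp c h p fun h' => mem_bulkPlaquettes.1 h' hp)
    refine ⟨ψ, hmem, fun h => hb (by rw [h]; rfl), ?_⟩
    rw [bulkHamiltonian_apply hmem, Finset.sum_congr rfl hF, Finset.sum_const,
      ← Nat.cast_smul_eq_nsmul ℂ]
    unfold groundEnergy
    push_cast
    module
  · rintro e ⟨ψ, hψ, h0, h⟩
    have := le_card_of_sum_apply_eq_smul (W := L.boundarySector b) L.bulkPlaquettes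
      (fun q hq φ hφ => F_mem_boundarySector_of_not_isBoundary (mem_bulkPlaquettes.1 hq) hφ)
      (fun q hq φ hφ => F_F_self (mem_bulkPlaquettes.1 hq) hφ.1)
      (fun q hq r _ φ hφ => F_comm_of_not_isBoundary (mem_bulkPlaquettes.1 hq) hφ.1) hψ h0
      (sum_F_eq_of_bulkHamiltonian hψ h)
    unfold groundEnergy
    linarith

/-- In a ground state the bulk flips sum to their number, and this persists under `F p`, which
commutes with them. The fermion energy may change with the boundary spins, but so does the lowest
energy of the new sector. -/
theorem F_mem_groundManifold (p : L.Plaquette) {ψ : L.State} (hψ : ψ ∈ L.groundManifold) :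
    L.F p ψ ∈ L.groundManifold := by
  have hle : L.groundManifold ≤ L.groundManifold.comap (L.F p) := by
    refine Submodule.span_le.2 ?_
    rintro ψ ⟨b, hψ, e, he, h⟩
    refine Submodule.subset_span ⟨L.flip p b, F_mem_boundarySector hψ p, _,
      isLeast_groundEnergy _, ?_⟩
    have hsum := sum_F_eq_of_bulkHamiltonian hψ h
    rw [he.unique (isLeast_groundEnergy b)] at hsum
    have hsum' : ∑ q ∈ L.bulkPlaquettes, L.F q (L.F p ψ) =
        ((-groundEnergy b - (L.dimers b).card : ℝ) : ℂ) • L.F p ψ := by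
      rw [← map_smul, ← hsum, map_sum]
      exact Finset.sum_congr rfl fun q hq =>
        F_comm_of_not_isBoundary (mem_bulkPlaquettes.1 hq) hψ.1
    rw [bulkHamiltonian_apply (F_mem_boundarySector hψ p), hsum']
    unfold groundEnergy
    push_cast
    module
  exact hle hψ

end TFLattice

/-! ### The proposition. -/

theorem proposition1 {E : Type*} [Finite E] (L : TFLattice E) :
    (∀ p : L.Plaquette, ∀ ψ ∈ L.constrained, L.F p ψ ∈ L.constrained) ∧
    (∀ p q : L.Plaquette, ¬ (L.IsBoundary p ∧ L.IsBoundary q) →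
      ∀ ψ ∈ L.constrained, L.F p (L.F q ψ) = L.F q (L.F p ψ)) ∧
    (∀ p q : L.Plaquette, L.IsBoundary p → L.IsBoundary q → ¬ L.NearestNeighbors p q →
      ∀ ψ ∈ L.constrained, L.F p (L.F q ψ) = L.F q (L.F p ψ)) ∧
    (∀ p q : L.Plaquette, (∃! d, d ∈ L.sharedBoundaryVertices p q) →
      ∃ ψ ∈ L.constrained, L.F p (L.F q ψ) ≠ L.F q (L.F p ψ)) ∧
    (∀ p : L.Plaquette, L.IsBoundary p →
      ∀ ψ ∈ L.groundManifold, L.F p ψ ∈ L.groundManifold) := by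
  refine ⟨fun p ψ hψ => TFLattice.F_mem_constrained hψ p,
    fun p q h ψ hψ => TFLattice.F_comm (TFLattice.not_nearestNeighbors h) hψ,
    fun p q _ _ h ψ hψ => TFLattice.F_comm h hψ, ?_,
    fun p _ ψ hψ => TFLattice.F_mem_groundManifold p hψ⟩
  -- The half-edge at the unique shared vertex may have either plaquette on its left; the second
  -- case exchanges `p` and `q`.
  rintro p q ⟨d, ⟨hd, h | h⟩, hu⟩
  · exact TFLattice.exists_F_ne h hd hu
  · obtain ⟨ψ, hψ, hne⟩ := TFLattice.exists_F_ne h hd fun d' hd' => hu d' ⟨hd'.1, hd'.2.symm⟩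
    exact ⟨ψ, hψ, hne.symm⟩
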